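/- Let $F$ be a field with $\operatorname{char}(F)\neq 2,3$. **Conventions.** A *non-unital cubic norm structure* over $F$ is a quadruple $\mathcal J=(J,N,\sharp,T)$ with $J$ an $F$-vector space (of arbitrary dimension), maps $N\colon J\to F$ and $\sharp\colon J\to J$, and a symmetric $F$-bilinear form $T$ (the trace) such that $(ta)^\sharp=t^2a^\sharp$, $N(ta)=t^3N(a)$, $N(a+b)=N(a)+T(b,a^\sharp)+T(a,b^\sharp)+N(b)$ and $a^{\sharp\sharp}=N(a)a$ for all $t\in F$, $a,b\in J$. Write $a\times b:=(a+b)^\sharp-a^\sharp-b^\sharp$. Let $K/F$ be a quadratic étale extension (possibly split) with non-trivial automorphism $\sigma$. A *hermitian cubic norm structure* over $K/F$ is a quadruple $(M,N,\sharp,T)$ with $M$ a $K$-module, $T\colon M\times M\to K$ hermitian (linear in the first and $\sigma$-semilinear in the second variable, $T(a,b)^\sigma=T(b,a)$), and, with $N\colon M\to K$ and $\sharp\colon M\to M$, the same identities for $t\in K$ except that $(ta)^\sharp=t^{2\sigma}a^\sharp$. In both notions $N=0$ is allowed. Its algebra with involution $\mathcal A(\mathcal K)=K\oplus M$ has $$(s,b)(t,c)=\bigl(st+T(b,c),\;sc+t^\sigma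 b+b\times c\bigr),\qquad \overline{(s,b)}=(s^\sigma,b).$$ For $\lambda\in K\setminus F$, the *$\sigma$-semilinear extension* of $\mathcal J$ to $K$ is $\mathcal J_K=(J_K,N,\sharp,T)$ with $J_K=K\otimes_FJ=J\oplus\lambda J$ and, for $a,b,c,d\in J$, $$N(a+\lambda b)=N(a)+\lambda T(b,a^\sharp)+\lambda^2T(a,b^\sharp)+\lambda^3N(b),\qquad (a+\lambda b)^\sharp=a^\sharp+\lambda^\sigma (a\times b)+\lambda^{2\sigma}b^\sharp,$$ $$T(a+\lambda b,c+\lambda d)=T(a,c)+\lambda T(b,c)+\lambda^\sigma T(a,d)+\lambda\lambda^\sigma T(b,d).$$ A *Jordan norm of degree $4$* on a unital (linear) Jordan algebra $\mathcal B$ over $F$ is a form $Q\colon\mathcal B\to F$ (homogeneous polynomial law) of degree $4$ with $Q(1)=1$, with $Q(U_xy)=Q(x)^2Q(y)$ over all scalar extensions, where $U_xy=2x(xy)-x^2y$, and such that the bilinear form $(b,c)\mapsto t(bc)$ is non-degenerate; here the trace $t$ of $Q$ is the linear form with $Q(1+\varepsilon b)=1+\varepsilon\, t(b)$ over $F[\varepsilon]/(\varepsilon^2)$.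 Put $b^\theta:=-b+\tfrac12t(b)1$. For $\mu\in F^\times$, the Cayley–Dickson algebra with involution $\mathrm{CD}(\mathcal B,\mu)=\mathcal B\oplus s_0\mathcal B$ is given by $$(b+s_0c)(d+s_0e)=\bigl(bd+\mu(ce^\theta)^\theta\bigr)+s_0\bigl(b^\theta e+(c^\theta d^\theta)^\theta\bigr),\qquad \overline{b+s_0c}=b-s_0c^\theta .$$ **Theorem.** (i) Let $\mathcal B$ be a Jordan algebra over $F$ with a Jordan norm $Q$ of degree $4$ and trace $t$, and let $\mu\in F^\times$. Then $\mathcal B_0=\{b\in\mathcal B\mid t(b)=0\}$, with $N(b)=\tfrac13t(b^3)$, $b^\sharp=b^2-\tfrac14t(b^2)1$ and $T(b,c)=t(bc)$, is a non-unital cubic norm structure over $F$; the algebra $K=F[x]/(x^2-\mu)$ is a quadratic étale extension of $F$; and, for every $\lambda\in K\setminus F$, the $\sigma$-semilinear extension $\mathcal K$ of $\mathcal B_0$ to $K$ is a hermitian cubic norm structure over $K/F$ (with non-zero norm if the norm of $\mathcal B_0$ is non-zero) and $$\mathrm{CD}(\mathcal B,\mu)\cong\mathcal A(\mathcal K)$$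 as $F$-algebras with involution. (ii) Conversely, let $\mathcal J$ be a non-unital cubic norm structure over $F$ with non-degenerate trace, let $K/F$ be a quadratic étale extension with non-trivial automorphism $\sigma$, let $\lambda\in K\setminus F$, and let $\mathcal K$ be the $\sigma$-semilinear extension of $\mathcal J$ to $K$. Then $\mathcal K$ is a hermitian cubic norm structure over $K/F$ (with non-zero norm if the norm of $\mathcal J$ is non-zero), and there are a Jordan algebra $\mathcal B$ over $F$ with a Jordan norm $Q$ of degree $4$ and some $\mu\in F^\times$ such that $$\mathcal A(\mathcal K)\cong\mathrm{CD}(\mathcal B,\mu)$$ as $F$-algebras with involution. -/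

import Mathlib

open scoped TensorProduct

universe u v w

/-! ### Jordan norms -/

section JordanNorm

variable {F : Type u} [Field F]

/-- The value in `S` of a form `Q` (a polynomial law with values in the base field) at a point of
the scalar extension `S ⊗ B`. -/
noncomputable def formEval {B : Type v} [AddCommGroup B] [Module F B] (Q : B →ₚₗ[F] F)
    (S : Type u) [CommRing S] [Algebra F S] (x : S ⊗[F] B) : S :=
  TensorProduct.rid F S (Q.toFun' S x)

/-- Evaluation of a form commutes with change of scalars. -/
theorem formEval_map {B : Type v} [AddCommGroup B] [Module F B] (Q : B →ₚₗ[F] F)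
    {S S' : Type u} [CommRing S] [Algebra F S] [CommRing S'] [Algebra F S'] (φ : S →ₐ[F] S')
    (x : S ⊗[F] B) :
    formEval Q S' (φ.toLinearMap.rTensor B x) = φ (formEval Q S x) := by
  unfold formEval
  rw [← PolynomialLaw.isCompat_apply']
  generalize Q.toFun' S x = y
  induction y with
  | zero => simp
  | tmul s r => simp
  | add a b ha hb => simp only [map_add, ha, hb]

variable {B : Type v} [NonAssocCommRing B] [Module F B]

/-- The directional derivative of the form `Q` at `1`: writing `Q(1 + ε b) = Q(1) + ε t(b)` over
the dual numbers `F[ε]`, it is the linear form `t`. For a form with `Q(1) = 1` it is called the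
trace of `Q`. -/
noncomputable def formTrace (Q : B →ₚₗ[F] F) : B →ₗ[F] F where
  toFun b := (formEval Q (DualNumber F)
    ((1 : DualNumber F) ⊗ₜ[F] (1 : B) + (DualNumber.eps : DualNumber F) ⊗ₜ[F] b)).snd
  map_add' b c := by
    have key : ∀ f : F × F →ₗ[F] F,
        formEval Q (DualNumber F) ((1 : DualNumber F) ⊗ₜ[F] (1 : B) +
            (TrivSqZeroExt.inr (f (1, 0)) : DualNumber F) ⊗ₜ[F] b +
            (TrivSqZeroExt.inr (f (0, 1)) : DualNumber F) ⊗ₜ[F] c) =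
          TrivSqZeroExt.map f (formEval Q (TrivSqZeroExt F (F × F))
            ((1 : TrivSqZeroExt F (F × F)) ⊗ₜ[F] (1 : B) +
              (TrivSqZeroExt.inr (1, 0) : TrivSqZeroExt F (F × F)) ⊗ₜ[F] b +
              (TrivSqZeroExt.inr (0, 1) : TrivSqZeroExt F (F × F)) ⊗ₜ[F] c)) := by
      intro f
      rw [← formEval_map]
      simp
    generalize hy : formEval Q (TrivSqZeroExt F (F × F))
            ((1 : TrivSqZeroExt F (F × F)) ⊗ₜ[F] (1 : B) +
              (TrivSqZeroExt.inr (1, 0) : TrivSqZeroExt F (F × F)) ⊗ₜ[F] b +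
              (TrivSqZeroExt.inr (0, 1) : TrivSqZeroExt F (F × F)) ⊗ₜ[F] c) = y at key
    have h1 := key (LinearMap.fst F F F)
    have h2 := key (LinearMap.snd F F F)
    have h3 := key (LinearMap.fst F F F + LinearMap.snd F F F)
    simp only [LinearMap.fst_apply, LinearMap.snd_apply, LinearMap.add_apply, add_zero, zero_add,
      TrivSqZeroExt.inr_zero, TensorProduct.zero_tmul] at h1 h2 h3
    rw [add_assoc, ← TensorProduct.tmul_add] at h3
    unfold DualNumber.eps
    rw [h1, h2, h3]
    simp
  map_smul' r b := by
    have h := formEval_map Q (TrivSqZeroExt.map (r • (LinearMap.id : F →ₗ[F] F)))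
      ((1 : DualNumber F) ⊗ₜ[F] (1 : B) + (DualNumber.eps : DualNumber F) ⊗ₜ[F] b)
    simp only [map_add, LinearMap.rTensor_tmul, AlgHom.toLinearMap_apply, map_one] at h
    rw [show TrivSqZeroExt.map (r • (LinearMap.id : F →ₗ[F] F)) DualNumber.eps
      = r • (DualNumber.eps : DualNumber F) by
        rw [DualNumber.eps, TrivSqZeroExt.map_inr, ← TrivSqZeroExt.inr_smul]; rfl] at h
    rw [TensorProduct.tmul_smul, TensorProduct.smul_tmul', h]
    simp

/-- A form `Q` on a unital Jordan algebra `B` is a *Jordan norm of degree `d`* if it is homogeneous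
of degree `d`, `Q(1) = 1`, it admits Jordan composition `Q(U_x y) = Q(x)² Q(y)`, where
`U_x y = 2 x (x y) - x² y`, as an identity of forms (that is, over every scalar extension), and its
trace form `(b, c) ↦ t(b c)` is nondegenerate. (For a form admitting Jordan composition, `t(b c)`
agrees with minus the second logarithmic derivative of `Q` at `1` in the directions `b`, `c`.) -/
structure IsJordanNorm [IsScalarTower F B B] [SMulCommClass F B B]
    (Q : B →ₚₗ[F] F) (d : ℕ) : Prop where
  homogeneous : ∀ (S : Type u) [CommRing S] [Algebra F S] (s : S) (x : S ⊗[F] B),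
    formEval Q S (s • x) = s ^ d * formEval Q S x
  map_one : formEval Q F ((1 : F) ⊗ₜ[F] (1 : B)) = 1
  map_U : ∀ (S : Type u) [CommRing S] [Algebra F S] (x y : S ⊗[F] B),
    formEval Q S (x * (x * y) + x * (x * y) - (x * x) * y) =
      formEval Q S x ^ 2 * formEval Q S y
  nondegenerate : ∀ b : B, (∀ c : B, formTrace Q (b * c) = 0) → b = 0

/-- The trace of a Jordan norm of degree `d` takes the value `d` at `1`. -/
theorem IsJordanNorm.trace_one [IsScalarTower F B B] [SMulCommClass F B B]
    {Q : B →ₚₗ[F] F} {d : ℕ} (hQ : IsJordanNorm Q d) : formTrace Q 1 = d := by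
  have h1 : formEval Q (DualNumber F) ((1 : DualNumber F) ⊗ₜ[F] (1 : B)) = 1 := by
    have h := formEval_map Q (Algebra.ofId F (DualNumber F)) ((1 : F) ⊗ₜ[F] (1 : B))
    rw [hQ.map_one, _root_.map_one] at h
    simpa only [LinearMap.rTensor_tmul, AlgHom.toLinearMap_apply, _root_.map_one] using h
  have h2 := hQ.homogeneous (DualNumber F) (1 + DualNumber.eps) (1 ⊗ₜ[F] (1 : B))
  rw [h1, mul_one, TensorProduct.smul_tmul', smul_eq_mul, mul_one, TensorProduct.add_tmul] at h2
  change (formEval Q (DualNumber F) _).snd = _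
  rw [h2, TrivSqZeroExt.snd_pow]
  simp

end JordanNorm

/-! ### Cubic norm structures and hermitian cubic norm structures -/

/-- The data `(J, N, ♯, T)` of a non-unital cubic norm structure over a field `F`, with `T`
bilinear. -/
structure CubicNormData (F : Type u) [Field F] (J : Type v) [AddCommGroup J] [Module F J] where
  norm : J → F
  adj : J → J
  trace : J →ₗ[F] J →ₗ[F] F

namespace CubicNormData

variable {F : Type u} [Field F] {J : Type v} [AddCommGroup J] [Module F J]

/-- The linearization `a × b = (a + b)♯ - a♯ - b♯`. -/
def cross (D : CubicNormData F J) (a b : J) : J := D.adj (a + b) - D.adj a - D.adj b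

/-- The axioms of a (not necessarily unital) cubic norm structure over `F`. -/
structure IsCubicNorm (D : CubicNormData F J) : Prop where
  trace_symm : ∀ a b, D.trace a b = D.trace b a
  adj_smul : ∀ (t : F) a, D.adj (t • a) = t ^ 2 • D.adj a
  norm_smul : ∀ (t : F) a, D.norm (t • a) = t ^ 3 * D.norm a
  norm_add : ∀ a b, D.norm (a + b) =
    D.norm a + D.trace b (D.adj a) + D.trace a (D.adj b) + D.norm b
  adj_adj : ∀ a, D.adj (D.adj a) = D.norm a • a

/-- The trace is non-degenerate. -/
def TraceNondegenerate (D : CubicNormData F J) : Prop :=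
  ∀ a, (∀ b, D.trace a b = 0) → a = 0

end CubicNormData

/-- The data `(M, N, ♯, T)` of a hermitian (non-unital) cubic norm structure over `K`. -/
structure HermitianCubicNormData (K : Type w) [CommRing K] (M : Type v) where
  norm : M → K
  adj : M → M
  trace : M → M → K

namespace HermitianCubicNormData

variable {K : Type w} [CommRing K] {M : Type v} [AddCommGroup M]

/-- The linearization `a × b = (a + b)♯ - a♯ - b♯`. -/
def cross (D : HermitianCubicNormData K M) (a b : M) : M := D.adj (a + b) - D.adj a - D.adj b

/-- The axioms of a hermitian cubic norm structure over `K/F`, where `σ` is the non-trivial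
automorphism of `K/F`. The norm is allowed to be zero. -/
structure IsHermitianCubicNorm {F : Type u} [Field F] [Algebra F K] [Module K M]
    (σ : K ≃ₐ[F] K) (D : HermitianCubicNormData K M) : Prop where
  trace_add_left : ∀ a b c, D.trace (a + b) c = D.trace a c + D.trace b c
  trace_add_right : ∀ a b c, D.trace a (b + c) = D.trace a b + D.trace a c
  trace_smul_smul : ∀ (s t : K) a b, D.trace (s • a) (t • b) = s * σ t * D.trace a b
  trace_conj : ∀ a b, σ (D.trace a b) = D.trace b a
  adj_smul : ∀ (t : K) a, D.adj (t • a) = σ t ^ 2 • D.adj a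
  norm_smul : ∀ (t : K) a, D.norm (t • a) = t ^ 3 * D.norm a
  norm_add : ∀ a b, D.norm (a + b) =
    D.norm a + D.trace b (D.adj a) + D.trace a (D.adj b) + D.norm b
  adj_adj : ∀ a, D.adj (D.adj a) = D.norm a • a

end HermitianCubicNormData

/-! ### The algebra `A(𝒦)` -/

/-- The underlying space `K ⊕ M` of the algebra with involution `A(𝒦)`, where `𝒦` is a hermitian
cubic norm structure on `M` over `K/F` and `σ` is the non-trivial automorphism of `K/F`. -/
@[nolint unusedArguments]
def HermitianAlgebra {F : Type u} [Field F] {K : Type w} [CommRing K] [Algebra F K] {M : Type v}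
    (_σ : K ≃ₐ[F] K) (_D : HermitianCubicNormData K M) : Type (max v w) := K × M

namespace HermitianAlgebra

variable {F : Type u} [Field F] {K : Type w} [CommRing K] [Algebra F K] {M : Type v}
  [AddCommGroup M] {σ : K ≃ₐ[F] K} {D : HermitianCubicNormData K M}

instance : AddCommGroup (HermitianAlgebra σ D) := inferInstanceAs (AddCommGroup (K × M))

instance [Module F M] : Module F (HermitianAlgebra σ D) := inferInstanceAs (Module F (K × M))

/-- `(s, b) (t, c) = (s t + T(b, c), s c + t^σ b + b × c)`. -/
instance [Module K M] : Mul (HermitianAlgebra σ D) where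
  mul x y := (x.1 * y.1 + D.trace x.2 y.2, x.1 • y.2 + σ y.1 • x.2 + D.cross x.2 y.2)

/-- The involution `(s, b) ↦ (s^σ, b)`. -/
instance : Star (HermitianAlgebra σ D) where
  star x := (σ x.1, x.2)

end HermitianAlgebra

/-! ### Semilinear extension of a cubic norm structure -/

section Extension

variable {F : Type u} [Field F] {K : Type w} [CommRing K] [Algebra F K]
  [Algebra.IsQuadraticExtension F K]

/-- The basis `(1, lam)` of a quadratic extension `K/F`, for `lam ∈ K ∖ F`. -/
noncomputable def quadBasis (lam : K) (hlam : lam ∉ Set.range (algebraMap F K)) :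
    Module.Basis (Fin 2) F K :=
  have : Nontrivial K := Module.nontrivial_of_finrank_pos (R := F)
    (by rw [Algebra.IsQuadraticExtension.finrank_eq_two F K]; norm_num)
  basisOfLinearIndependentOfCardEqFinrank (b := ![(1 : K), lam])
    (by
      rw [LinearIndependent.pair_iff]
      intro s t h
      have ht : t = 0 := by
        by_contra ht
        refine hlam ⟨-(t⁻¹ * s), ?_⟩
        have h' : lam = -(t⁻¹ • s • (1 : K)) := by
          have := congrArg (fun z => t⁻¹ • z) h
          simp only [smul_add, smul_zero, inv_smul_smul₀ ht] at this
          exact eq_neg_of_add_eq_zero_right this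
        rw [h', smul_smul, map_neg, Algebra.algebraMap_eq_smul_one]
      subst ht
      refine ⟨?_, rfl⟩
      simpa using h)
    (by rw [Algebra.IsQuadraticExtension.finrank_eq_two F K]; simp)

theorem quadBasis_zero (lam : K) (hlam : lam ∉ Set.range (algebraMap F K)) :
    quadBasis lam hlam 0 = 1 := by
  simp [quadBasis]

theorem quadBasis_one (lam : K) (hlam : lam ∉ Set.range (algebraMap F K)) :
    quadBasis lam hlam 1 = lam := by
  simp [quadBasis]

variable {J : Type v} [AddCommGroup J] [Module F J]

/-- The two components of an element of `J_K = K ⊗ J = J ⊕ lam J`: component `0` and component `1`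
of `a + lam b` are `a` and `b`. -/
noncomputable def extCoord (lam : K) (hlam : lam ∉ Set.range (algebraMap F K)) (i : Fin 2) :
    K ⊗[F] J →ₗ[F] J :=
  (TensorProduct.lid F J).toLinearMap ∘ₗ ((quadBasis lam hlam).coord i).rTensor J

theorem extCoord_zero (lam : K) (hlam : lam ∉ Set.range (algebraMap F K)) (a b : J) :
    extCoord lam hlam 0 ((1 : K) ⊗ₜ[F] a + lam ⊗ₜ[F] b) = a := by
  have h0 := (quadBasis lam hlam).repr_self 0
  have h1 := (quadBasis lam hlam).repr_self 1
  rw [quadBasis_zero] at h0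
  rw [quadBasis_one] at h1
  simp [extCoord, h0, h1]

theorem extCoord_one (lam : K) (hlam : lam ∉ Set.range (algebraMap F K)) (a b : J) :
    extCoord lam hlam 1 ((1 : K) ⊗ₜ[F] a + lam ⊗ₜ[F] b) = b := by
  have h0 := (quadBasis lam hlam).repr_self 0
  have h1 := (quadBasis lam hlam).repr_self 1
  rw [quadBasis_zero] at h0
  rw [quadBasis_one] at h1
  simp [extCoord, h0, h1]

/-- The `σ`-semilinear extension of a cubic norm structure over `F` to `J_K = J ⊕ lam J`, where
`lam ∈ K ∖ F`:
* `N(a + lam b) = N(a) + lam T(b, a♯) + lam² T(a, b♯) + lam³ N(b)`,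
* `(a + lam b)♯ = a♯ + lam^σ (a × b) + lam^{2σ} b♯`,
* `T(a + lam b, c + lam d) = T(a, c) + lam T(b, c) + lam^σ T(a, d) + lam lam^σ T(b, d)`. -/
noncomputable def CubicNormData.semilinearExt (D : CubicNormData F J) (σ : K ≃ₐ[F] K)
    (lam : K) (hlam : lam ∉ Set.range (algebraMap F K)) :
    HermitianCubicNormData K (K ⊗[F] J) where
  norm x :=
    let a := extCoord lam hlam 0 x
    let b := extCoord lam hlam 1 x
    algebraMap F K (D.norm a) + lam * algebraMap F K (D.trace b (D.adj a)) +
      lam ^ 2 * algebraMap F K (D.trace a (D.adj b)) + lam ^ 3 * algebraMap F K (D.norm b)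
  adj x :=
    let a := extCoord lam hlam 0 x
    let b := extCoord lam hlam 1 x
    (1 : K) ⊗ₜ[F] D.adj a + σ lam ⊗ₜ[F] D.cross a b + (σ lam ^ 2) ⊗ₜ[F] D.adj b
  trace x y :=
    let a := extCoord lam hlam 0 x
    let b := extCoord lam hlam 1 x
    let c := extCoord lam hlam 0 y
    let d := extCoord lam hlam 1 y
    algebraMap F K (D.trace a c) + lam * algebraMap F K (D.trace b c) +
      σ lam * algebraMap F K (D.trace a d) + lam * σ lam * algebraMap F K (D.trace b d)

end Extension

/-! ### The Cayley--Dickson process -/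

section CayleyDickson

variable {F : Type u} [Field F] {B : Type v} [NonAssocCommRing B] [Module F B]

/-- `b^θ = -b + ½ t(b) 1`, where `t` is the trace of `Q`. -/
noncomputable def thetaMap (Q : B →ₚₗ[F] F) (b : B) : B := -b + ((2 : F)⁻¹ * formTrace Q b) • (1 : B)

/-- The underlying space `B ⊕ s₀ B` of the Cayley--Dickson algebra `CD(B, μ)` of a Jordan algebra
`B` with Jordan norm `Q` of degree 4; the pair `(b, c)` stands for `b + s₀ c`. -/
@[nolint unusedArguments]
def CayleyDicksonAlgebra (_Q : B →ₚₗ[F] F) (_μ : F) : Type v := B × B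

namespace CayleyDicksonAlgebra

variable {Q : B →ₚₗ[F] F} {μ : F}

instance : AddCommGroup (CayleyDicksonAlgebra Q μ) := inferInstanceAs (AddCommGroup (B × B))

instance : Module F (CayleyDicksonAlgebra Q μ) := inferInstanceAs (Module F (B × B))

/-- `(b + s₀ c) (d + s₀ e) = (b d + μ (c e^θ)^θ) + s₀ (b^θ e + (c^θ d^θ)^θ)`. -/
noncomputable instance : Mul (CayleyDicksonAlgebra Q μ) where
  mul x y :=
    (x.1 * y.1 + μ • thetaMap Q (x.2 * thetaMap Q y.2),
      thetaMap Q x.1 * y.2 + thetaMap Q (thetaMap Q x.2 * thetaMap Q y.1))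

/-- The involution `b + s₀ c ↦ b - s₀ c^θ`. -/
noncomputable instance : Star (CayleyDicksonAlgebra Q μ) where
  star x := (x.1, -thetaMap Q x.2)

end CayleyDicksonAlgebra

variable [IsScalarTower F B B] [SMulCommClass F B B]

/-- The cubic norm data on the space `B₀ = {b | t(b) = 0}` of trace zero elements of a Jordan
algebra `B` with Jordan norm `Q` of degree 4: `N(b) = ⅓ t(b³)`, `b♯ = b² - ¼ t(b²) 1`,
`T(b, c) = t(b c)`. -/
noncomputable def traceZeroData {Q : B →ₚₗ[F] F} (hQ : IsJordanNorm Q 4) (h2 : (2 : F) ≠ 0) :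
    CubicNormData F (LinearMap.ker (formTrace Q)) where
  norm b := (3 : F)⁻¹ * formTrace Q ((b : B) * b * b)
  adj b := ⟨(b : B) * b - ((4 : F)⁻¹ * formTrace Q ((b : B) * b)) • (1 : B), by
    have h4 : (4 : F) ≠ 0 := by
      rw [show (4 : F) = 2 * 2 by norm_num]
      exact mul_ne_zero h2 h2
    rw [LinearMap.mem_ker, map_sub, map_smul, hQ.trace_one, smul_eq_mul]
    push_cast
    field_simp
    ring⟩
  trace := LinearMap.mk₂ F (fun b c => formTrace Q ((b : B) * (c : B)))
    (fun a b c => by simp [add_mul])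
    (fun r a b => by simp only [Submodule.coe_smul, smul_mul_assoc, map_smul])
    (fun a b c => by simp [mul_add])
    (fun r a b => by simp only [Submodule.coe_smul, mul_smul_comm, map_smul])

end CayleyDickson

/-! ### Isomorphisms of algebras with involution -/

/-- Two `F`-algebras with involution are isomorphic. -/
def AlgInvolutionIsomorphic (F : Type u) [Field F] (A : Type v) [AddCommGroup A] [Module F A]
    [Mul A] [Star A] (A' : Type w) [AddCommGroup A'] [Module F A'] [Mul A'] [Star A'] : Prop :=
  ∃ e : A ≃ₗ[F] A', (∀ x y, e (x * y) = e x * e y) ∧ ∀ x, e (star x) = star (e x)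

/-! ### The quadratic algebra `F[x]/(x² - μ)` -/

/-- The quadratic algebra `F[x]/(x² - μ)`. -/
abbrev QuadraticRoot {F : Type u} [Field F] (μ : F) : Type u :=
  AdjoinRoot (Polynomial.X ^ 2 - Polynomial.C μ : Polynomial F)

instance {F : Type u} [Field F] (μ : F) : Algebra.IsQuadraticExtension F (QuadraticRoot μ) where
  finrank_eq_two' := by
    have hne : (Polynomial.X ^ 2 - Polynomial.C μ : Polynomial F) ≠ 0 :=
      Polynomial.X_pow_sub_C_ne_zero two_pos μ
    rw [(AdjoinRoot.powerBasis hne).finrank, AdjoinRoot.powerBasis_dim,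
      Polynomial.natDegree_X_pow_sub_C]

/-! Both directions rest on one description: `B` is the sum of its scalars and a trace-zero part
`J`, with product `(s, a)(r, c) = (sr + ¼T(a, c), sc + ra + ½ a × c)` (`IsCubicDecomposition`).
Given such a splitting, choose `ι ∈ K` with `ι² = μ`; then `σ ι = -ι`. The map `(β + b) + s₀(γ + c)
↦ (β + γι, ½(b + ιc))` is the isomorphism: `θ` fixes scalars and negates `J`, which produces exactly
the signs caused by `ι^σ = -ι`. On pure tensors the trace and cross product of the semilinear
extension do not involve `λ`, so `ι` need not be related to it. The hermitian axioms for the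
extension are checked by polarizing until both sides are multiadditive and then comparing on pure
tensors.

From a Jordan norm to a cubic norm structure: composition with `U` at `1 + ½ηx`, where `η² = 0`,
shows that the logarithmic derivative of `Q` at `z` in direction `xz` is `t(x)`
(`formEval_add_smul_mul`). Carrying out two such deformations in both orders gives `t([L_x, L_y]b) =
0`, so the trace is associative. Deforming `1 + Tb` gives Newton's identities for the coefficients
of `Q(1 + Tb)`. Since the coefficient of `T⁴` is `Q(b)` and does not see the deformation, one also
gets the Cayley–Hamilton equation paired with an arbitrary `y`; nondegeneracy removes `y`. For `t(b)
= 0` this equation amounts to `b♯♯ = N(b)b`.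

From a cubic norm structure to a Jordan norm: the linearizations of `a♯♯ = N(a)a` make `F ⊕ J` a
Jordan algebra whose trace `t(s, a) = 4s` is associative and satisfies a degree 4 Cayley–Hamilton
identity (`IsQuarticTrace`). Define `Q` from the power sums `t(x^k)`. Jordan composition comes from
infinitesimal invariance: the polarized form `q` is invariant under the operators `V` up to a trace
factor, and `V_{x,z}U_x = U_xV_{z,x}` shows that `q(U_x ·, …)` transforms under `V_{z,x}` as `q`
does. For `x = 1 + Xb` with a formal parameter `X`, a symmetric form with this invariance is
determined by its value at `1` (`quadrilinear_eq_zero`), which reduces composition to `Q(x²) =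
Q(x)²`. Specializing `X = 1` reaches every `x`. -/

/-! ### Identities in linear Jordan algebras -/

section JordanIdentities

variable {A : Type*} [NonAssocCommRing A] [IsCommJordan A]

/-- The linearized Jordan identity. -/
theorem jordan_linearized (h2 : ∀ a : A, a + a = 0 → a = 0) (x y z w : A) :
    x * y * (z * w) + y * z * (x * w) + z * x * (y * w) =
      z * (x * y * w) + x * (y * z * w) + y * (z * x * w) := by
  have h := congrArg (fun f : AddMonoid.End A => f w)
    (two_nsmul_lie_lmul_lmul_add_add_eq_zero x y z)
  simp only [two_nsmul, Ring.lie_def] at h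
  have h' : x * (y * z * w) - y * z * (x * w) + (y * (z * x * w) - z * x * (y * w)) +
    (z * (x * y * w) - x * y * (z * w)) = 0 := h2 _ h
  rw [← sub_eq_zero, ← neg_eq_zero, ← h']
  abel

/-- The operator identity `V_{x,z} U_x = U_x V_{z,x}`, divided by two. -/
theorem jordan_structure_identity (h2 : ∀ a : A, a + a = 0 → a = 0) (x z y : A) :
    x * z * (x * (x * y) + x * (x * y) - x * x * y) +
        x * (z * (x * (x * y) + x * (x * y) - x * x * y)) -
        z * (x * (x * (x * y) + x * (x * y) - x * x * y)) =
      x * (x * (x * z * y + z * (x * y) - x * (z * y))) +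
        x * (x * (x * z * y + z * (x * y) - x * (z * y))) -
        x * x * (x * z * y + z * (x * y) - x * (z * y)) := by
  -- The identity is rewritten in multiplication operators: `U_x = 2L_x² - L_{x²}`, and half of
  -- `V_{x,z}` is `L_{xz} + [L_x, L_z]`. `R1` to `R4` are the relations among these operators
  -- supplied by the linearized Jordan identity.
  have J := jordan_linearized h2
  let L : A → Module.End ℤ A := LinearMap.mulLeft ℤ
  have hL : ∀ a b, L a b = a * b := fun a b => rfl
  have R1 : L x * L (x * x) = L (x * x) * L x := by
    ext w
    exact (IsJordan.lmul_lmul_comm_lmul x w).symm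
  have R2 : L (x * z) * L x + L (x * z) * L x - (L x * L (x * z) + L x * L (x * z)) =
      L z * L (x * x) - L (x * x) * L z := by
    ext w
    have h := J x x z w
    simp only [LinearMap.sub_apply, LinearMap.add_apply, Module.End.mul_apply, hL]
    rw [mul_comm z x] at h
    linear_combination (norm := module) h
  have R3 : L (x * (x * z)) = L (x * x) * L z + L (x * z) * L x + L (x * z) * L x - L x * L x * L z
      - L z * L x * L x := by
    ext w
    have h := J x z w x
    simp only [LinearMap.sub_apply, LinearMap.add_apply, Module.End.mul_apply, hL]
    rw [mul_comm w x, mul_comm z x, mul_comm (z * w), mul_comm (x * z) x, mul_comm (z * w) x,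
      mul_comm (x * w) x, mul_comm w (x * (x * z)), mul_comm (x * w) (x * z)] at h
    linear_combination (norm := module) -h
  have R4 : L (x * x) * L (x * z) - L (x * z) * L (x * x) =
      (L x * L (x * (x * z)) + L x * L (x * (x * z))) -
      (L (x * (x * z)) * L x + L (x * (x * z)) * L x) := by
    ext w
    have h := J x x (x * z) w
    simp only [LinearMap.sub_apply, LinearMap.add_apply, Module.End.mul_apply, hL]
    rw [mul_comm (x * z) x] at h
    linear_combination (norm := module) h
  rw [R3] at R4
  have key : L (x * z) * (L x * L x + L x * L x - L (x * x)) + (L x * L z - L z * L x) *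
      (L x * L x + L x * L x - L (x * x)) = (L x * L x + L x * L x - L (x * x)) *
      (L (x * z) + L z * L x - L x * L z) := by
    -- The rest is a consequence of the relations in the free associative ring on the four
    -- operators.
    generalize L x = a at *
    generalize L z = c at *
    generalize L (x * z) = p at *
    generalize L (x * x) = e at *
    linear_combination (norm := noncomm_ring) R4 + a * R2 - R2 * a + R1 * c + c * R1
  have := congrArg (fun f : Module.End ℤ A => f y) key
  simp only [LinearMap.sub_apply, LinearMap.add_apply, Module.End.mul_apply, hL] at this
  rw [← add_sub_assoc] at this
  exact this

end JordanIdentities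

/-! ### Quartic forms attached to an associative trace -/

section QuarticForm

variable {R : Type*} {A : Type*} [CommRing R] [NonAssocCommRing A] [Module R A]

/-- The full polarization of the quartic form whose power sums are `t (x ^ k)`. -/
def quarticForm (t : A →ₗ[R] R) (a b c d : A) : R :=
  t a * t b * t c * t d
    - (t (a * b) * t c * t d + t (a * c) * t b * t d + t (a * d) * t b * t c
      + t (b * c) * t a * t d + t (b * d) * t a * t c + t (c * d) * t a * t b)
    + (t (a * b) * t (c * d) + t (a * c) * t (b * d) + t (a * d) * t (b * c))
    + 2 * (t (a * b * c) * t d + t (a * b * d) * t c + t (a * c * d) * t b + t (b * c * d) * t a)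
    - 2 * (t (a * b * (c * d)) + t (a * c * (b * d)) + t (a * d * (b * c)))

/-- The polarized adjoint of the quartic form. -/
def quarticAdj (t : A →ₗ[R] R) (b c d : A) : A :=
  (t b * t c * t d - t (b * c) * t d - t (b * d) * t c - t (c * d) * t b
      + 2 * t (b * c * d)) • (1 : A)
    + ((t (c * d) - t c * t d) • b + (t (b * d) - t b * t d) • c + (t (b * c) - t b * t c) • d)
    + (2 : R) • (t d • (b * c) + t c • (b * d) + t b • (c * d))
    - (2 : R) • (b * (c * d) + c * (b * d) + d * (b * c))

/-- A linear form `t` with `t 1 = 4` on a commutative algebra is a quartic trace if it is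
associative and every element satisfies its generic polynomial of degree four, strictly. -/
structure IsQuarticTrace (t : A →ₗ[R] R) : Prop where
  assoc : ∀ a b c, t (a * b * c) = t (a * (b * c))
  one : t 1 = 4
  cayley : ∀ a b c d, a * quarticAdj t b c d + b * quarticAdj t a c d + c * quarticAdj t a b d +
    d * quarticAdj t a b c = quarticForm t a b c d • (1 : A)

variable {t : A →ₗ[R] R}

theorem quarticForm_swap₁₂ (t : A →ₗ[R] R) (a b c d : A) :
    quarticForm t b a c d = quarticForm t a b c d := by
  simp only [quarticForm, mul_comm b a, mul_comm (b * c), mul_comm (b * d)]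
  ring

theorem trace_swap_of_assoc (h : ∀ a b c, t (a * b * c) = t (a * (b * c))) (a b c : A) :
    t (a * b * c) = t (a * c * b) := by
  rw [h, mul_comm b c, ← h]

theorem quarticForm_swap₂₃_of_assoc (h : ∀ a b c, t (a * b * c) = t (a * (b * c)))
    (a b c d : A) : quarticForm t a c b d = quarticForm t a b c d := by
  simp only [quarticForm, mul_comm c b, trace_swap_of_assoc h a c b]
  ring

theorem quarticForm_swap₃₄_of_assoc (h : ∀ a b c, t (a * b * c) = t (a * (b * c)))
    (a b c d : A) : quarticForm t a b d c = quarticForm t a b c d := by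
  simp only [quarticForm, mul_comm d c, trace_swap_of_assoc h _ d c]
  ring

theorem quarticAdj_swap₁₂ (t : A →ₗ[R] R) (b c d : A) :
    quarticAdj t c b d = quarticAdj t b c d := by
  simp only [quarticAdj, mul_comm c b]
  module

theorem quarticAdj_swap₂₃_of_assoc (h : ∀ a b c, t (a * b * c) = t (a * (b * c)))
    (b c d : A) : quarticAdj t b d c = quarticAdj t b c d := by
  simp only [quarticAdj, mul_comm d c, trace_swap_of_assoc h b d c]
  module

namespace IsQuarticTrace

theorem quarticForm_swap₂₃ (ht : IsQuarticTrace t) (a b c d : A) :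
    quarticForm t a c b d = quarticForm t a b c d :=
  quarticForm_swap₂₃_of_assoc ht.assoc a b c d

theorem quarticForm_swap₃₄ (ht : IsQuarticTrace t) (a b c d : A) :
    quarticForm t a b d c = quarticForm t a b c d :=
  quarticForm_swap₃₄_of_assoc ht.assoc a b c d

theorem quarticForm_eq [SMulCommClass R A A] (ht : IsQuarticTrace t) (a b c d : A) :
    quarticForm t a b c d = t (a * quarticAdj t b c d) := by
  simp only [quarticForm, quarticAdj, mul_add, mul_sub, map_add, map_sub, mul_smul_comm, map_smul,
    smul_eq_mul, mul_one, ht.assoc]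
  ring

/-- The quartic form is invariant up to the factor `t u` under multiplication by `u`. -/
theorem quarticForm_mul [SMulCommClass R A A] (ht : IsQuarticTrace t) (u a b c d : A) :
    quarticForm t (u * a) b c d + quarticForm t a (u * b) c d + quarticForm t a b (u * c) d +
      quarticForm t a b c (u * d) = t u * quarticForm t a b c d := by
  have h1 : quarticForm t a (u * b) c d = quarticForm t (u * b) a c d :=
    quarticForm_swap₁₂ t _ _ _ _
  have h2 : quarticForm t a b (u * c) d = quarticForm t (u * c) a b d := by
    rw [← ht.quarticForm_swap₂₃, quarticForm_swap₁₂]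
  have h3 : quarticForm t a b c (u * d) = quarticForm t (u * d) a b c := by
    rw [← ht.quarticForm_swap₃₄, ← ht.quarticForm_swap₂₃, quarticForm_swap₁₂]
  -- Writing the form as `t(a · adj(b, c, d))`, associativity extracts `u` from all four terms; what
  -- remains inside the trace is the linearized Cayley–Hamilton expression, a scalar.
  rw [h1, h2, h3, ht.quarticForm_eq, ht.quarticForm_eq, ht.quarticForm_eq, ht.quarticForm_eq,
    ht.assoc, ht.assoc, ht.assoc, ht.assoc, ← map_add, ← map_add, ← map_add, ← mul_add, ← mul_add,
    ← mul_add, ht.cayley, mul_smul_comm, mul_one, map_smul, smul_eq_mul, mul_comm]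

end IsQuarticTrace

theorem quarticForm_add (t : A →ₗ[R] R) (a a' b c d : A) :
    quarticForm t (a + a') b c d = quarticForm t a b c d + quarticForm t a' b c d := by
  simp only [quarticForm, add_mul, map_add]
  ring

theorem quarticForm_sub (t : A →ₗ[R] R) (a a' b c d : A) :
    quarticForm t (a - a') b c d = quarticForm t a b c d - quarticForm t a' b c d := by
  simp only [quarticForm, sub_mul, map_sub]
  ring

theorem quarticForm_smul [IsScalarTower R A A] (t : A →ₗ[R] R) (r : R) (a b c d : A) :
    quarticForm t (r • a) b c d = r * quarticForm t a b c d := by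
  simp only [quarticForm, smul_mul_assoc, map_smul, smul_eq_mul]
  ring

end QuarticForm

/-! ### Jordan composition for the quartic form -/

section JordanComposition

variable {R : Type*} {A : Type*} [CommRing R] [NonAssocCommRing A] [Module R A]

/-- The quadratic operator `U_x y = 2 x (x y) - x² y` of a Jordan algebra. -/
def jordanU (x y : A) : A := x * (x * y) + x * (x * y) - x * x * y

variable [IsScalarTower R A A]

/-- A linear form vanishing on the multiples of `1 + s b` vanishes if no nonzero scalar is
divisible by all powers of `s`. -/
theorem linear_eq_zero_of_mul_one_add_smul {s : R} (hs : ∀ c : R, (∀ n, s ^ n ∣ c) → c = 0) {b : A}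
    {f : A → R} (hadd : ∀ a a', f (a + a') = f a + f a') (hsmul : ∀ (r : R) a, f (r • a) = r * f a)
    (h : ∀ z, f ((1 + s • b) * z) = 0) (v : A) : f v = 0 := by
  have hstep : ∀ v, f v = -s * f (b * v) := by
    intro v
    have := h v
    rw [add_mul, one_mul, smul_mul_assoc, hadd, hsmul] at this
    linear_combination this
  have hpow : ∀ n v, s ^ n ∣ f v := by
    intro n
    induction n with
    | zero => simp
    | succ n ih =>
      intro v
      rw [hstep v, pow_succ', neg_mul]
      exact (mul_dvd_mul_left s (ih _)).neg_right
  exact hs _ fun n => hpow n v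

/-- A symmetric quadrilinear form which is infinitesimally invariant under the operators
`V_{z,x}`, where `x = 1 + s b`, is determined by its value at `1`. -/
theorem quadrilinear_eq_zero {i : R} (hi : 24 * i = 1) {s : R}
    (hs : ∀ c : R, (∀ n, s ^ n ∣ c) → c = 0) {e x : A} (hx : x = 1 + s • e)
    {H : A → A → A → A → R}
    (hadd : ∀ a a' b c d, H (a + a') b c d = H a b c d + H a' b c d)
    (hsmul : ∀ (r : R) a b c d, H (r • a) b c d = r * H a b c d)
    (h₁₂ : ∀ a b c d, H b a c d = H a b c d) (h₂₃ : ∀ a b c d, H a c b d = H a b c d)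
    (h₃₄ : ∀ a b c d, H a b d c = H a b c d) {τ : A → R}
    {W : A → A → A} (hW : ∀ z, W z 1 = x * z)
    (hinv : ∀ z a b c d, H (W z a) b c d + H a (W z b) c d + H a b (W z c) d + H a b c (W z d) =
      τ z * H a b c d) (h1 : H 1 1 1 1 = 0) (a b c d : A) : H a b c d = 0 := by
  have key : ∀ a b c, (∀ z, H (x * z) a b c = 0) → ∀ v, H v a b c = 0 := by
    intro a b c h v
    refine linear_eq_zero_of_mul_one_add_smul (b := e) hs (f := fun v => H v a b c)
      (fun _ _ => hadd _ _ _ _ _) (fun _ _ => hsmul _ _ _ _ _) (fun z => ?_) v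
    rw [← hx]
    exact h z
  have h₁₃ : ∀ a b c d, H c b a d = H a b c d := fun a b c d => by
    rw [h₁₂, h₂₃, h₁₂]
  have h₁₄ : ∀ a b c d, H d b c a = H a b c d := fun a b c d => by
    rw [← h₃₄, h₁₃, h₃₄]
  -- Induction on the number of arguments different from `1`. Since `W z 1 = xz`, invariance at a
  -- tuple with `k` ones gives `k` copies of the form with one `1` replaced by `xz`, and all other
  -- terms vanish by the previous stage; `k` divides `24`.
  have e1 : ∀ v, H v 1 1 1 = 0 := by
    refine key _ _ _ fun z => ?_
    have := hinv z 1 1 1 1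
    rw [hW, h₁₂ (x * z), h₁₃ (x * z), h₁₄ (x * z), h1] at this
    linear_combination (6 * i) * this - H (x * z) 1 1 1 * hi
  have e2 : ∀ w v, H v w 1 1 = 0 := by
    refine fun w => key _ _ _ fun z => ?_
    have := hinv z w 1 1 1
    rw [hW, e1, e1, h₁₂ (x * z) w, h₁₃ (x * z) 1 w, h₁₄ (x * z) 1 1 w, h₃₄ _ 1 w 1,
      h₂₃ _ w 1 1] at this
    linear_combination (8 * i) * this - H (x * z) w 1 1 * hi
  have e3 : ∀ u w v, H v u w 1 = 0 := by
    refine fun u w => key _ _ _ fun z => ?_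
    have := hinv z w u 1 1
    rw [hW, e2, e2, e2, h₁₃ (x * z) u w, h₁₄ (x * z) u 1 w, h₃₄ _ u w 1] at this
    linear_combination (12 * i) * this - H (x * z) u w 1 * hi
  rw [← h₁₄]
  refine key _ _ _ (fun z => ?_) d
  have := hinv z a b c 1
  rw [hW, e3, e3, e3, e3, h₁₄ (x * z)] at this
  linear_combination this

variable {t : A →ₗ[R] R}

namespace IsQuarticTrace

-- The operator is `L_{xz} + [L_x, L_z]`, and each `L_u` scales the form infinitesimally by `t u`.
-- Scalars commute, so the commutator contributes nothing.
omit [IsScalarTower R A A] in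
theorem quarticForm_V [SMulCommClass R A A] (ht : IsQuarticTrace t) (x z a b c d : A) :
    quarticForm t (x * z * a + x * (z * a) - z * (x * a)) b c d +
      quarticForm t a (x * z * b + x * (z * b) - z * (x * b)) c d +
      quarticForm t a b (x * z * c + x * (z * c) - z * (x * c)) d +
      quarticForm t a b c (x * z * d + x * (z * d) - z * (x * d)) =
      t (x * z) * quarticForm t a b c d := by
  have add₂ : ∀ a b b' c d, quarticForm t a (b + b') c d =
      quarticForm t a b c d + quarticForm t a b' c d := fun a b b' c d => by
    rw [quarticForm_swap₁₂, quarticForm_add, quarticForm_swap₁₂, quarticForm_swap₁₂ _ b']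
  have add₃ : ∀ a b c c' d, quarticForm t a b (c + c') d =
      quarticForm t a b c d + quarticForm t a b c' d := fun a b c c' d => by
    rw [ht.quarticForm_swap₂₃, add₂, ht.quarticForm_swap₂₃, ht.quarticForm_swap₂₃ _ c']
  have add₄ : ∀ a b c d d', quarticForm t a b c (d + d') =
      quarticForm t a b c d + quarticForm t a b c d' := fun a b c d d' => by
    rw [ht.quarticForm_swap₃₄, add₃, ht.quarticForm_swap₃₄, ht.quarticForm_swap₃₄ _ _ d']
  have sub₂ : ∀ a b b' c d, quarticForm t a (b - b') c d =
      quarticForm t a b c d - quarticForm t a b' c d := fun a b b' c d => by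
    rw [eq_sub_iff_add_eq, ← add₂, sub_add_cancel]
  have sub₃ : ∀ a b c c' d, quarticForm t a b (c - c') d =
      quarticForm t a b c d - quarticForm t a b c' d := fun a b c c' d => by
    rw [eq_sub_iff_add_eq, ← add₃, sub_add_cancel]
  have sub₄ : ∀ a b c d d', quarticForm t a b c (d - d') =
      quarticForm t a b c d - quarticForm t a b c d' := fun a b c d d' => by
    rw [eq_sub_iff_add_eq, ← add₄, sub_add_cancel]
  simp only [quarticForm_add, quarticForm_sub, add₂, add₃, add₄, sub₂, sub₃, sub₄]
  have m := ht.quarticForm_mul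
  linear_combination m (x * z) a b c d + m x (z * a) b c d + m x a (z * b) c d +
    m x a b (z * c) d + m x a b c (z * d) - m z (x * a) b c d - m z a (x * b) c d -
    m z a b (x * c) d - m z a b c (x * d) + t x * m z a b c d - t z * m x a b c d

variable [SMulCommClass R A A] [IsCommJordan A]

-- The Jordan identity enters only through power associativity. Cayley–Hamilton gives a recursion
-- for the power sums `t(x^k)`, and those of `x²`, with `k = 2, 4, 6, 8`, become polynomials in the
-- elementary symmetric `e₁, …, e₄`. In these terms `Q(x²) = e₄²`.
omit [IsScalarTower R A A] in
theorem quarticForm_sq (ht : IsQuarticTrace t) {i : R} (hi : 24 * i = 1) (x : A) :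
    24 * quarticForm t (x * x) (x * x) (x * x) (x * x) = quarticForm t x x x x ^ 2 := by
  set x₂ := x * x with hx₂
  set x₃ := x * x₂ with hx₃
  set x₄ := x * x₃ with hx₄
  have m22 : x₂ * x₂ = x₄ := by
    rw [hx₄, hx₃, hx₂, IsCommJordan.lmul_comm_rmul_rmul]
  have m23 : x₂ * x₃ = x * x₄ := by
    rw [← m22, hx₃, hx₂, IsJordan.lmul_lmul_comm_lmul]
  have m32 : x₂ * x = x₃ := mul_comm _ _
  have m42 : x₃ * x = x₄ := mul_comm _ _
  obtain ⟨e₁, he₁⟩ : ∃ e, t x = e := ⟨_, rfl⟩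
  -- With `i = 1/24`, the factors `12i`, `4i` and `i` are the denominators `1/2`, `1/6` and `1/24`
  -- of Newton's formulas.
  obtain ⟨e₂, he₂⟩ : ∃ e, e = 12 * i * (t x ^ 2 - t x₂) := ⟨_, rfl⟩
  obtain ⟨e₃, he₃⟩ : ∃ e, e = 4 * i * (t x ^ 3 - 3 * t x * t x₂ + 2 * t x₃) := ⟨_, rfl⟩
  obtain ⟨e₄, he₄⟩ : ∃ e, e = i * quarticForm t x x x x := ⟨_, rfl⟩
  have hq : quarticForm t x x x x = 24 * e₄ := by
    linear_combination -quarticForm t x x x x * hi - 24 * he₄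
  have hx4 : x₄ = e₁ • x₃ - e₂ • x₂ + e₃ • x - e₄ • (1 : A) := by
    have hc := ht.cayley x x x x
    rw [he₂, he₃, he₄, ← he₁, mul_smul i, ← hc]
    simp only [quarticAdj, mul_add, mul_sub, mul_smul_comm, mul_one, ← hx₂, ← hx₃, ← hx₄, m32]
    linear_combination (norm := module) (t x • hi) • x₃ - hi • x₄
  have p2 : t x₂ = e₁ ^ 2 - 2 * e₂ := by
    rw [he₂, ← he₁]
    linear_combination (t x ^ 2 - t x₂) * hi
  have p3 : t x₃ = e₁ ^ 3 - 3 * e₁ * e₂ + 3 * e₃ := by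
    rw [he₂, he₃, ← he₁]
    linear_combination (t x ^ 3 - t x₃) * hi
  have r : ∀ y, t (y * x₄) = e₁ * t (y * x₃) - e₂ * t (y * x₂) + e₃ * t (y * x) - e₄ * t y := by
    intro y
    rw [hx4]
    simp only [mul_add, mul_sub, mul_smul_comm, map_add, map_sub, map_smul, smul_eq_mul, mul_one]
  have p4 := r 1
  rw [one_mul, one_mul, one_mul, one_mul, ht.one, he₁, p2, p3] at p4
  have p5 := r x
  rw [← hx₄, ← hx₃, ← hx₂, he₁, p2, p3, p4] at p5
  have p6 := r x₂
  rw [m23, m22, m32, p2, p3, p4, p5] at p6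
  have p7 := r x₃
  rw [show t (x₃ * x₃) = t (x₂ * x₄) by
      rw [hx₃, ht.assoc, ← hx₃, m23, ← ht.assoc], mul_comm x₃ x₂, m23, m42, p3, p4, p5, p6] at p7
  have p8 := r x₄
  rw [mul_comm x₄ x₃, mul_comm x₄ x₂, mul_comm x₄ x, p4, p5, p6, p7] at p8
  rw [hq, quarticForm, m22, mul_comm x₄ x₂, p2, p4, p6, p8]
  ring

/-- Jordan composition for the quartic form, for `x = 1 + s b` with `s` a formal parameter. -/
theorem quarticForm_jordanU_of_one_add_smul (ht : IsQuarticTrace t) {i : R} (hi : 24 * i = 1)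
    {s : R} (hs : ∀ c : R, (∀ n, s ^ n ∣ c) → c = 0) {b x : A} (hx : x = 1 + s • b) (y : A) :
    576 * quarticForm t (jordanU x y) (jordanU x y) (jordanU x y) (jordanU x y) =
      quarticForm t x x x x ^ 2 * quarticForm t y y y y := by
  have h2 : ∀ a : A, a + a = 0 → a = 0 := by
    intro a ha
    have : a = (12 * i : R) • (a + a) := by
      rw [← two_smul R a, smul_smul, mul_right_comm, show (12 : R) * 2 = 24 by norm_num, hi,
        one_smul]
    rw [this, ha, smul_zero]
  have hU1 : jordanU x 1 = x * x := by simp [jordanU]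
  have hUadd : ∀ a b, jordanU x (a + b) = jordanU x a + jordanU x b := fun a b => by
    simp only [jordanU, mul_add]; abel
  have hUsmul : ∀ (r : R) a, jordanU x (r • a) = r • jordanU x a := fun r a => by
    simp only [jordanU, mul_smul_comm, smul_add, smul_sub]
  -- At `a = b = c = d = 1` the two terms cancel, because `U_x 1 = x²` and the polarized form takes
  -- the value `24` at `1`. Both terms have the same factor `t(xz)` under `V_{z,x}`.
  have h := quadrilinear_eq_zero hi hs hx (H := fun a b c d =>
      24 * quarticForm t (jordanU x a) (jordanU x b) (jordanU x c) (jordanU x d) -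
        quarticForm t (x * x) (x * x) (x * x) (x * x) * quarticForm t a b c d)
    (fun a a' b c d => by simp only [hUadd, quarticForm_add]; ring)
    (fun r a b c d => by simp only [hUsmul, quarticForm_smul]; ring)
    (fun a b c d => by
      rw [quarticForm_swap₁₂, quarticForm_swap₁₂ t a])
    (fun a b c d => by
      rw [ht.quarticForm_swap₂₃, ht.quarticForm_swap₂₃ a])
    (fun a b c d => by
      rw [ht.quarticForm_swap₃₄, ht.quarticForm_swap₃₄ a])
    (W := fun z a => x * z * a + z * (x * a) - x * (z * a)) (τ := fun z => t (x * z))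
    (fun z => by rw [mul_one, mul_one, mul_one, mul_comm z x, add_sub_cancel_right])
    (fun z a b c d => by
      have hUW : ∀ a, jordanU x (x * z * a + z * (x * a) - x * (z * a)) =
        x * z * jordanU x a + x * (z * jordanU x a) - z * (x * jordanU x a) :=
        fun a => (jordan_structure_identity h2 x z a).symm
      have h1 := ht.quarticForm_V x z (jordanU x a) (jordanU x b) (jordanU x c) (jordanU x d)
      have h2 := ht.quarticForm_V z x a b c d
      rw [mul_comm z x] at h2
      simp only [hUW]
      linear_combination 24 * h1 - quarticForm t (x * x) (x * x) (x * x) (x * x) * h2)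
    (by
      have h1 : quarticForm t (1 : A) 1 1 1 = 24 := by
        simp only [quarticForm, mul_one, ht.one]
        norm_num
      simp only [hU1, h1]
      ring) y y y y
  linear_combination 24 * h + quarticForm t y y y y * ht.quarticForm_sq hi x

end IsQuarticTrace

end JordanComposition

/-! ### Checking multiadditive identities on pure tensors -/

section TensorInduction

variable {F S B M : Type*} [CommSemiring F] [AddCommMonoid S] [Module F S] [AddCommMonoid B]
  [Module F B] [AddCommGroup M]

/-- An additive map on a tensor product vanishes if it vanishes on pure tensors. -/
theorem additive_eq_zero_of_tmul (f : S ⊗[F] B → M) (hf : ∀ x y, f (x + y) = f x + f y)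
    (h : ∀ k b, f (k ⊗ₜ b) = 0) (x : S ⊗[F] B) : f x = 0 := by
  induction x with
  | zero => simpa using hf 0 0
  | tmul k b => exact h k b
  | add x y hx hy => rw [hf, hx, hy, add_zero]

/-- A biadditive map on a tensor product vanishes if it vanishes on pure tensors. -/
theorem biadditive_eq_zero_of_tmul (Φ : S ⊗[F] B → S ⊗[F] B → M)
    (h₁ : ∀ a a' b, Φ (a + a') b = Φ a b + Φ a' b)
    (h₂ : ∀ a b b', Φ a (b + b') = Φ a b + Φ a b')
    (h : ∀ (k l : S) (a b : B), Φ (k ⊗ₜ a) (l ⊗ₜ b) = 0) (a b : S ⊗[F] B) : Φ a b = 0 :=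
  additive_eq_zero_of_tmul (fun a => Φ a b) (fun _ _ => h₁ _ _ _)
    (fun k a => additive_eq_zero_of_tmul (Φ (k ⊗ₜ a)) (h₂ _) (fun _ _ => h _ _ _ _) b) a

/-- A triadditive map on a tensor product vanishes if it vanishes on pure tensors. -/
theorem triadditive_eq_zero_of_tmul (Φ : S ⊗[F] B → S ⊗[F] B → S ⊗[F] B → M)
    (h₁ : ∀ a a' b c, Φ (a + a') b c = Φ a b c + Φ a' b c)
    (h₂ : ∀ a b b' c, Φ a (b + b') c = Φ a b c + Φ a b' c)
    (h₃ : ∀ a b c c', Φ a b (c + c') = Φ a b c + Φ a b c')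
    (h : ∀ (k₁ k₂ k₃ : S) (a b c : B), Φ (k₁ ⊗ₜ a) (k₂ ⊗ₜ b) (k₃ ⊗ₜ c) = 0)
    (a b c : S ⊗[F] B) : Φ a b c = 0 :=
  additive_eq_zero_of_tmul (fun a => Φ a b c) (fun _ _ => h₁ _ _ _ _)
    (fun k a => biadditive_eq_zero_of_tmul (Φ (k ⊗ₜ a)) (h₂ _) (h₃ _)
      (fun _ _ _ _ => h _ _ _ _ _ _) b c) a

/-- A quadriadditive map on a tensor product vanishes if it vanishes on pure tensors. -/
theorem quadriadditive_eq_zero_of_tmul (Φ : S ⊗[F] B → S ⊗[F] B → S ⊗[F] B → S ⊗[F] B → M)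
    (h₁ : ∀ a a' b c d, Φ (a + a') b c d = Φ a b c d + Φ a' b c d)
    (h₂ : ∀ a b b' c d, Φ a (b + b') c d = Φ a b c d + Φ a b' c d)
    (h₃ : ∀ a b c c' d, Φ a b (c + c') d = Φ a b c d + Φ a b c' d)
    (h₄ : ∀ a b c d d', Φ a b c (d + d') = Φ a b c d + Φ a b c d')
    (h : ∀ (k₁ k₂ k₃ k₄ : S) (a b c d : B),
      Φ (k₁ ⊗ₜ a) (k₂ ⊗ₜ b) (k₃ ⊗ₜ c) (k₄ ⊗ₜ d) = 0) (a b c d : S ⊗[F] B) : Φ a b c d = 0 :=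
  additive_eq_zero_of_tmul (fun a => Φ a b c d) (fun _ _ => h₁ _ _ _ _ _)
    (fun k a => triadditive_eq_zero_of_tmul (Φ (k ⊗ₜ a)) (h₂ _) (h₃ _) (h₄ _)
      (fun _ _ _ _ _ _ => h _ _ _ _ _ _ _ _) b c d) a

end TensorInduction

section Additivity

variable {R : Type*} {A : Type*} [CommRing R] [NonAssocCommRing A] [Module R A] (t : A →ₗ[R] R)

theorem quarticForm_add₂ (a b b' c d : A) :
    quarticForm t a (b + b') c d = quarticForm t a b c d + quarticForm t a b' c d := by
  simp only [quarticForm, add_mul, mul_add, map_add]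
  ring

theorem quarticForm_add₃ (a b c c' d : A) :
    quarticForm t a b (c + c') d = quarticForm t a b c d + quarticForm t a b c' d := by
  simp only [quarticForm, add_mul, mul_add, map_add]
  ring

theorem quarticForm_add₄ (a b c d d' : A) :
    quarticForm t a b c (d + d') = quarticForm t a b c d + quarticForm t a b c d' := by
  simp only [quarticForm, add_mul, mul_add, map_add]
  ring

theorem quarticAdj_add₁ (b b' c d : A) :
    quarticAdj t (b + b') c d = quarticAdj t b c d + quarticAdj t b' c d := by
  simp only [quarticAdj, add_mul, mul_add, map_add]
  module

theorem quarticAdj_add₂ (b c c' d : A) :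
    quarticAdj t b (c + c') d = quarticAdj t b c d + quarticAdj t b c' d := by
  simp only [quarticAdj, add_mul, mul_add, map_add]
  module

theorem quarticAdj_add₃ (b c d d' : A) :
    quarticAdj t b c (d + d') = quarticAdj t b c d + quarticAdj t b c d' := by
  simp only [quarticAdj, add_mul, mul_add, map_add]
  module

end Additivity

/-! ### Scalar extension of Jordan algebras and quartic traces -/

section BaseChange

variable {F : Type u} [Field F] {B : Type v} [NonAssocCommRing B] [Module F B]
  [IsScalarTower F B B] [SMulCommClass F B B]

/-- The scalar extension of a commutative nonassociative algebra. -/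
noncomputable abbrev tensorNonAssocCommRing (S : Type w) [CommRing S] [Algebra F S] :
    NonAssocCommRing (S ⊗[F] B) where
  __ := (Algebra.TensorProduct.instNonAssocRing : NonAssocRing (S ⊗[F] B))
  mul_comm a b := by
    rw [← sub_eq_zero]
    refine biadditive_eq_zero_of_tmul (fun a b : S ⊗[F] B => a * b - b * a) ?_ ?_ ?_ a b
    · intro a a' b
      simp only [add_mul, mul_add]
      abel
    · intro a b b'
      simp only [add_mul, mul_add]
      abel
    · intro k l a b
      simp only [Algebra.TensorProduct.tmul_mul_tmul, mul_comm, sub_self]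

attribute [local instance] tensorNonAssocCommRing

/-- The scalar extension of a linear form. -/
noncomputable def traceExt (S : Type w) [CommSemiring S] [Algebra F S] (t : B →ₗ[F] F) :
    S ⊗[F] B →ₗ[S] S :=
  (Algebra.linearMap F S ∘ₗ t).liftBaseChange S

omit [IsScalarTower F B B] [SMulCommClass F B B] in
theorem traceExt_tmul (S : Type w) [CommSemiring S] [Algebra F S] (t : B →ₗ[F] F) (s : S) (b : B) :
    traceExt S t (s ⊗ₜ b) = s * algebraMap F S (t b) := rfl

variable (S : Type w) [CommRing S] [Algebra F S] {t : B →ₗ[F] F}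

/-- The Jordan identity is cubic in `a`, so pure tensors do not suffice. Its full linearization is
multiadditive and does pass to the tensor product; on the diagonal it returns three times the
identity. -/
theorem isCommJordan_tensor [IsCommJordan B] (h2 : (2 : F) ≠ 0) (h3 : (3 : F) ≠ 0) :
    IsCommJordan (S ⊗[F] B) where
  lmul_comm_rmul_rmul a b := by
    have hB : ∀ a : B, a + a = 0 → a = 0 := fun a ha => by
      rw [← two_smul F] at ha
      exact (smul_eq_zero.1 ha).resolve_left h2
    have h := quadriadditive_eq_zero_of_tmul (fun x y z w : S ⊗[F] B =>
      x * y * (z * w) + y * z * (x * w) + z * x * (y * w) -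
      (z * (x * y * w) + x * (y * z * w) + y * (z * x * w)))
      (by intros; simp only [add_mul, mul_add]; abel)
      (by intros; simp only [add_mul, mul_add]; abel)
      (by intros; simp only [add_mul, mul_add]; abel)
      (by intros; simp only [mul_add]; abel)
      (by
        intro k₁ k₂ k₃ k₄ x y z w
        have hJ := jordan_linearized hB x y z w
        simp only [Algebra.TensorProduct.tmul_mul_tmul]
        rw [show k₂ * k₃ * (k₁ * k₄) = k₁ * k₂ * (k₃ * k₄) by ring,
          show k₃ * k₁ * (k₂ * k₄) = k₁ * k₂ * (k₃ * k₄) by ring,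
          show k₃ * (k₁ * k₂ * k₄) = k₁ * k₂ * (k₃ * k₄) by ring,
          show k₁ * (k₂ * k₃ * k₄) = k₁ * k₂ * (k₃ * k₄) by ring,
          show k₂ * (k₃ * k₁ * k₄) = k₁ * k₂ * (k₃ * k₄) by ring,
          ← TensorProduct.tmul_add, ← TensorProduct.tmul_add, ← TensorProduct.tmul_add,
          ← TensorProduct.tmul_add, hJ, sub_self]) a a a b
    rw [mul_comm b (a * a), mul_comm (a * b)]
    have h' : (3 : F) • (a * a * (a * b) - a * (a * a * b)) = 0 := by
      rw [← h]
      module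
    exact sub_eq_zero.1 ((smul_eq_zero.1 h').resolve_left h3)

theorem quarticAdj_tmul (k₂ k₃ k₄ : S) (b c d : B) :
    quarticAdj (traceExt S t) (k₂ ⊗ₜ b) (k₃ ⊗ₜ c) (k₄ ⊗ₜ d) =
      (k₂ * k₃ * k₄) ⊗ₜ[F] quarticAdj t b c d := by
  have h : ∀ (k : S) (b : B), k ⊗ₜ[F] b = k • ((1 : S) ⊗ₜ[F] b) := fun k b => by
    rw [TensorProduct.smul_tmul', smul_eq_mul, mul_one]
  have h' : ∀ (r : F) (k : S) (b : B), k ⊗ₜ[F] (r • b) = (k * algebraMap F S r) ⊗ₜ[F] b :=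
    fun r k b => by
      rw [TensorProduct.tmul_smul, TensorProduct.smul_tmul', Algebra.smul_def, mul_comm]
  simp only [quarticAdj, Algebra.TensorProduct.tmul_mul_tmul, traceExt_tmul,
    Algebra.TensorProduct.one_def, TensorProduct.tmul_add, TensorProduct.tmul_sub, h', map_add,
    map_sub, map_mul, map_ofNat]
  simp only [h (_ * _), h k₂, h k₃, h k₄]
  module

theorem quarticForm_tmul (k₁ k₂ k₃ k₄ : S) (a b c d : B) :
    quarticForm (traceExt S t) (k₁ ⊗ₜ a) (k₂ ⊗ₜ b) (k₃ ⊗ₜ c) (k₄ ⊗ₜ d) =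
      k₁ * k₂ * k₃ * k₄ * algebraMap F S (quarticForm t a b c d) := by
  simp only [quarticForm, Algebra.TensorProduct.tmul_mul_tmul, traceExt_tmul, map_add,
    map_sub, map_mul, map_ofNat]
  ring

theorem IsQuarticTrace.baseChange (ht : IsQuarticTrace t) : IsQuarticTrace (traceExt S t) where
  assoc a b c := by
    rw [← sub_eq_zero]
    refine triadditive_eq_zero_of_tmul (fun a b c : S ⊗[F] B =>
      traceExt S t (a * b * c) - traceExt S t (a * (b * c)))
      (fun _ _ _ _ => ?_) (fun _ _ _ _ => ?_) (fun _ _ _ _ => ?_) (fun _ _ _ _ _ _ => ?_) a b c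
    · simp only [add_mul, map_add]
      ring
    · simp only [add_mul, mul_add, map_add]
      ring
    · simp only [mul_add, map_add]
      ring
    · simp only [Algebra.TensorProduct.tmul_mul_tmul, traceExt_tmul, ht.assoc]
      ring
  one := by
    rw [Algebra.TensorProduct.one_def, traceExt_tmul, ht.one, one_mul, map_ofNat]
  cayley a b c d := by
    rw [← sub_eq_zero]
    refine quadriadditive_eq_zero_of_tmul (fun a b c d : S ⊗[F] B =>
      a * quarticAdj (traceExt S t) b c d + b * quarticAdj (traceExt S t) a c d +
      c * quarticAdj (traceExt S t) a b d + d * quarticAdj (traceExt S t) a b c -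
      quarticForm (traceExt S t) a b c d • (1 : S ⊗[F] B)) (fun _ _ _ _ _ => ?_)
      (fun _ _ _ _ _ => ?_) (fun _ _ _ _ _ => ?_) (fun _ _ _ _ _ => ?_)
      (fun k₁ k₂ k₃ k₄ a b c d => ?_) a b c d
    · simp only [quarticAdj_add₁, quarticForm_add, add_mul, mul_add, add_smul]
      abel
    · simp only [quarticAdj_add₁, quarticAdj_add₂, quarticForm_add₂, add_mul, mul_add, add_smul]
      abel
    · simp only [quarticAdj_add₂, quarticAdj_add₃, quarticForm_add₃, add_mul, mul_add, add_smul]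
      abel
    · simp only [quarticAdj_add₃, quarticForm_add₄, add_mul, mul_add, add_smul]
      abel
    · simp only [quarticAdj_tmul, quarticForm_tmul, Algebra.TensorProduct.tmul_mul_tmul,
        Algebra.TensorProduct.one_def, TensorProduct.smul_tmul', smul_eq_mul, mul_one]
      rw [show k₂ * (k₁ * k₃ * k₄) = k₁ * (k₂ * k₃ * k₄) by ring,
        show k₃ * (k₁ * k₂ * k₄) = k₁ * (k₂ * k₃ * k₄) by ring,
        show k₄ * (k₁ * k₂ * k₃) = k₁ * (k₂ * k₃ * k₄) by ring,
        show k₁ * k₂ * k₃ * k₄ = k₁ * (k₂ * k₃ * k₄) by ring,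
        ← TensorProduct.tmul_add, ← TensorProduct.tmul_add, ← TensorProduct.tmul_add, ht.cayley,
        TensorProduct.tmul_smul, TensorProduct.smul_tmul', Algebra.smul_def, mul_comm, sub_self]

end BaseChange

/-! ### The quartic form as a polynomial law, and its Jordan norm property -/

section QuarticLaw

variable {F : Type u} [Field F] {B : Type v} [NonAssocCommRing B] [Module F B]

section ChangeOfScalars

variable {S S' : Type w} [CommSemiring S] [Algebra F S] [CommSemiring S'] [Algebra F S']
  (φ : S →ₐ[F] S')

theorem rTensor_smul_tensor (s : S) (x : S ⊗[F] B) :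
    φ.toLinearMap.rTensor B (s • x) = φ s • φ.toLinearMap.rTensor B x := by
  induction x with
  | zero => simp
  | tmul k b => simp [TensorProduct.smul_tmul']
  | add x y hx hy => simp only [smul_add, map_add, hx, hy]

theorem traceExt_rTensor (t : B →ₗ[F] F) (x : S ⊗[F] B) :
    traceExt S' t (φ.toLinearMap.rTensor B x) = φ (traceExt S t x) := by
  induction x with
  | zero => simp
  | tmul k b => simp [traceExt_tmul]
  | add x y hx hy => simp only [map_add, hx, hy]

variable [IsScalarTower F B B] [SMulCommClass F B B]

theorem rTensor_mul_tensor (x y : S ⊗[F] B) :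
    φ.toLinearMap.rTensor B (x * y) = φ.toLinearMap.rTensor B x * φ.toLinearMap.rTensor B y := by
  induction x with
  | zero => simp
  | tmul k b =>
    induction y with
    | zero => simp
    | tmul l c => simp [Algebra.TensorProduct.tmul_mul_tmul]
    | add x y hx hy => simp only [mul_add, map_add, hx, hy]
  | add x y hx hy => simp only [add_mul, map_add, hx, hy]

omit [IsScalarTower F B B] [SMulCommClass F B B] in
theorem rTensor_one_tensor : φ.toLinearMap.rTensor B (1 : S ⊗[F] B) = 1 := by
  simp [Algebra.TensorProduct.one_def]

end ChangeOfScalars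

variable [IsScalarTower F B B] [SMulCommClass F B B]

/-- The quartic form with power sums `t (x ^ k)`, in terms of the extended trace. -/
noncomputable def quarticLawEval (t : B →ₗ[F] F) (S : Type w) [CommSemiring S] [Algebra F S]
    (x : S ⊗[F] B) : S :=
  -- A polynomial law must be defined over commutative semirings, so the signs are placed in scalars
  -- from `F`.
  (24 : F)⁻¹ • (traceExt S t x ^ 4 + (-6 : F) • (traceExt S t x ^ 2 * traceExt S t (x * x)) +
    (3 : F) • traceExt S t (x * x) ^ 2 + (8 : F) • (traceExt S t x * traceExt S t (x * x * x)) +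
    (-6 : F) • traceExt S t (x * x * (x * x)))

/-- The quartic form with power sums `t (x ^ k)`. -/
noncomputable def quarticLaw (t : B →ₗ[F] F) : B →ₚₗ[F] F where
  toFun' S _ _ x := quarticLawEval t S x ⊗ₜ[F] (1 : F)
  isCompat' {S _ _ S' _ _} φ := by
    ext x
    simp [quarticLawEval, ← rTensor_mul_tensor, traceExt_rTensor]

theorem formEval_quarticLaw (t : B →ₗ[F] F) (S : Type u) [CommRing S] [Algebra F S]
    (x : S ⊗[F] B) : formEval (quarticLaw t) S x = quarticLawEval t S x := by
  change TensorProduct.rid F S (quarticLawEval t S x ⊗ₜ[F] (1 : F)) = _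
  rw [TensorProduct.rid_tmul, one_smul]

attribute [local instance] tensorNonAssocCommRing

theorem quarticForm_eq_quarticLawEval (h24 : (24 : F) ≠ 0) (t : B →ₗ[F] F) (S : Type w)
    [CommRing S] [Algebra F S] (x : S ⊗[F] B) :
    quarticForm (traceExt S t) x x x x = 24 * quarticLawEval t S x := by
  have h : (24 : S) * algebraMap F S 24⁻¹ = 1 := by
    rw [← map_ofNat (algebraMap F S), ← map_mul, mul_inv_cancel₀ h24, map_one]
  simp only [quarticLawEval, quarticForm, Algebra.smul_def, map_neg, map_ofNat]
  linear_combination (-(traceExt S t x ^ 4 + (-6) * (traceExt S t x ^ 2 * traceExt S t (x * x)) +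
    3 * traceExt S t (x * x) ^ 2 + 8 * (traceExt S t x * traceExt S t (x * x * x)) +
    (-6) * traceExt S t (x * x * (x * x)))) * h

theorem formTrace_quarticLaw (h24 : (24 : F) ≠ 0) {t : B →ₗ[F] F} (ht1 : t 1 = 4) :
    formTrace (quarticLaw t) = t := by
  ext b
  change (formEval (quarticLaw t) (DualNumber F) _).snd = t b
  have he : (DualNumber.eps : DualNumber F) * DualNumber.eps = 0 := DualNumber.eps_mul_eps
  have e2 : (DualNumber.eps * algebraMap F (DualNumber F) (t b)) ^ 2 = 0 := by
    rw [mul_pow, sq DualNumber.eps, he, zero_mul]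
  have key : quarticLawEval t (DualNumber F)
      ((1 : DualNumber F) ⊗ₜ[F] (1 : B) + (DualNumber.eps : DualNumber F) ⊗ₜ[F] b) =
      1 + DualNumber.eps * algebraMap F (DualNumber F) (t b) := by
    -- The `k`-th power sum of `1 + εb` is `4 + kε t(b)`; substitution leaves `24(1 + ε t(b))`
    -- before division.
    simp only [quarticLawEval, add_mul, mul_add, Algebra.TensorProduct.tmul_mul_tmul, mul_one,
      one_mul, he, TensorProduct.zero_tmul, add_zero, map_add, traceExt_tmul, ht1,
      map_ofNat]
    rw [inv_smul_eq_iff₀ h24]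
    simp only [Algebra.smul_def, map_neg, map_ofNat]
    generalize DualNumber.eps * algebraMap F (DualNumber F) (t b) = e at e2
    linear_combination (e ^ 2 + 4 * e + 12) * e2
  rw [formEval_quarticLaw, key, TrivSqZeroExt.snd_add, TrivSqZeroExt.snd_one, zero_add,
    TrivSqZeroExt.algebraMap_eq_inl, TrivSqZeroExt.snd_mul]
  simp

theorem isJordanNorm_quarticLaw [IsCommJordan B] (h2 : (2 : F) ≠ 0) (h3 : (3 : F) ≠ 0)
    {t : B →ₗ[F] F} (ht : IsQuarticTrace t) (hnd : ∀ b, (∀ c, t (b * c) = 0) → b = 0) :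
    IsJordanNorm (quarticLaw t) 4 := by
  have h24 : (24 : F) ≠ 0 := by
    rw [show (24 : F) = 2 * 2 * 2 * 3 by norm_num]
    exact mul_ne_zero (mul_ne_zero (mul_ne_zero h2 h2) h2) h3
  refine ⟨fun S _ _ s x => ?_, ?_, fun S _ _ x y => ?_, ?_⟩
  · simp only [formEval_quarticLaw, quarticLawEval, smul_mul_assoc, mul_smul_comm, map_smul,
      smul_eq_mul, Algebra.smul_def]
    ring
  · simp only [formEval_quarticLaw, quarticLawEval, Algebra.TensorProduct.tmul_mul_tmul, mul_one,
      traceExt_tmul, ht.one, smul_eq_mul, Algebra.algebraMap_self_apply]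
    rw [inv_mul_eq_one₀ h24]
    norm_num
  · simp only [formEval_quarticLaw]
    have hJ := isCommJordan_tensor (B := B) (Polynomial S) h2 h3
    have hT := ht.baseChange (Polynomial S)
    have hi : (24 : Polynomial S) * algebraMap F (Polynomial S) 24⁻¹ = 1 := by
      rw [← map_ofNat (algebraMap F (Polynomial S)), ← map_mul, mul_inv_cancel₀ h24, map_one]
    have hi' : algebraMap F S 24⁻¹ * (24 : S) = 1 := by
      rw [← map_ofNat (algebraMap F S), ← map_mul, inv_mul_cancel₀ h24, map_one]
    let φ : S →ₐ[F] Polynomial S := Polynomial.CAlgHom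
    let ψ : Polynomial S →ₐ[F] S := (Polynomial.aeval (1 : S)).restrictScalars F
    have hψφ : ∀ z : S ⊗[F] B, ψ.toLinearMap.rTensor B (φ.toLinearMap.rTensor B z) = z := by
      intro z
      rw [← LinearMap.comp_apply, ← LinearMap.rTensor_comp,
        show ψ.toLinearMap ∘ₗ φ.toLinearMap = LinearMap.id by ext; simp [φ, ψ],
        LinearMap.rTensor_id, LinearMap.id_apply]
    have hψX : ψ Polynomial.X = 1 := by simp [ψ]
    -- The point `1 + X(x - 1)` specializes to `x` at `X = 1`, and a polynomial divisible by every
    -- power of `X` is zero. Hence composition over `S[X]` yields composition at an arbitrary point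
    -- over `S`.
    obtain ⟨x', hx'⟩ : ∃ x' : Polynomial S ⊗[F] B,
      x' = 1 + (Polynomial.X : Polynomial S) • (φ.toLinearMap.rTensor B x - 1) := ⟨_, rfl⟩
    have hx : ψ.toLinearMap.rTensor B x' = x := by
      rw [hx', map_add, rTensor_smul_tensor, map_sub, hψφ, hψX, rTensor_one_tensor, one_smul,
        add_sub_cancel]
    have h := hT.quarticForm_jordanU_of_one_add_smul hi (s := Polynomial.X)
      (fun c hc => by
        ext n
        rw [Polynomial.coeff_zero]
        exact Polynomial.X_pow_dvd_iff.1 (hc (n + 1)) n n.lt_succ_self) hx'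
      (φ.toLinearMap.rTensor B y)
    rw [quarticForm_eq_quarticLawEval h24, quarticForm_eq_quarticLawEval h24,
      quarticForm_eq_quarticLawEval h24] at h
    have hc : ∀ z, ψ (quarticLawEval t _ z) = quarticLawEval t S (ψ.toLinearMap.rTensor B z) :=
      fun z => by
        simp [quarticLawEval, ← rTensor_mul_tensor, traceExt_rTensor]
    have h' := congrArg ψ h
    simp only [map_mul, map_pow, map_ofNat, hc, jordanU, map_add, map_sub, rTensor_mul_tensor, hx,
      hψφ] at h'
    have hi3 : algebraMap F S 24⁻¹ ^ 3 * 24 ^ 3 = 1 := by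
      rw [← mul_pow, hi', one_pow]
    linear_combination algebraMap F S 24⁻¹ ^ 3 * h' - (quarticLawEval t S
      (x * (x * y) + x * (x * y) - x * x * y) -
        quarticLawEval t S x ^ 2 * quarticLawEval t S y) * hi3
  · rw [formTrace_quarticLaw h24 ht.one]
    exact hnd

end QuarticLaw

/-! ### Recovering symmetric quadriadditive maps from their diagonal -/

section Polarization

/-- A symmetric quadriadditive map with vanishing diagonal is zero when `24` is invertible. -/
theorem quadriadditive_eq_zero_of_diagonal {F A M : Type*} [Field F] [AddCommGroup A] [Module F A]
    [AddCommGroup M] [Module F M] (h24 : (24 : F) ≠ 0)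
    (Φ : A → A → A → A → M) (hadd : ∀ a a' b c d, Φ (a + a') b c d = Φ a b c d + Φ a' b c d)
    (h₁₂ : ∀ a b c d, Φ b a c d = Φ a b c d) (h₂₃ : ∀ a b c d, Φ a c b d = Φ a b c d)
    (h₃₄ : ∀ a b c d, Φ a b d c = Φ a b c d) (hdiag : ∀ a, Φ a a a a = 0) (a b c d : A) :
    Φ a b c d = 0 := by
  have tor : ∀ m : M, (24 : F) • m = 0 → m = 0 := fun m hm => (smul_eq_zero.1 hm).resolve_left h24
  have add₂ : ∀ a b b' c d, Φ a (b + b') c d = Φ a b c d + Φ a b' c d := fun a b b' c d => by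
    rw [h₁₂, hadd, h₁₂, h₁₂ _ b']
  have add₃ : ∀ a b c c' d, Φ a b (c + c') d = Φ a b c d + Φ a b c' d := fun a b c c' d => by
    rw [h₂₃, add₂, h₂₃, h₂₃ _ c']
  have add₄ : ∀ a b c d d', Φ a b c (d + d') = Φ a b c d + Φ a b c d' := fun a b c d d' => by
    rw [h₃₄, add₃, h₃₄, h₃₄ _ _ d']
  have exp : ∀ x y, (4 : F) • Φ x x x y + (6 : F) • Φ x x y y + (4 : F) • Φ x y y y = 0 := by
    intro x y
    have h := hdiag (x + y)
    simp only [hadd, add₂, add₃, add₄, hdiag] at h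
    rw [h₁₂ x y x x, h₁₂ x y x y, h₁₂ x y y x, h₂₃ y x y x, h₁₂ x y y x, h₂₃ y x y y,
      h₃₄ y y x y, h₂₃ y x y y, h₁₂ x y y y, h₃₄ x y x y, h₂₃ x x y y, h₂₃ x x y x,
      h₃₄ x x x y] at h
    linear_combination (norm := module) h
  have e22 : ∀ x y, Φ x x y y = 0 := by
    intro x y
    have h1 := exp x y
    have h2 := exp x (y + y)
    have h3 := exp x (y + y + y)
    simp only [add₂, add₃, add₄] at h2 h3
    refine tor _ ?_
    -- The three equations for `y`, `2y`, `3y` form a Vandermonde system; this combination cancels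
    -- the terms of degree 1 and 3 in `y` and leaves `24 Φ(x, x, y, y)`.
    linear_combination (norm := module) (-10 : F) • h1 + (8 : F) • h2 - (2 : F) • h3
  have e21 : ∀ x y z, Φ x x y z = 0 := by
    intro x y z
    have h := e22 x (y + z)
    rw [add₃, add₄, add₄, e22, e22, h₃₄ x x y z] at h
    refine tor _ ?_
    linear_combination (norm := module) (12 : F) • h
  have h := e21 (a + b) c d
  rw [hadd, add₂, add₂, e21, e21, h₁₂ a b] at h
  refine tor _ ?_
  linear_combination (norm := module) (12 : F) • h

/-- The linearized Cayley-Hamilton identity follows from the Cayley-Hamilton identity. -/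
theorem IsQuarticTrace.of_diagonal {F A : Type*} [Field F] [NonAssocCommRing A] [Module F A]
    (h24 : (24 : F) ≠ 0) {t : A →ₗ[F] F} (hassoc : ∀ a b c, t (a * b * c) = t (a * (b * c)))
    (hone : t 1 = 4)
    (hdiag : ∀ x, (4 : F) • (x * quarticAdj t x x x) = quarticForm t x x x x • (1 : A)) :
    IsQuarticTrace t where
  assoc := hassoc
  one := hone
  cayley a b c d := by
    rw [← sub_eq_zero]
    have s₁₂ := quarticAdj_swap₁₂ t
    have s₂₃ := quarticAdj_swap₂₃_of_assoc hassoc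
    refine quadriadditive_eq_zero_of_diagonal h24 (fun a b c d : A =>
      a * quarticAdj t b c d + b * quarticAdj t a c d +
      c * quarticAdj t a b d + d * quarticAdj t a b c -
      quarticForm t a b c d • (1 : A)) (fun a a' b c d => ?_)
      (fun a b c d => ?_) (fun a b c d => ?_) (fun a b c d => ?_) (fun x => ?_) a b c d
    · simp only [quarticAdj_add₁, quarticForm_add, add_mul, mul_add, add_smul]
      abel
    · rw [quarticForm_swap₁₂, s₁₂ a b d, s₁₂ a b c]
      abel
    · rw [quarticForm_swap₂₃_of_assoc hassoc, s₁₂ b c d, s₂₃ a b c]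
      abel
    · rw [quarticForm_swap₃₄_of_assoc hassoc, s₂₃ b c d, s₂₃ a c d]
      abel
    · rw [← hdiag]
      module

end Polarization

/-! ### Identities in non-unital cubic norm structures -/

namespace CubicNormData

variable {F : Type u} [Field F] {J : Type v} [AddCommGroup J] [Module F J] {D : CubicNormData F J}

namespace IsCubicNorm

/-- Expand `N(a + b + c)` with the two bracketings and compare the mixed terms. -/
theorem trace_cross (hD : D.IsCubicNorm) (a b c : J) :
    D.trace (D.cross a b) c = D.trace a (D.cross b c) := by
  have h1 := hD.norm_add (a + b) c
  have h2 := hD.norm_add a (b + c)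
  rw [add_assoc, h2, hD.norm_add a b, hD.norm_add b c] at h1
  rw [hD.trace_symm, cross, cross]
  simp only [map_add, map_sub, LinearMap.add_apply] at h1 ⊢
  linear_combination -h1

theorem cross_comm (D : CubicNormData F J) (a b : J) : D.cross a b = D.cross b a := by
  rw [cross, cross, add_comm a b]
  abel

theorem trace_cross' (hD : D.IsCubicNorm) (a b c : J) :
    D.trace (D.cross a b) c = D.trace (D.cross a c) b := by
  rw [hD.trace_cross, cross_comm, ← hD.trace_cross]

theorem eq_of_trace (hnd : D.TraceNondegenerate) {a b : J}
    (h : ∀ c, D.trace a c = D.trace b c) : a = b := by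
  rw [← sub_eq_zero]
  exact hnd _ fun c => by rw [map_sub, LinearMap.sub_apply, h, sub_self]

/-- Additivity of `×` is not an axiom. It holds because `T(a × b, d) = T(a × d, b)` is linear in `b`
and the trace separates points. -/
theorem cross_add (hD : D.IsCubicNorm) (hnd : D.TraceNondegenerate) (a b c : J) :
    D.cross a (b + c) = D.cross a b + D.cross a c := by
  refine eq_of_trace hnd fun d => ?_
  rw [hD.trace_cross', map_add, map_add, LinearMap.add_apply, hD.trace_cross',
    hD.trace_cross' a d c]

theorem cross_smul (hD : D.IsCubicNorm) (hnd : D.TraceNondegenerate) (r : F) (a b : J) :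
    D.cross a (r • b) = r • D.cross a b := by
  refine eq_of_trace hnd fun d => ?_
  rw [hD.trace_cross', map_smul, map_smul, LinearMap.smul_apply, hD.trace_cross']

theorem add_cross (hD : D.IsCubicNorm) (hnd : D.TraceNondegenerate) (a b c : J) :
    D.cross (a + b) c = D.cross a c + D.cross b c := by
  rw [cross_comm, hD.cross_add hnd, cross_comm, cross_comm D c]

theorem smul_cross (hD : D.IsCubicNorm) (hnd : D.TraceNondegenerate) (r : F) (a b : J) :
    D.cross (r • a) b = r • D.cross a b := by
  rw [cross_comm, hD.cross_smul hnd, cross_comm]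

theorem cross_self (hD : D.IsCubicNorm) (a : J) : D.cross a a = (2 : F) • D.adj a := by
  rw [cross, ← two_smul F a, hD.adj_smul]
  module

theorem adj_eq (hD : D.IsCubicNorm) (h2 : (2 : F) ≠ 0) (a : J) :
    D.adj a = (2 : F)⁻¹ • D.cross a a := by
  rw [hD.cross_self, inv_smul_smul₀ h2]

/-- Euler's relation, obtained by computing `N(2a)` by homogeneity and by the addition formula. -/
theorem trace_self_adj (hD : D.IsCubicNorm) (h2 : (2 : F) ≠ 0) (a : J) :
    D.trace a (D.adj a) = 3 * D.norm a := by
  have h := hD.norm_add a a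
  rw [← two_smul F a, hD.norm_smul] at h
  refine mul_left_cancel₀ h2 ?_
  linear_combination -h

theorem trace_cross_self (hD : D.IsCubicNorm) (h2 : (2 : F) ≠ 0) (a : J) :
    D.trace (D.cross a a) a = 6 * D.norm a := by
  rw [hD.cross_self, hD.trace_symm, map_smul, hD.trace_self_adj h2, smul_eq_mul]
  ring

/-- The full linearization of `a♯♯ = N(a) a`. -/
theorem adj_adj_linearized (hD : D.IsCubicNorm) (hnd : D.TraceNondegenerate) (h24 : (24 : F) ≠ 0)
    (a b c d : J) :
    D.cross (D.cross a b) (D.cross c d) + D.cross (D.cross a c) (D.cross b d) +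
      D.cross (D.cross a d) (D.cross b c) =
    D.trace (D.cross a b) c • d + D.trace (D.cross a b) d • c + D.trace (D.cross a c) d • b +
      D.trace (D.cross b c) d • a := by
  have h2 : (2 : F) ≠ 0 := fun h => h24 (by rw [show (24 : F) = 2 * 12 by norm_num, h, zero_mul])
  rw [← sub_eq_zero]
  refine quadriadditive_eq_zero_of_diagonal h24 (fun a b c d : J =>
    D.cross (D.cross a b) (D.cross c d) + D.cross (D.cross a c) (D.cross b d) +
      D.cross (D.cross a d) (D.cross b c) -
    (D.trace (D.cross a b) c • d + D.trace (D.cross a b) d • c + D.trace (D.cross a c) d • b +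
      D.trace (D.cross b c) d • a)) (fun a a' b c d => ?_) (fun a b c d => ?_) (fun a b c d => ?_)
      (fun a b c d => ?_) (fun a => ?_) a b c d
  · simp only [hD.add_cross hnd, map_add, LinearMap.add_apply]
    module
  · simp only [cross_comm D b a]
    rw [cross_comm D (D.cross b c), cross_comm D (D.cross b d)]
    module
  · rw [cross_comm D c b, hD.trace_cross' a c b]
    module
  · rw [cross_comm D d c, hD.trace_cross' a d c, hD.trace_cross' b d c]
    module
  -- On the diagonal `a × a = 2a♯` and `T(a × a, a) = 6N(a)`, so both sides equal `24N(a)a`.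
  · rw [hD.trace_cross_self h2, hD.cross_self a, hD.smul_cross hnd, hD.cross_smul hnd,
      hD.cross_self, hD.adj_adj]
    module

/-- The linearization `a♯ × (a × c) = N(a) c + T(c, a♯) a`. -/
theorem adj_cross_cross (hD : D.IsCubicNorm) (hnd : D.TraceNondegenerate) (h2 : (2 : F) ≠ 0)
    (h3 : (3 : F) ≠ 0) (a c : J) :
    D.cross (D.adj a) (D.cross a c) = D.norm a • c + D.trace c (D.adj a) • a := by
  have h24 : (24 : F) ≠ 0 := by
    rw [show (24 : F) = 2 * 2 * 2 * 3 by norm_num]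
    exact mul_ne_zero (mul_ne_zero (mul_ne_zero h2 h2) h2) h3
  have h := hD.adj_adj_linearized hnd h24 a a a c
  rw [hD.trace_cross_self h2, hD.cross_self, hD.smul_cross hnd, map_smul, LinearMap.smul_apply,
    cross_comm D (D.cross a c), hD.smul_cross hnd, hD.trace_symm _ c, smul_eq_mul] at h
  have h6 : (6 : F) ≠ 0 := by
    rw [show (6 : F) = 2 * 3 by norm_num]
    exact mul_ne_zero h2 h3
  refine (smul_right_injective J h6) ?_
  dsimp only
  linear_combination (norm := module) h

/-- The identity `a × (a♯ × c) = N(a) c + T(a, c) a♯`. -/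
theorem cross_adj_cross (hD : D.IsCubicNorm) (hnd : D.TraceNondegenerate) (h2 : (2 : F) ≠ 0)
    (h3 : (3 : F) ≠ 0) (a c : J) :
    D.cross a (D.cross (D.adj a) c) = D.norm a • c + D.trace a c • D.adj a := by
  -- Multiplication by a fixed element under `×` is self-adjoint for `T`, so this identity is the
  -- transpose of `adj_cross_cross`.
  refine eq_of_trace hnd fun d => ?_
  rw [hD.trace_cross', cross_comm D (D.adj a), ← hD.trace_cross, hD.trace_cross',
    cross_comm D _ (D.adj a), hD.adj_cross_cross hnd h2 h3]
  simp only [map_add, map_smul, LinearMap.add_apply, LinearMap.smul_apply, smul_eq_mul]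
  rw [hD.trace_symm d c, hD.trace_symm d (D.adj a)]
  ring

end IsCubicNorm

end CubicNormData

/-! ### The Jordan algebra `F ⊕ J` and its quartic trace -/

namespace CubicNormData

variable {F : Type u} [Field F] {J : Type v} [AddCommGroup J] [Module F J]

/-- The bilinear product `a ∘ b = ½ (a × b)`. -/
def dot (D : CubicNormData F J) (a b : J) : J := (2 : F)⁻¹ • D.cross a b

/-- The rescaled trace form `¼ T(a, b)`. -/
def form (D : CubicNormData F J) : J →ₗ[F] J →ₗ[F] F := (4 : F)⁻¹ • D.trace

/-- The rescaled norm `¼ N(a)`. -/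
def nu (D : CubicNormData F J) (a : J) : F := (4 : F)⁻¹ * D.norm a

variable {D : CubicNormData F J}

theorem dot_comm (D : CubicNormData F J) (a b : J) : D.dot a b = D.dot b a := by
  rw [dot, dot, IsCubicNorm.cross_comm]

namespace IsCubicNorm

theorem form_symm (hD : D.IsCubicNorm) (a b : J) : D.form a b = D.form b a := by
  simp only [form, LinearMap.smul_apply, hD.trace_symm a b]

theorem form_dot (hD : D.IsCubicNorm) (a b c : J) :
    D.form (D.dot a b) c = D.form a (D.dot b c) := by
  simp only [form, dot, LinearMap.smul_apply, map_smul, hD.trace_cross a b c]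

theorem form_dot' (hD : D.IsCubicNorm) (a b c : J) :
    D.form (D.dot a b) c = D.form (D.dot a c) b := by
  rw [hD.form_dot, dot_comm, ← hD.form_dot]

theorem dot_self (hD : D.IsCubicNorm) (h2 : (2 : F) ≠ 0) (a : J) : D.dot a a = D.adj a := by
  rw [dot, hD.adj_eq h2]

theorem form_adj (hD : D.IsCubicNorm) (h2 : (2 : F) ≠ 0) (a : J) :
    D.form a (D.adj a) = 3 * D.nu a := by
  simp only [form, nu, LinearMap.smul_apply, hD.trace_self_adj h2, smul_eq_mul]
  ring

section

variable (hD : D.IsCubicNorm) (hnd : D.TraceNondegenerate)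
include hD hnd

theorem dot_add (a b c : J) : D.dot a (b + c) = D.dot a b + D.dot a c := by
  rw [dot, hD.cross_add hnd, smul_add, dot, dot]

theorem add_dot (a b c : J) : D.dot (a + b) c = D.dot a c + D.dot b c := by
  rw [dot, hD.add_cross hnd, smul_add, dot, dot]

theorem dot_smul (r : F) (a b : J) : D.dot a (r • b) = r • D.dot a b := by
  rw [dot, hD.cross_smul hnd, smul_comm, dot]

theorem smul_dot (r : F) (a b : J) : D.dot (r • a) b = r • D.dot a b := by
  rw [dot, hD.smul_cross hnd, smul_comm, dot]

/-- The two halves in the nested `dot` give the quarter built into `nu` and `form`, so the identity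
for `×` keeps its shape without further constants. -/
theorem adj_dot_dot (h2 : (2 : F) ≠ 0) (h3 : (3 : F) ≠ 0) (a c : J) :
    D.dot (D.adj a) (D.dot a c) = D.nu a • c + D.form c (D.adj a) • a := by
  have h4 : (2 : F)⁻¹ * 2⁻¹ = 4⁻¹ := by rw [← mul_inv]; norm_num
  rw [dot, dot, hD.cross_smul hnd, hD.adj_cross_cross hnd h2 h3, smul_smul, h4, smul_add, smul_smul,
    smul_smul, nu, form, LinearMap.smul_apply, LinearMap.smul_apply, smul_eq_mul]

theorem dot_adj_dot (h2 : (2 : F) ≠ 0) (h3 : (3 : F) ≠ 0) (a c : J) :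
    D.dot a (D.dot (D.adj a) c) = D.nu a • c + D.form a c • D.adj a := by
  have h4 : (2 : F)⁻¹ * 2⁻¹ = 4⁻¹ := by rw [← mul_inv]; norm_num
  rw [dot, dot, hD.cross_smul hnd, hD.cross_adj_cross hnd h2 h3, smul_smul, h4, smul_add, smul_smul,
    smul_smul, nu, form, LinearMap.smul_apply, LinearMap.smul_apply, smul_eq_mul]

end

end IsCubicNorm

end CubicNormData

/-- The Jordan algebra `F ⊕ J` of a non-unital cubic norm structure on `J`. -/
@[nolint unusedArguments]
def CubicNormAlgebra {F : Type u} [Field F] {J : Type v} [AddCommGroup J] [Module F J]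
    (_D : CubicNormData F J) : Type (max u v) := F × J

namespace CubicNormAlgebra

variable {F : Type u} [Field F] {J : Type v} [AddCommGroup J] [Module F J] {D : CubicNormData F J}

instance : AddCommGroup (CubicNormAlgebra D) := inferInstanceAs (AddCommGroup (F × J))

instance : Module F (CubicNormAlgebra D) := inferInstanceAs (Module F (F × J))

/-- `(s, a) (r, c) = (s r + ¼ T(a, c), s c + r a + ½ (a × c))`. -/
instance : Mul (CubicNormAlgebra D) where
  mul x y := (x.1 * y.1 + D.form x.2 y.2, x.1 • y.2 + y.1 • x.2 + D.dot x.2 y.2)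

instance : One (CubicNormAlgebra D) where
  one := ((1 : F), (0 : J))

@[ext]
theorem ext {x y : CubicNormAlgebra D} (h1 : x.1 = y.1) (h2 : x.2 = y.2) : x = y :=
  Prod.ext h1 h2

theorem fst_add (x y : CubicNormAlgebra D) : (x + y).1 = x.1 + y.1 := rfl

theorem snd_add (x y : CubicNormAlgebra D) : (x + y).2 = x.2 + y.2 := rfl

theorem fst_sub (x y : CubicNormAlgebra D) : (x - y).1 = x.1 - y.1 := rfl

theorem snd_sub (x y : CubicNormAlgebra D) : (x - y).2 = x.2 - y.2 := rfl

theorem fst_smul (r : F) (x : CubicNormAlgebra D) : (r • x).1 = r * x.1 := rfl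

theorem snd_smul (r : F) (x : CubicNormAlgebra D) : (r • x).2 = r • x.2 := rfl

theorem fst_mul (x y : CubicNormAlgebra D) : (x * y).1 = x.1 * y.1 + D.form x.2 y.2 := rfl

theorem snd_mul (x y : CubicNormAlgebra D) :
    (x * y).2 = x.1 • y.2 + y.1 • x.2 + D.dot x.2 y.2 := rfl

theorem fst_one : (1 : CubicNormAlgebra D).1 = 1 := rfl

theorem snd_one : (1 : CubicNormAlgebra D).2 = 0 := rfl

theorem fst_zero : (0 : CubicNormAlgebra D).1 = 0 := rfl

theorem snd_zero : (0 : CubicNormAlgebra D).2 = 0 := rfl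

-- Distributivity of the product depends on these two properties; as `Fact`s they are available to
-- instance search.
variable [hD : Fact D.IsCubicNorm] [hnd : Fact D.TraceNondegenerate]

theorem dot_zero (a : J) : D.dot a 0 = 0 := by
  simpa using hD.out.dot_smul hnd.out 0 a 0

omit hnd in
protected theorem mul_comm (x y : CubicNormAlgebra D) : x * y = y * x := by
  ext
  · rw [fst_mul, fst_mul, hD.out.form_symm, mul_comm]
  · rw [snd_mul, snd_mul, D.dot_comm, add_comm (x.1 • y.2)]

protected theorem mul_add (x y z : CubicNormAlgebra D) : x * (y + z) = x * y + x * z := by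
  ext
  · simp only [fst_mul, fst_add, snd_add, map_add]
    ring
  · simp only [snd_mul, fst_add, snd_add, hD.out.dot_add hnd.out]
    module

protected theorem mul_zero (x : CubicNormAlgebra D) : x * 0 = 0 := by
  ext
  · simp only [fst_mul, fst_zero, snd_zero, map_zero, mul_zero, add_zero]
  · simp only [snd_mul, fst_zero, snd_zero, dot_zero, smul_zero, zero_smul, add_zero]

protected theorem mul_one (x : CubicNormAlgebra D) : x * 1 = x := by
  ext
  · simp only [fst_mul, fst_one, snd_one, map_zero, mul_one, add_zero]
  · simp only [snd_mul, fst_one, snd_one, dot_zero, smul_zero, one_smul, add_zero, zero_add]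

instance : NonAssocCommRing (CubicNormAlgebra D) where
  __ := (inferInstance : AddCommGroup (CubicNormAlgebra D))
  __ := (inferInstance : Mul (CubicNormAlgebra D))
  __ := (inferInstance : One (CubicNormAlgebra D))
  mul_comm := CubicNormAlgebra.mul_comm
  left_distrib := CubicNormAlgebra.mul_add
  right_distrib x y z := by
    rw [CubicNormAlgebra.mul_comm, CubicNormAlgebra.mul_add, CubicNormAlgebra.mul_comm z,
      CubicNormAlgebra.mul_comm z]
  mul_zero := CubicNormAlgebra.mul_zero
  zero_mul x := by rw [CubicNormAlgebra.mul_comm, CubicNormAlgebra.mul_zero]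
  mul_one := CubicNormAlgebra.mul_one
  one_mul x := by rw [CubicNormAlgebra.mul_comm, CubicNormAlgebra.mul_one]

instance : IsScalarTower F (CubicNormAlgebra D) (CubicNormAlgebra D) where
  smul_assoc r x y := by
    simp only [smul_eq_mul]
    ext
    · simp only [fst_mul, fst_smul, snd_smul, map_smul, LinearMap.smul_apply, smul_eq_mul]
      ring
    · simp only [snd_mul, fst_smul, snd_smul, hD.out.smul_dot hnd.out]
      module

instance : SMulCommClass F (CubicNormAlgebra D) (CubicNormAlgebra D) where
  smul_comm r x y := by
    simp only [smul_eq_mul]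
    rw [mul_comm x (r • y), smul_mul_assoc, mul_comm y]

/-- The trace `(s, a) ↦ 4 s`. -/
def trace (D : CubicNormData F J) : CubicNormAlgebra D →ₗ[F] F where
  toFun x := 4 * x.1
  map_add' x y := by rw [fst_add, mul_add]
  map_smul' r x := by rw [fst_smul, RingHom.id_apply, smul_eq_mul, mul_left_comm]

omit hD hnd in
theorem trace_apply (x : CubicNormAlgebra D) : trace D x = 4 * x.1 := rfl

omit hnd in
theorem trace_assoc (x y z : CubicNormAlgebra D) : trace D (x * y * z) = trace D (x * (y * z)) := by
  simp only [trace_apply, fst_mul, snd_mul, map_add, map_smul, LinearMap.add_apply,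
    LinearMap.smul_apply, smul_eq_mul, hD.out.form_dot]
  ring

/-- For `a ∈ J`, with `a² = ¼T(a, a) + a♯`, the elements `a♯ ∘ (a ∘ c)` and `a ∘ (a♯ ∘ c)` differ by
`¼T(c, a♯)a - ¼T(a, c)a♯`. The products of `a` and `a♯` with the scalar parts of `a♯c` and `ac`
compensate exactly for this difference. -/
theorem isCommJordan (h2 : (2 : F) ≠ 0) (h3 : (3 : F) ≠ 0) :
    IsCommJordan (CubicNormAlgebra D) where
  lmul_comm_rmul_rmul x y := by
    have e1 := hD.out.adj_dot_dot hnd.out h2 h3 x.2 y.2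
    have e2 := hD.out.dot_adj_dot hnd.out h2 h3 x.2 y.2
    have e4 : D.form (D.dot x.2 y.2) x.2 = D.form (D.adj x.2) y.2 := by
      rw [hD.out.form_dot', hD.out.dot_self h2]
    have e5 := hD.out.form_symm x.2 y.2
    have e6 := hD.out.form_symm (D.adj x.2) y.2
    have e8 := hD.out.form_symm (D.dot y.2 (D.adj x.2)) x.2
    have e9 := D.dot_comm (D.adj x.2) y.2
    rw [e9] at e2
    ext
    · simp only [fst_mul, snd_mul, map_add, map_smul, LinearMap.add_apply,
        LinearMap.smul_apply, smul_eq_mul, hD.out.dot_self h2, hD.out.dot_add hnd.out,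
        hD.out.dot_smul hnd.out]
      rw [D.dot_comm y.2 x.2, hD.out.form_symm x.2 (D.dot x.2 y.2), hD.out.form_dot' x.2 y.2,
        ← e8, hD.out.form_dot' y.2, D.dot_comm y.2, hD.out.form_dot' x.2 y.2 (D.adj x.2),
        hD.out.dot_self h2, e6, e5]
      ring
    · simp only [fst_mul, snd_mul, map_add, map_smul, smul_eq_mul, hD.out.dot_self h2, hD.out.dot_add hnd.out,
        hD.out.dot_smul hnd.out, hD.out.add_dot hnd.out, hD.out.smul_dot hnd.out]
      rw [D.dot_comm y.2 x.2, e2, D.dot_comm (D.dot x.2 y.2) (D.adj x.2), e1, e5,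
        D.dot_comm (D.dot x.2 y.2) x.2]
      module

/-- By polarization only the one-variable equation matters. The powers of `x = (s, a)` stay in the
span of `1`, `a`, `a♯` and `a ∘ a♯`, because `a ∘ (a ∘ a♯)` falls back to `a` and `a♯`; the equation
is then a comparison of coefficients. -/
theorem isQuarticTrace (h2 : (2 : F) ≠ 0) (h3 : (3 : F) ≠ 0) : IsQuarticTrace (trace D) := by
  have h24 : (24 : F) ≠ 0 := by
    rw [show (24 : F) = 2 * 2 * 2 * 3 by norm_num]
    exact mul_ne_zero (mul_ne_zero (mul_ne_zero h2 h2) h2) h3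
  refine IsQuarticTrace.of_diagonal h24 trace_assoc (by rw [trace_apply, fst_one, mul_one])
    fun x => ?_
  obtain ⟨s, a, hs, ha⟩ : ∃ s a, x.1 = s ∧ x.2 = a := ⟨_, _, rfl, rfl⟩
  obtain ⟨τ, hτ⟩ : ∃ τ, D.form a a = τ := ⟨_, rfl⟩
  obtain ⟨ν, hν⟩ : ∃ ν, D.nu a = ν := ⟨_, rfl⟩
  obtain ⟨μ, hμ⟩ : ∃ μ, D.form (D.adj a) (D.adj a) = μ := ⟨_, rfl⟩
  have f1 : D.form a (D.adj a) = 3 * ν := by rw [hD.out.form_adj h2, hν]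
  have f2 : D.form (D.adj a) a = 3 * ν := by rw [hD.out.form_symm, f1]
  have f3 : D.form a (D.dot a (D.adj a)) = μ := by
    rw [← hD.out.form_dot, hD.out.dot_self h2, hμ]
  have d1 : D.dot a (D.dot a (D.adj a)) = ν • a + τ • D.adj a := by
    rw [D.dot_comm a (D.adj a), hD.out.dot_adj_dot hnd.out h2 h3, hν, hτ]
  obtain ⟨y, hy⟩ : ∃ y, y = x * x := ⟨_, rfl⟩
  have y1 : y.1 = s ^ 2 + τ := by rw [hy, fst_mul, hs, ha, hτ, sq]
  have y2 : y.2 = (2 * s) • a + D.adj a := by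
    rw [hy, snd_mul, hs, ha, hD.out.dot_self h2]
    module
  obtain ⟨z, hz⟩ : ∃ z, z = x * y := ⟨_, rfl⟩
  have z1 : z.1 = s ^ 3 + 3 * s * τ + 3 * ν := by
    rw [hz, fst_mul, hs, ha, y1, y2, map_add, map_smul, f1, hτ, smul_eq_mul]
    ring
  have z2 : z.2 = (3 * s ^ 2 + τ) • a + (3 * s) • D.adj a + D.dot a (D.adj a) := by
    rw [hz, snd_mul, hs, ha, y1, y2, hD.out.dot_add hnd.out, hD.out.dot_smul hnd.out,
      hD.out.dot_self h2]
    module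
  have w1 : (x * z).1 = s ^ 4 + 6 * s ^ 2 * τ + 12 * s * ν + τ ^ 2 + μ := by
    rw [fst_mul, hs, ha, z1, z2, map_add, map_add, map_smul, map_smul, f1, f3, hτ, smul_eq_mul,
      smul_eq_mul]
    ring
  have w2 : (x * z).2 = (4 * s ^ 3 + 4 * s * τ + 4 * ν) • a + (6 * s ^ 2 + 2 * τ) • D.adj a +
      (4 * s) • D.dot a (D.adj a) := by
    rw [snd_mul, hs, ha, z1, z2, hD.out.dot_add hnd.out, hD.out.dot_add hnd.out,
      hD.out.dot_smul hnd.out, hD.out.dot_smul hnd.out, hD.out.dot_self h2, d1]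
    module
  have v1 : (y * y).1 = s ^ 4 + 6 * s ^ 2 * τ + 12 * s * ν + τ ^ 2 + μ := by
    rw [fst_mul, y1, y2]
    simp only [map_add, map_smul, LinearMap.add_apply, LinearMap.smul_apply, smul_eq_mul, f1, f2,
      hτ, hμ]
    ring
  simp only [quarticAdj, quarticForm, mul_add, mul_sub, mul_smul_comm, mul_one, ← hy]
  rw [mul_comm y x, ← hz]
  ext
  · simp only [fst_add, fst_sub, fst_smul, fst_one, trace_apply, hs, y1, z1, w1, v1]
    ring
  · simp only [snd_add, snd_sub, snd_smul, snd_one, trace_apply, hs, ha, y1, z1, y2, z2, w2]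
    module

theorem trace_nondegenerate (h2 : (2 : F) ≠ 0) (x : CubicNormAlgebra D)
    (h : ∀ y, trace D (x * y) = 0) : x = 0 := by
  have h4 : (4 : F) ≠ 0 := by
    rw [show (4 : F) = 2 * 2 by norm_num]
    exact mul_ne_zero h2 h2
  ext
  · have := h 1
    rw [mul_one, trace_apply] at this
    exact (mul_eq_zero.1 this).resolve_left h4
  · refine hnd.out _ fun b => ?_
    have := h (((0 : F), b) : F × J)
    change 4 * (x.1 * 0 + D.form x.2 b) = 0 at this
    rw [mul_zero, zero_add, CubicNormData.form, LinearMap.smul_apply,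
      LinearMap.smul_apply, smul_eq_mul, mul_inv_cancel_left₀ h4] at this
    exact this

end CubicNormAlgebra

/-! ### Quadratic étale extensions and their square-root generators -/

section QuadraticExtension

variable {F : Type u} [Field F] {K : Type w} [CommRing K] [Algebra F K]
  [Algebra.IsQuadraticExtension F K]

theorem exists_quad_coords {lam : K} (hlam : lam ∉ Set.range (algebraMap F K)) (k : K) :
    k = algebraMap F K ((quadBasis lam hlam).coord 0 k) +
      algebraMap F K ((quadBasis lam hlam).coord 1 k) * lam := by
  have h := (quadBasis lam hlam).sum_repr k
  rw [Fin.sum_univ_two, quadBasis_zero, quadBasis_one] at h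
  rw [Module.Basis.coord_apply, Module.Basis.coord_apply, ← Algebra.smul_def,
    Algebra.algebraMap_eq_smul_one, h]

theorem quad_coords_eq_zero {lam : K} (hlam : lam ∉ Set.range (algebraMap F K)) {a b : F}
    (h : algebraMap F K a + algebraMap F K b * lam = 0) : a = 0 ∧ b = 0 := by
  have hli := (quadBasis lam hlam).linearIndependent
  have he : ⇑(quadBasis lam hlam) = ![(1 : K), lam] := by
    ext i
    fin_cases i
    · exact quadBasis_zero lam hlam
    · exact quadBasis_one lam hlam
  rw [he, LinearIndependent.pair_iff] at hli
  refine hli a b ?_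
  rw [Algebra.smul_def, Algebra.smul_def, mul_one, h]

/-- Write `σ ι = a + bι`. Squaring gives `2ab = 0` and `a² + b²μ = μ`. The case `b = 0` would put
`ι` in `F`, so `a = 0` and `b = ±1`; the sign `+` would make `σ` the identity. No field property of
`K` is needed, so the split case is covered. -/
theorem conj_sqrt {σ : K ≃ₐ[F] K} (hσ : σ ≠ AlgEquiv.refl) (h2 : (2 : F) ≠ 0) {ι : K}
    (hι : ι ∉ Set.range (algebraMap F K)) {μ : F} (hμ : μ ≠ 0) (hsq : ι * ι = algebraMap F K μ) :
    σ ι = -ι := by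
  obtain ⟨a, b, hab⟩ : ∃ a b, σ ι = algebraMap F K a + algebraMap F K b * ι :=
    ⟨_, _, exists_quad_coords hι (σ ι)⟩
  have h1 : σ ι * σ ι = algebraMap F K μ := by rw [← map_mul, hsq, AlgEquiv.commutes]
  have h2' : algebraMap F K (a ^ 2 + b ^ 2 * μ - μ) + algebraMap F K (2 * a * b) * ι = 0 := by
    simp only [map_add, map_sub, map_mul, map_pow, map_ofNat]
    rw [hab] at h1
    linear_combination h1 - algebraMap F K b ^ 2 * hsq
  obtain ⟨e1, e2⟩ := quad_coords_eq_zero hι h2'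
  by_cases hb : b = 0
  · refine absurd ⟨a, ?_⟩ hι
    apply σ.injective
    rw [AlgEquiv.commutes, hab, hb, map_zero, zero_mul, add_zero]
  · have ha : a = 0 := by
      rw [mul_assoc, mul_eq_zero, mul_eq_zero] at e2
      tauto
    have hb2 : (b - 1) * (b + 1) = 0 := by
      refine mul_right_cancel₀ hμ ?_
      rw [ha] at e1
      linear_combination e1
    rw [ha, map_zero, zero_add] at hab
    rcases mul_eq_zero.1 hb2 with h | h
    · refine absurd ?_ hσ
      ext k
      rw [exists_quad_coords hι k, map_add, map_mul, AlgEquiv.commutes, AlgEquiv.commutes, hab,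
        sub_eq_zero.1 h, map_one, one_mul]
      rfl
    · rw [hab, eq_neg_of_add_eq_zero_left h, map_neg, map_one, neg_one_mul]

/-- Complete the square in the quadratic equation of `lam`. If `μ` were zero, `ι` would be
nilpotent, hence zero since an étale algebra over a field is reduced. -/
theorem exists_sqrt_generator [Algebra.Etale F K] (h2 : (2 : F) ≠ 0) {lam : K}
    (hlam : lam ∉ Set.range (algebraMap F K)) :
    ∃ (ι : K) (μ : F), ι ∉ Set.range (algebraMap F K) ∧ μ ≠ 0 ∧ ι * ι = algebraMap F K μ := by
  obtain ⟨q, p, hpq⟩ : ∃ q p, lam * lam = algebraMap F K q + algebraMap F K p * lam :=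
    ⟨_, _, exists_quad_coords hlam (lam * lam)⟩
  have hι : lam - algebraMap F K (2⁻¹ * p) ∉ Set.range (algebraMap F K) := by
    rintro ⟨r, hr⟩
    exact hlam ⟨r + 2⁻¹ * p, by rw [map_add, hr, sub_add_cancel]⟩
  have hsq : (lam - algebraMap F K (2⁻¹ * p)) * (lam - algebraMap F K (2⁻¹ * p)) =
      algebraMap F K (q + (2⁻¹ * p) ^ 2) := by
    have : algebraMap F K p = 2 * algebraMap F K (2⁻¹ * p) := by
      rw [← map_ofNat (algebraMap F K), ← map_mul, mul_inv_cancel_left₀ h2]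
    rw [map_add, map_pow]
    linear_combination hpq + lam * this
  refine ⟨_, _, hι, fun h0 => hι ⟨0, ?_⟩, hsq⟩
  have : IsReduced K := Algebra.FormallyUnramified.isReduced_of_field F K
  rw [h0, map_zero] at hsq
  rw [map_zero]
  exact (pow_eq_zero_iff two_ne_zero).1 ((sq _).trans hsq) |>.symm

theorem conj_conj {σ : K ≃ₐ[F] K} {ι : K} (hι : ι ∉ Set.range (algebraMap F K))
    (hσ : σ ι = -ι) (k : K) : σ (σ k) = k := by
  rw [exists_quad_coords hι k]
  simp only [map_add, map_mul, AlgEquiv.commutes, hσ, map_neg, neg_neg]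

end QuadraticExtension

theorem quadraticRoot_root_mul_root {F : Type u} [Field F] (μ : F) :
    (AdjoinRoot.root _ : QuadraticRoot μ) * AdjoinRoot.root _ = algebraMap F _ μ := by
  have h := AdjoinRoot.eval₂_root (Polynomial.X ^ 2 - Polynomial.C μ : Polynomial F)
  rw [Polynomial.eval₂_sub, Polynomial.eval₂_pow, Polynomial.eval₂_X, Polynomial.eval₂_C,
    sub_eq_zero] at h
  rw [← sq]
  exact h

/-- For two lifts `x`, `y` of the root with `(x - y)² = 0`, the equality `x² = y² = μ` gives `2y(x -
y) = 0`, hence `2μ(x - y) = 0` with `2μ` a unit. So the algebra is unramified, which suffices over a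
field. -/
theorem etale_quadraticRoot {F : Type u} [Field F] (h2 : (2 : F) ≠ 0) {μ : F} (hμ : μ ≠ 0) :
    Algebra.Etale F (QuadraticRoot μ) := by
  have hfin : Module.Finite F (QuadraticRoot μ) :=
    Module.finite_of_finrank_pos (by
      rw [Algebra.IsQuadraticExtension.finrank_eq_two F (QuadraticRoot μ)]; norm_num)
  have hroot := quadraticRoot_root_mul_root μ
  have hunr : Algebra.FormallyUnramified F (QuadraticRoot μ) := by
    rw [Algebra.FormallyUnramified.iff_comp_injective]
    intro B _ _ I hI f g hfg
    refine AdjoinRoot.algHom_ext ?_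
    obtain ⟨x, hx⟩ : ∃ x, f (AdjoinRoot.root _) = x := ⟨_, rfl⟩
    obtain ⟨y, hy⟩ : ∃ y, g (AdjoinRoot.root _) = y := ⟨_, rfl⟩
    have hxx : x * x = algebraMap F B μ := by
      rw [← hx, ← map_mul, hroot, AlgHom.commutes]
    have hyy : y * y = algebraMap F B μ := by
      rw [← hy, ← map_mul, hroot, AlgHom.commutes]
    have hmem : x - y ∈ I := by
      have := congrArg (fun φ => φ (AdjoinRoot.root _)) hfg
      simp only [AlgHom.comp_apply, hx, hy, Ideal.Quotient.mkₐ_eq_mk] at this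
      exact Ideal.Quotient.eq.1 this
    have hδ : (x - y) * (x - y) = 0 := by
      have : (x - y) * (x - y) ∈ I ^ 2 := by
        rw [sq]
        exact Ideal.mul_mem_mul hmem hmem
      rwa [hI] at this
    have hinv : algebraMap F B (2⁻¹ * μ⁻¹) * (2 * (algebraMap F B μ)) = 1 := by
      rw [← map_ofNat (algebraMap F B), ← map_mul, ← map_mul, ← map_one (algebraMap F B)]
      congr 1
      field_simp
    rw [hx, hy]
    linear_combination (-(x - y)) * hinv + algebraMap F B (2⁻¹ * μ⁻¹) * y * (hxx - hyy - hδ) -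
      2 * algebraMap F B (2⁻¹ * μ⁻¹) * (x - y) * hyy
  have : Algebra.FormallyEtale F (QuadraticRoot μ) :=
    Algebra.FormallyEtale.of_formallyUnramified_of_field F _
  exact ⟨inferInstance, Algebra.FinitePresentation.of_finiteType.1 inferInstance⟩

/-! ### The hermitian cubic norm structure on `K ⊗ J` -/

section SemilinearExtension

variable {F : Type u} [Field F] {K : Type w} [CommRing K] [Algebra F K]
  [Algebra.IsQuadraticExtension F K] {J : Type v} [AddCommGroup J] [Module F J]

theorem extCoord_tmul {lam : K} (hlam : lam ∉ Set.range (algebraMap F K)) (i : Fin 2) (k : K)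
    (a : J) : extCoord lam hlam i (k ⊗ₜ[F] a) = (quadBasis lam hlam).coord i k • a := rfl

theorem eq_extCoord {lam : K} (hlam : lam ∉ Set.range (algebraMap F K)) (x : K ⊗[F] J) :
    x = (1 : K) ⊗ₜ[F] extCoord lam hlam 0 x + lam ⊗ₜ[F] extCoord lam hlam 1 x := by
  rw [← sub_eq_zero]
  refine additive_eq_zero_of_tmul (fun x : K ⊗[F] J =>
    x - ((1 : K) ⊗ₜ[F] extCoord lam hlam 0 x + lam ⊗ₜ[F] extCoord lam hlam 1 x))
    (fun x y => ?_) (fun k a => ?_) x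
  · simp only [map_add, TensorProduct.tmul_add]
    abel
  · rw [extCoord_tmul, extCoord_tmul, ← TensorProduct.smul_tmul, ← TensorProduct.smul_tmul,
      ← TensorProduct.add_tmul, sub_eq_zero, Algebra.smul_def, Algebra.smul_def, mul_one,
      ← exists_quad_coords]

namespace CubicNormData

variable {D : CubicNormData F J} {σ : K ≃ₐ[F] K} {lam : K}
  {hlam : lam ∉ Set.range (algebraMap F K)}

/-- Shows that the trace is independent of `lam`, so that a different generator of `K` may be used
later. -/
theorem semilinearExt_trace_tmul (k l : K) (a b : J) :
    (D.semilinearExt σ lam hlam).trace (k ⊗ₜ a) (l ⊗ₜ b) =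
      k * σ l * algebraMap F K (D.trace a b) := by
  have hk := exists_quad_coords hlam k
  have hl := congrArg σ (exists_quad_coords hlam l)
  rw [map_add, map_mul, AlgEquiv.commutes, AlgEquiv.commutes] at hl
  simp only [semilinearExt, extCoord_tmul, map_smul, LinearMap.smul_apply, smul_eq_mul, map_mul]
  rw [hl]
  linear_combination (-(algebraMap F K ((quadBasis lam hlam).coord 0 l) +
    algebraMap F K ((quadBasis lam hlam).coord 1 l) * σ lam) * algebraMap F K (D.trace a b)) * hk

theorem semilinearExt_trace_add_left (x y z : K ⊗[F] J) :
    (D.semilinearExt σ lam hlam).trace (x + y) z =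
      (D.semilinearExt σ lam hlam).trace x z + (D.semilinearExt σ lam hlam).trace y z := by
  simp only [semilinearExt, map_add, LinearMap.add_apply]
  ring

theorem semilinearExt_trace_add_right (x y z : K ⊗[F] J) :
    (D.semilinearExt σ lam hlam).trace x (y + z) =
      (D.semilinearExt σ lam hlam).trace x y + (D.semilinearExt σ lam hlam).trace x z := by
  simp only [semilinearExt, map_add]
  ring

namespace IsCubicNorm

/-- The cross product of a cubic norm structure with nondegenerate trace as a bilinear map. -/
def crossHom (hD : D.IsCubicNorm) (hnd : D.TraceNondegenerate) : J →ₗ[F] J →ₗ[F] J :=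
  LinearMap.mk₂ F D.cross (hD.add_cross hnd) (hD.smul_cross hnd) (hD.cross_add hnd)
    (hD.cross_smul hnd)

/-- The `σ`-semilinear extension of the cross product. -/
noncomputable def extCross (hD : D.IsCubicNorm) (hnd : D.TraceNondegenerate) (σ : K ≃ₐ[F] K) :
    K ⊗[F] J →ₗ[F] K ⊗[F] J →ₗ[F] K ⊗[F] J :=
  TensorProduct.map₂ ((LinearMap.mul F K).compr₂ σ.toLinearMap) (hD.crossHom hnd)

variable (hD : D.IsCubicNorm) (hnd : D.TraceNondegenerate)

omit [Algebra.IsQuadraticExtension F K] in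
theorem extCross_tmul (k l : K) (a b : J) :
    hD.extCross hnd σ (k ⊗ₜ a) (l ⊗ₜ b) = σ (k * l) ⊗ₜ[F] D.cross a b := rfl

omit [Algebra.IsQuadraticExtension F K] in
theorem extCross_comm (x y : K ⊗[F] J) :
    hD.extCross hnd σ x y = hD.extCross hnd σ y x := by
  rw [← sub_eq_zero]
  refine biadditive_eq_zero_of_tmul (fun x y =>
    hD.extCross hnd σ x y - hD.extCross hnd σ y x) (fun x x' y => ?_) (fun x y y' => ?_)
    (fun k l a b => ?_) x y
  · simp only [map_add, LinearMap.add_apply]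
    abel
  · simp only [map_add, LinearMap.add_apply]
    abel
  · rw [extCross_tmul, extCross_tmul, mul_comm, cross_comm, sub_self]

/-- Trades the coordinate formula for `♯` for the diagonal of a biadditive map, which can be studied
on pure tensors. -/
theorem two_smul_semilinearExt_adj (x : K ⊗[F] J) :
    (2 : F) • (D.semilinearExt σ lam hlam).adj x = hD.extCross hnd σ x x := by
  conv_rhs => rw [eq_extCoord hlam x]
  simp only [semilinearExt, map_add, LinearMap.add_apply, extCross_tmul]
  rw [cross_comm D (extCoord lam hlam 1 x), hD.cross_self, hD.cross_self]
  simp only [one_mul, mul_one, map_one, map_mul, TensorProduct.tmul_smul, sq]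
  module

theorem semilinearExt_cross (h2 : (2 : F) ≠ 0) (x y : K ⊗[F] J) :
    (D.semilinearExt σ lam hlam).cross x y = hD.extCross hnd σ x y := by
  refine smul_right_injective _ h2 ?_
  dsimp only
  rw [HermitianCubicNormData.cross, smul_sub, smul_sub, hD.two_smul_semilinearExt_adj hnd,
    hD.two_smul_semilinearExt_adj hnd, hD.two_smul_semilinearExt_adj hnd]
  simp only [map_add, LinearMap.add_apply]
  rw [hD.extCross_comm hnd y x]
  module

omit [Algebra.IsQuadraticExtension F K] in
theorem extCross_smul_smul (s t : K) (x y : K ⊗[F] J) :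
    hD.extCross hnd σ (s • x) (t • y) = σ (s * t) • hD.extCross hnd σ x y := by
  rw [← sub_eq_zero]
  refine biadditive_eq_zero_of_tmul (fun x y => hD.extCross hnd σ (s • x) (t • y) -
    σ (s * t) • hD.extCross hnd σ x y) (fun x x' y => ?_) (fun x y y' => ?_)
    (fun k l a b => ?_) x y
  · simp only [map_add, smul_add, LinearMap.add_apply]
    abel
  · simp only [map_add, smul_add]
    abel
  · simp only [TensorProduct.smul_tmul', extCross_tmul, smul_eq_mul]
    rw [← map_mul, mul_mul_mul_comm, sub_self]

end IsCubicNorm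

theorem semilinearExt_trace_smul_smul (s t : K) (x y : K ⊗[F] J) :
    (D.semilinearExt σ lam hlam).trace (s • x) (t • y) =
      s * σ t * (D.semilinearExt σ lam hlam).trace x y := by
  rw [← sub_eq_zero]
  refine biadditive_eq_zero_of_tmul (fun x y => (D.semilinearExt σ lam hlam).trace (s • x) (t • y) -
    s * σ t * (D.semilinearExt σ lam hlam).trace x y) (fun x x' y => ?_) (fun x y y' => ?_)
    (fun k l a b => ?_) x y
  · simp only [smul_add, semilinearExt_trace_add_left]
    ring
  · simp only [smul_add, semilinearExt_trace_add_right]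
    ring
  · simp only [TensorProduct.smul_tmul', semilinearExt_trace_tmul, smul_eq_mul, map_mul]
    ring

namespace IsCubicNorm

variable (hD : D.IsCubicNorm) (hnd : D.TraceNondegenerate)

include hD in
theorem semilinearExt_trace_conj (hσ : ∀ k, σ (σ k) = k) (x y : K ⊗[F] J) :
    σ ((D.semilinearExt σ lam hlam).trace x y) = (D.semilinearExt σ lam hlam).trace y x := by
  rw [← sub_eq_zero]
  refine biadditive_eq_zero_of_tmul (fun x y => σ ((D.semilinearExt σ lam hlam).trace x y) -
    (D.semilinearExt σ lam hlam).trace y x) (fun x x' y => ?_) (fun x y y' => ?_)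
    (fun k l a b => ?_) x y
  · simp only [semilinearExt_trace_add_right, semilinearExt_trace_add_left, map_add]
    ring
  · simp only [semilinearExt_trace_add_right, semilinearExt_trace_add_left, map_add]
    ring
  · simp only [semilinearExt_trace_tmul, map_mul, hσ, AlgEquiv.commutes, hD.trace_symm b a]
    ring

/-- The conjugation in `×` cancels the one in the second slot of `T`, so `T(x, y × z)` is linear
over `K` in every variable; its symmetry is inherited from `J`. -/
theorem semilinearExt_trace_extCross (hσ : ∀ k, σ (σ k) = k) (x y z : K ⊗[F] J) :
    (D.semilinearExt σ lam hlam).trace x (hD.extCross hnd σ y z) =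
      (D.semilinearExt σ lam hlam).trace y (hD.extCross hnd σ x z) := by
  rw [← sub_eq_zero]
  refine triadditive_eq_zero_of_tmul (fun x y z =>
    (D.semilinearExt σ lam hlam).trace x (hD.extCross hnd σ y z) -
      (D.semilinearExt σ lam hlam).trace y (hD.extCross hnd σ x z)) (fun x x' y z => ?_)
    (fun x y y' z => ?_) (fun x y z z' => ?_) (fun k₁ k₂ k₃ a b c => ?_) x y z
  · simp only [map_add, LinearMap.add_apply, semilinearExt_trace_add_right,
      semilinearExt_trace_add_left]
    ring
  · simp only [map_add, LinearMap.add_apply, semilinearExt_trace_add_right,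
      semilinearExt_trace_add_left]
    ring
  · simp only [map_add, semilinearExt_trace_add_right]
    ring
  · simp only [extCross_tmul, semilinearExt_trace_tmul, hσ]
    rw [← hD.trace_cross a b c, cross_comm D a b, hD.trace_cross]
    ring

theorem six_mul_semilinearExt_norm (h2 : (2 : F) ≠ 0) (hσ : ∀ k, σ (σ k) = k) (x : K ⊗[F] J) :
    6 * (D.semilinearExt σ lam hlam).norm x =
      (D.semilinearExt σ lam hlam).trace x (hD.extCross hnd σ x x) := by
  obtain ⟨a, ha⟩ : ∃ a, extCoord lam hlam 0 x = a := ⟨_, rfl⟩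
  obtain ⟨b, hb⟩ : ∃ b, extCoord lam hlam 1 x = b := ⟨_, rfl⟩
  have hx := eq_extCoord hlam x
  have e1 : D.trace a (D.cross a b) = 2 * D.trace b (D.adj a) := by
    rw [cross_comm, ← hD.trace_cross, hD.trace_cross', hD.cross_self, hD.trace_symm, map_smul,
      smul_eq_mul]
  have e2 : D.trace b (D.cross a b) = 2 * D.trace a (D.adj b) := by
    rw [← hD.trace_cross, hD.trace_cross', hD.cross_self, hD.trace_symm, map_smul, smul_eq_mul]
  rw [← hD.two_smul_semilinearExt_adj hnd (hlam := hlam), two_smul, semilinearExt_trace_add_right,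
    ← two_mul]
  have e3 : (D.semilinearExt σ lam hlam).trace x ((D.semilinearExt σ lam hlam).adj x) =
      (D.semilinearExt σ lam hlam).trace ((1 : K) ⊗ₜ[F] a + lam ⊗ₜ[F] b)
        ((1 : K) ⊗ₜ[F] D.adj a + σ lam ⊗ₜ[F] D.cross a b + (σ lam ^ 2) ⊗ₜ[F] D.adj b) := by
    rw [ha, hb] at hx
    rw [← hx, semilinearExt, ← ha, ← hb]
  rw [e3]
  simp only [semilinearExt_trace_add_right, semilinearExt_trace_add_left, semilinearExt_trace_tmul,
    e1, e2, hD.trace_self_adj h2, map_pow, hσ, map_one, map_mul, map_ofNat]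
  simp only [semilinearExt, ha, hb]
  ring

-- After multiplying by `2`, `6` or `24`, each axiom involving `♯` or `N` becomes a statement about
-- the multiadditive `extCross` and trace.
include hD hnd in
theorem isHermitianCubicNorm_semilinearExt (h2 : (2 : F) ≠ 0) (h3 : (3 : F) ≠ 0)
    (hσ : ∀ k, σ (σ k) = k) : (D.semilinearExt σ lam hlam).IsHermitianCubicNorm σ := by
  have h6 : (6 : F) ≠ 0 := by
    rw [show (6 : F) = 2 * 3 by norm_num]
    exact mul_ne_zero h2 h3
  have h24 : (24 : F) ≠ 0 := by
    rw [show (24 : F) = 2 * 2 * 6 by norm_num]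
    exact mul_ne_zero (mul_ne_zero h2 h2) h6
  have cancel : ∀ k l : K, 6 * k = 6 * l → k = l := by
    intro k l h
    refine smul_right_injective K h6 ?_
    dsimp only
    rwa [Algebra.smul_def, Algebra.smul_def, map_ofNat]
  have hN := hD.six_mul_semilinearExt_norm hnd h2 hσ (hlam := hlam)
  have hA := hD.two_smul_semilinearExt_adj hnd (σ := σ) (hlam := hlam)
  have hTA : ∀ x y, (D.semilinearExt σ lam hlam).trace x (hD.extCross hnd σ y y) =
      2 * (D.semilinearExt σ lam hlam).trace x ((D.semilinearExt σ lam hlam).adj y) := by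
    intro x y
    rw [← hA, two_smul, semilinearExt_trace_add_right, two_mul]
  refine ⟨semilinearExt_trace_add_left, semilinearExt_trace_add_right,
    semilinearExt_trace_smul_smul, hD.semilinearExt_trace_conj hσ, fun t x => ?_, fun t x => ?_,
    fun x y => ?_, fun x => ?_⟩
  · refine smul_right_injective _ h2 ?_
    dsimp only
    rw [hA, smul_comm, hA, hD.extCross_smul_smul, map_mul, sq]
  · apply cancel
    rw [hN, hD.extCross_smul_smul, semilinearExt_trace_smul_smul, hσ, ← hN]
    ring
  · apply cancel
    have e1 := hD.semilinearExt_trace_extCross hnd hσ (hlam := hlam) y x x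
    have e2 := hD.semilinearExt_trace_extCross hnd hσ (hlam := hlam) x y y
    rw [mul_add, mul_add, mul_add, hN, hN, hN]
    simp only [map_add, LinearMap.add_apply, semilinearExt_trace_add_right,
      semilinearExt_trace_add_left]
    rw [hD.extCross_comm hnd y x] at e1 ⊢
    rw [← e1, ← e2, hTA y x, hTA x y]
    ring
  -- The fully linearized form of `x♯♯ = N(x)x` transfers from `J` by pure tensors; its diagonal is
  -- `24` times the axiom.
  · have h := quadriadditive_eq_zero_of_tmul (fun a b c d : K ⊗[F] J =>
      hD.extCross hnd σ (hD.extCross hnd σ a b) (hD.extCross hnd σ c d) +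
        hD.extCross hnd σ (hD.extCross hnd σ a c) (hD.extCross hnd σ b d) +
        hD.extCross hnd σ (hD.extCross hnd σ a d) (hD.extCross hnd σ b c) -
      ((D.semilinearExt σ lam hlam).trace a (hD.extCross hnd σ b c) • d +
        (D.semilinearExt σ lam hlam).trace a (hD.extCross hnd σ b d) • c +
        (D.semilinearExt σ lam hlam).trace a (hD.extCross hnd σ c d) • b +
        (D.semilinearExt σ lam hlam).trace b (hD.extCross hnd σ c d) • a))
      (by
        intros
        simp only [map_add, LinearMap.add_apply, semilinearExt_trace_add_left, add_smul, smul_add]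
        abel)
      (by
        intros
        simp only [map_add, LinearMap.add_apply, semilinearExt_trace_add_left,
          semilinearExt_trace_add_right, add_smul, smul_add]
        abel)
      (by
        intros
        simp only [map_add, LinearMap.add_apply,
          semilinearExt_trace_add_right, add_smul, smul_add]
        abel)
      (by
        intros
        simp only [map_add, LinearMap.add_apply,
          semilinearExt_trace_add_right, add_smul, smul_add]
        abel)
      (by
        intro k₁ k₂ k₃ k₄ a b c d
        have hl := hD.adj_adj_linearized hnd h24 a b c d
        have hr : ∀ (r : F) (k : K) (b : J), (k * algebraMap F K r) ⊗ₜ[F] b = k ⊗ₜ[F] (r • b) :=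
          fun r k b => by
            rw [TensorProduct.tmul_smul, TensorProduct.smul_tmul', Algebra.smul_def, mul_comm]
        simp only [extCross_tmul, semilinearExt_trace_tmul, TensorProduct.smul_tmul', smul_eq_mul,
          map_mul, hσ, ← hD.trace_cross]
        rw [show k₁ * (k₂ * k₃) * algebraMap F K (D.trace (D.cross a b) c) * k₄ =
            k₁ * k₂ * (k₃ * k₄) * algebraMap F K (D.trace (D.cross a b) c) by ring,
          show k₁ * (k₂ * k₄) * algebraMap F K (D.trace (D.cross a b) d) * k₃ =
            k₁ * k₂ * (k₃ * k₄) * algebraMap F K (D.trace (D.cross a b) d) by ring,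
          show k₁ * (k₃ * k₄) * algebraMap F K (D.trace (D.cross a c) d) * k₂ =
            k₁ * k₂ * (k₃ * k₄) * algebraMap F K (D.trace (D.cross a c) d) by ring,
          show k₂ * (k₃ * k₄) * algebraMap F K (D.trace (D.cross b c) d) * k₁ =
            k₁ * k₂ * (k₃ * k₄) * algebraMap F K (D.trace (D.cross b c) d) by ring,
          show k₁ * k₃ * (k₂ * k₄) = k₁ * k₂ * (k₃ * k₄) by ring,
          show k₁ * k₄ * (k₂ * k₃) = k₁ * k₂ * (k₃ * k₄) by ring, hr, hr, hr, hr,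
          ← TensorProduct.tmul_add, ← TensorProduct.tmul_add, ← TensorProduct.tmul_add,
          ← TensorProduct.tmul_add, ← TensorProduct.tmul_add, hl, sub_self]) x x x x
    rw [← hN, ← hA x] at h
    simp only [map_smul, LinearMap.smul_apply] at h
    rw [← hA] at h
    refine smul_right_injective _ h24 ?_
    have e6 : ∀ k : K, (6 * k) • x = (6 : F) • k • x := fun k => by
      rw [← map_ofNat (algebraMap F K) 6, mul_smul, algebraMap_smul]
    rw [e6] at h
    generalize (D.semilinearExt σ lam hlam).norm x • x = y at h ⊢
    rw [← sub_eq_zero, ← h]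
    module

include hD in
theorem exists_semilinearExt_norm_ne_zero (h : ∃ b, D.norm b ≠ 0) :
    ∃ x, (D.semilinearExt σ lam hlam).norm x ≠ 0 := by
  obtain ⟨b, hb⟩ := h
  have : Nontrivial K := Module.nontrivial_of_finrank_pos (R := F)
    (by rw [Algebra.IsQuadraticExtension.finrank_eq_two F K]; norm_num)
  refine ⟨(1 : K) ⊗ₜ[F] b + lam ⊗ₜ[F] (0 : J), ?_⟩
  have h0 : D.norm 0 = 0 := by simpa using hD.norm_smul 0 0
  have h0' : D.adj 0 = 0 := by simpa using hD.adj_smul 0 0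
  simp only [semilinearExt, extCoord_zero, extCoord_one, h0, h0', map_zero, LinearMap.zero_apply,
    mul_zero, add_zero]
  rwa [map_ne_zero_iff _ (algebraMap F K).injective]

end IsCubicNorm

end CubicNormData

end SemilinearExtension

/-! ### The isomorphism between the Cayley–Dickson and hermitian algebras -/

section CayleyDicksonIsomorphism

variable {F : Type u} [Field F] {J : Type v} [AddCommGroup J] [Module F J] {D : CubicNormData F J}
  {B : Type*} [NonAssocCommRing B] [Module F B]

/-- A decomposition `B = F ⊕ J` of an algebra into scalars and a cubic norm structure `J`, under
which the product is `(s, a) (r, c) = (s r + ¼ T(a, c), s c + r a + ½ (a × c))`. -/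
structure IsCubicDecomposition (D : CubicNormData F J) (τ : B →ₗ[F] F) (π : B →ₗ[F] J) : Prop where
  fst_mul : ∀ x y, τ (x * y) = τ x * τ y + D.form (π x) (π y)
  snd_mul : ∀ x y, π (x * y) = τ x • π y + τ y • π x + D.dot (π x) (π y)
  fst_one : τ 1 = 1
  snd_one : π 1 = 0
  ext : ∀ x, τ x = 0 → π x = 0 → x = 0
  surj : ∀ s a, ∃ x, τ x = s ∧ π x = a

variable {τ : B →ₗ[F] F} {π : B →ₗ[F] J} {Q : B →ₚₗ[F] F}

/-- Since `½t = 2τ`, the map `θ` is the reflection that is `+1` on scalars and `-1` on `J`. -/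
theorem IsCubicDecomposition.fst_theta (h : IsCubicDecomposition D τ π) (h2 : (2 : F) ≠ 0)
    (ht : ∀ x, formTrace Q x = 4 * τ x) (x : B) : τ (thetaMap Q x) = τ x := by
  rw [thetaMap, map_add, map_neg, map_smul, h.fst_one, ht, smul_eq_mul]
  field_simp
  ring

theorem IsCubicDecomposition.snd_theta (h : IsCubicDecomposition D τ π) (x : B) :
    π (thetaMap Q x) = -π x := by
  rw [thetaMap, map_add, map_neg, map_smul, h.snd_one, smul_zero, add_zero]

variable {K : Type w} [CommRing K] [Algebra F K] {σ : K ≃ₐ[F] K}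

/-- The map `(β + b) + s₀ (γ + c) ↦ (β + γ ι, ½ (b + ι c))`. -/
noncomputable def cayleyDicksonMap (τ : B →ₗ[F] F) (π : B →ₗ[F] J) (Q : B →ₚₗ[F] F) (μ : F)
    (σ : K ≃ₐ[F] K) (E : HermitianCubicNormData K (K ⊗[F] J)) (ι : K) :
    CayleyDicksonAlgebra Q μ →ₗ[F] HermitianAlgebra σ E where
  toFun x := (τ x.1 • (1 : K) + τ x.2 • ι,
    -- Halving the `J`-part matches the constants: `T(½a, ½c) = ¼T(a, c)` and `(½a) × (½c) = ½ · ½(a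
    -- × c)`.
    (2 : F)⁻¹ • ((1 : K) ⊗ₜ[F] π x.1 + ι ⊗ₜ[F] π x.2))
  map_add' x y := by
    refine Prod.ext ?_ ?_
    · change τ (x.1 + y.1) • (1 : K) + τ (x.2 + y.2) • ι =
        (τ x.1 • (1 : K) + τ x.2 • ι) + (τ y.1 • (1 : K) + τ y.2 • ι)
      rw [map_add, map_add]
      module
    · change (2 : F)⁻¹ • ((1 : K) ⊗ₜ[F] π (x.1 + y.1) + ι ⊗ₜ[F] π (x.2 + y.2)) =
        (2 : F)⁻¹ • ((1 : K) ⊗ₜ[F] π x.1 + ι ⊗ₜ[F] π x.2) +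
        (2 : F)⁻¹ • ((1 : K) ⊗ₜ[F] π y.1 + ι ⊗ₜ[F] π y.2)
      rw [map_add, map_add, TensorProduct.tmul_add, TensorProduct.tmul_add]
      module
  map_smul' r x := by
    refine Prod.ext ?_ ?_
    · change τ (r • x.1) • (1 : K) + τ (r • x.2) • ι = r • (τ x.1 • (1 : K) + τ x.2 • ι)
      rw [map_smul, map_smul, smul_eq_mul, smul_eq_mul]
      module
    · change (2 : F)⁻¹ • ((1 : K) ⊗ₜ[F] π (r • x.1) + ι ⊗ₜ[F] π (r • x.2)) =
        r • (2 : F)⁻¹ • ((1 : K) ⊗ₜ[F] π x.1 + ι ⊗ₜ[F] π x.2)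
      rw [map_smul, map_smul, TensorProduct.tmul_smul, TensorProduct.tmul_smul]
      module

variable [Algebra.IsQuadraticExtension F K] {lam : K} {hlam : lam ∉ Set.range (algebraMap F K)}

theorem IsCubicDecomposition.cayleyDicksonMap_mul (h : IsCubicDecomposition D τ π)
    (h2 : (2 : F) ≠ 0) (ht : ∀ x, formTrace Q x = 4 * τ x) (hD : D.IsCubicNorm)
    (hnd : D.TraceNondegenerate) {μ : F} {ι : K} (hsq : ι * ι = algebraMap F K μ)
    (hσ : σ ι = -ι) (x y : CayleyDicksonAlgebra Q μ) :
    cayleyDicksonMap τ π Q μ σ (D.semilinearExt σ lam hlam) ι (x * y) =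
      cayleyDicksonMap τ π Q μ σ (D.semilinearExt σ lam hlam) ι x *
        cayleyDicksonMap τ π Q μ σ (D.semilinearExt σ lam hlam) ι y := by
  obtain ⟨b, c⟩ := x
  obtain ⟨d, e⟩ := y
  have h4 : (4 : F) ≠ 0 := by
    rw [show (4 : F) = 2 * 2 by norm_num]
    exact mul_ne_zero h2 h2
  have hT : ∀ a b : J, D.trace a b = 4 * D.form a b := fun a b => by
    rw [CubicNormData.form, LinearMap.smul_apply, LinearMap.smul_apply, smul_eq_mul,
      mul_inv_cancel_left₀ h4]
  have hX : ∀ a b : J, D.cross a b = (2 : F) • D.dot a b := fun a b => by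
    rw [CubicNormData.dot, smul_inv_smul₀ h2]
  have hs : ι * ι = μ • (1 : K) := by rw [hsq, Algebra.smul_def, mul_one]
  have hh : (2 : F) * 2⁻¹ = 1 := mul_inv_cancel₀ h2
  have fθ := h.fst_theta h2 ht
  have sθ := h.snd_theta (Q := Q)
  refine Prod.ext ?_ ?_
  · change τ (b * d + μ • thetaMap Q (c * thetaMap Q e)) • (1 : K) +
        τ (thetaMap Q b * e + thetaMap Q (thetaMap Q c * thetaMap Q d)) • ι =
      (τ b • (1 : K) + τ c • ι) * (τ d • (1 : K) + τ e • ι) +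
        (D.semilinearExt σ lam hlam).trace ((2 : F)⁻¹ • ((1 : K) ⊗ₜ[F] π b + ι ⊗ₜ[F] π c))
          ((2 : F)⁻¹ • ((1 : K) ⊗ₜ[F] π d + ι ⊗ₜ[F] π e))
    simp only [← TensorProduct.tmul_smul, smul_add, CubicNormData.semilinearExt_trace_add_left,
      CubicNormData.semilinearExt_trace_add_right, CubicNormData.semilinearExt_trace_tmul, hσ,
      map_one, one_mul, mul_one, hT, map_smul, LinearMap.smul_apply, smul_eq_mul, map_add,
      h.fst_mul, fθ, sθ, map_neg, LinearMap.neg_apply, Algebra.smul_def, map_mul, map_ofNat]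
    have hk : 2 * algebraMap F K 2⁻¹ = 1 := by
      rw [← map_ofNat (algebraMap F K), ← map_mul, hh, map_one]
    linear_combination (-(2 * algebraMap F K 2⁻¹ + 1) * (algebraMap F K (D.form (π b) (π d)) +
      ι * algebraMap F K (D.form (π c) (π d)) - ι * algebraMap F K (D.form (π b) (π e)) -
      ι * ι * algebraMap F K (D.form (π c) (π e)))) * hk -
      (algebraMap F K (τ c) * algebraMap F K (τ e) -
        algebraMap F K (D.form (π c) (π e))) * hsq
  · change (2 : F)⁻¹ • ((1 : K) ⊗ₜ[F] π (b * d + μ • thetaMap Q (c * thetaMap Q e)) +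
        ι ⊗ₜ[F] π (thetaMap Q b * e + thetaMap Q (thetaMap Q c * thetaMap Q d))) =
      (τ b • (1 : K) + τ c • ι) • ((2 : F)⁻¹ • ((1 : K) ⊗ₜ[F] π d + ι ⊗ₜ[F] π e)) +
      σ (τ d • (1 : K) + τ e • ι) • ((2 : F)⁻¹ • ((1 : K) ⊗ₜ[F] π b + ι ⊗ₜ[F] π c)) +
        (D.semilinearExt σ lam hlam).cross ((2 : F)⁻¹ • ((1 : K) ⊗ₜ[F] π b + ι ⊗ₜ[F] π c))
          ((2 : F)⁻¹ • ((1 : K) ⊗ₜ[F] π d + ι ⊗ₜ[F] π e))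
    rw [hD.semilinearExt_cross hnd h2]
    have h1 : ∀ z : K ⊗[F] J, (2 : F)⁻¹ • (2 : F)⁻¹ • (2 : F) • z = (2 : F)⁻¹ • z := fun z => by
      rw [inv_smul_smul₀ h2]
    have dn : ∀ a b : J, D.dot a (-b) = -D.dot a b := fun a b => by
      rw [← neg_one_smul F b, hD.dot_smul hnd, neg_one_smul]
    have nd : ∀ a b : J, D.dot (-a) b = -D.dot a b := fun a b => by
      rw [D.dot_comm, dn, D.dot_comm]
    simp only [map_smul, LinearMap.smul_apply, map_add, LinearMap.add_apply,
      CubicNormData.IsCubicNorm.extCross_tmul, h.snd_mul, fθ, sθ, hσ, map_one,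
      one_mul, mul_one, hX]
    simp only [smul_add, add_smul, smul_assoc, one_smul, TensorProduct.smul_tmul', smul_eq_mul, hs,
      TensorProduct.tmul_add, TensorProduct.tmul_smul, TensorProduct.tmul_neg, map_smul, map_one,
      dn, nd, TensorProduct.neg_tmul, mul_smul_comm, mul_one, neg_mul]
    simp only [← TensorProduct.smul_tmul', TensorProduct.neg_tmul, smul_neg, h1]
    module

theorem IsCubicDecomposition.cayleyDicksonMap_star (h : IsCubicDecomposition D τ π)
    (h2 : (2 : F) ≠ 0) (ht : ∀ x, formTrace Q x = 4 * τ x) {μ : F} {ι : K}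
    (hσ : σ ι = -ι) (x : CayleyDicksonAlgebra Q μ) :
    cayleyDicksonMap τ π Q μ σ (D.semilinearExt σ lam hlam) ι (star x) =
      star (cayleyDicksonMap τ π Q μ σ (D.semilinearExt σ lam hlam) ι x) := by
  obtain ⟨b, c⟩ := x
  refine Prod.ext ?_ ?_
  · change τ b • (1 : K) + τ (-thetaMap Q c) • ι = σ (τ b • (1 : K) + τ c • ι)
    rw [map_neg, h.fst_theta h2 ht, map_add, map_smul, map_smul, hσ, map_one]
    module
  · change (2 : F)⁻¹ • ((1 : K) ⊗ₜ[F] π b + ι ⊗ₜ[F] π (-thetaMap Q c)) =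
      (2 : F)⁻¹ • ((1 : K) ⊗ₜ[F] π b + ι ⊗ₜ[F] π c)
    rw [map_neg, h.snd_theta, neg_neg]

theorem IsCubicDecomposition.cayleyDicksonMap_bijective (h : IsCubicDecomposition D τ π)
    (h2 : (2 : F) ≠ 0) {μ : F} {ι : K} (hι : ι ∉ Set.range (algebraMap F K)) :
    Function.Bijective (cayleyDicksonMap τ π Q μ σ (D.semilinearExt σ lam hlam) ι) := by
  constructor
  · rw [injective_iff_map_eq_zero]
    rintro ⟨b, c⟩ hx
    have e1 : τ b • (1 : K) + τ c • ι = 0 := congrArg Prod.fst hx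
    have e2 : (2 : F)⁻¹ • ((1 : K) ⊗ₜ[F] π b + ι ⊗ₜ[F] π c) = 0 := congrArg Prod.snd hx
    rw [Algebra.smul_def, Algebra.smul_def, mul_one] at e1
    obtain ⟨hb, hc⟩ := quad_coords_eq_zero hι e1
    have e3 := (smul_eq_zero.1 e2).resolve_left (inv_ne_zero h2)
    -- Coordinates are taken with respect to the basis `(1, ι)`, not the basis `(1, lam)` defining
    -- the extension.
    have e4 := extCoord_zero ι hι (π b) (π c)
    have e5 := extCoord_one ι hι (π b) (π c)
    rw [e3, map_zero] at e4 e5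
    exact Prod.ext (h.ext b hb e4.symm) (h.ext c hc e5.symm)
  · rintro ⟨s, x⟩
    obtain ⟨b, hb, hb'⟩ := h.surj ((quadBasis ι hι).coord 0 s) ((2 : F) • extCoord ι hι 0 x)
    obtain ⟨c, hc, hc'⟩ := h.surj ((quadBasis ι hι).coord 1 s) ((2 : F) • extCoord ι hι 1 x)
    refine ⟨(b, c), Prod.ext ?_ ?_⟩
    · change τ b • (1 : K) + τ c • ι = s
      rw [hb, hc, Algebra.smul_def, Algebra.smul_def, mul_one, ← exists_quad_coords]
    · change (2 : F)⁻¹ • ((1 : K) ⊗ₜ[F] π b + ι ⊗ₜ[F] π c) = x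
      rw [hb', hc', TensorProduct.tmul_smul, TensorProduct.tmul_smul, ← smul_add,
        inv_smul_smul₀ h2, ← eq_extCoord]

/-- The Cayley-Dickson algebra is isomorphic to the algebra of the hermitian extension. -/
theorem IsCubicDecomposition.isomorphic (h : IsCubicDecomposition D τ π)
    (h2 : (2 : F) ≠ 0) (ht : ∀ x, formTrace Q x = 4 * τ x) (hD : D.IsCubicNorm)
    (hnd : D.TraceNondegenerate) {μ : F} {ι : K} (hι : ι ∉ Set.range (algebraMap F K))
    (hsq : ι * ι = algebraMap F K μ) (hσ : σ ι = -ι) :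
    AlgInvolutionIsomorphic F (CayleyDicksonAlgebra Q μ)
      (HermitianAlgebra σ (D.semilinearExt σ lam hlam)) :=
  ⟨LinearEquiv.ofBijective _ (h.cayleyDicksonMap_bijective h2 hι),
    h.cayleyDicksonMap_mul h2 ht hD hnd hsq hσ, h.cayleyDicksonMap_star h2 ht hσ⟩

end CayleyDicksonIsomorphism

theorem AlgInvolutionIsomorphic.symm {F : Type u} [Field F] {A : Type v} [AddCommGroup A]
    [Module F A] [Mul A] [Star A] {A' : Type w} [AddCommGroup A'] [Module F A'] [Mul A'] [Star A']
    (h : AlgInvolutionIsomorphic F A A') : AlgInvolutionIsomorphic F A' A := by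
  obtain ⟨e, h1, h2⟩ := h
  refine ⟨e.symm, fun x y => ?_, fun x => ?_⟩
  · apply e.injective
    rw [h1, e.apply_symm_apply, e.apply_symm_apply, e.apply_symm_apply]
  · apply e.injective
    rw [h2, e.apply_symm_apply, e.apply_symm_apply]

/-! ### Infinitesimal consequences of Jordan composition: associativity of the trace -/

theorem coeff_toLaurent_natCast {A : Type*} [CommRing A] (f : Polynomial A) (n : ℕ) :
    (Polynomial.toLaurent f).coeff (n : ℤ) = f.coeff n := by
  rw [LaurentPolynomial.coeff_toLaurent]
  exact Finsupp.mapDomain_apply Nat.cast_injective _ _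

theorem coeff_T_mul {A : Type*} [CommRing A] (f : LaurentPolynomial A) (n : ℤ) :
    (LaurentPolynomial.T n * f).coeff n = f.coeff 0 := by
  rw [LaurentPolynomial.T, AddMonoidAlgebra.coeff_single_mul_eq_mul_coeff 0 (by simp), one_mul]

/-- Stated existentially so that several independent infinitesimals can be adjoined in turn without
handling nested dual numbers. -/
theorem exists_square_zero (F A : Type u) [CommRing F] [CommRing A] [Algebra F A] :
    ∃ (S : Type u) (_ : CommRing S) (_ : Algebra F S) (f : A →ₐ[F] S) (η : S), η * η = 0 ∧
      ∀ a, η * f a = 0 → a = 0 := by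
  refine ⟨DualNumber A, inferInstance, inferInstance, TrivSqZeroExt.inlAlgHom F A A,
    DualNumber.eps, DualNumber.eps_mul_eps, fun a h => ?_⟩
  have h' := congrArg TrivSqZeroExt.snd h
  simpa using h'

section JordanNormTrace

attribute [local instance] tensorNonAssocCommRing

variable {F : Type u} [Field F] {B : Type v} [NonAssocCommRing B] [Module F B]
  [IsScalarTower F B B] [SMulCommClass F B B]

omit [IsScalarTower F B B] [SMulCommClass F B B] in
/-- The value of a form depends on its argument modulo `s` only modulo `s`. -/
theorem dvd_formEval_add_smul_sub (Q : B →ₚₗ[F] F) {S : Type u} [CommRing S] [Algebra F S] (s : S)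
    (z w : S ⊗[F] B) : s ∣ formEval Q S (z + s • w) - formEval Q S z := by
  have h : Ideal.Quotient.mkₐ F (Ideal.span {s}) s = 0 :=
    Ideal.Quotient.eq_zero_iff_mem.2 (Ideal.mem_span_singleton_self s)
  rw [← Ideal.mem_span_singleton, ← Ideal.Quotient.eq_zero_iff_mem, map_sub,
    ← Ideal.Quotient.mkₐ_eq_mk F, ← formEval_map, ← formEval_map, map_add, rTensor_smul_tensor, h,
    zero_smul, add_zero, sub_self]

/-- A form of degree `d`, restricted to a line with direction `v`, is a polynomial whose
coefficient in degree `d` is the value of the form at `v`. -/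
theorem coeff_formEval_line {Q : B →ₚₗ[F] F} {d : ℕ} (hQ : IsJordanNorm Q d) {A : Type u}
    [CommRing A] [Algebra F A] (x y : A ⊗[F] B) :
    (formEval Q (Polynomial A) ((Polynomial.CAlgHom : A →ₐ[F] Polynomial A).toLinearMap.rTensor B x +
      (Polynomial.X : Polynomial A) •
        (Polynomial.CAlgHom : A →ₐ[F] Polynomial A).toLinearMap.rTensor B y)).coeff d =
      formEval Q A y := by
  let c : A →ₐ[F] Polynomial A := Polynomial.CAlgHom
  let l : Polynomial A →ₐ[F] LaurentPolynomial A := Polynomial.toLaurentAlg.restrictScalars F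
  let i : LaurentPolynomial A →ₐ[F] LaurentPolynomial A :=
    (LaurentPolynomial.invert (R := A)).toAlgHom.restrictScalars F
  let e : Polynomial A →ₐ[F] A := (Polynomial.aeval (0 : A)).restrictScalars F
  have hil : (i.comp l).comp c = l.comp c := by
    ext a
    simp [i, l, c]
  have hrT : ∀ {S₁ S₂ S₃ : Type u} [CommRing S₁] [Algebra F S₁] [CommRing S₂] [Algebra F S₂]
      [CommRing S₃] [Algebra F S₃] (f : S₁ →ₐ[F] S₂) (g : S₂ →ₐ[F] S₃) (z : S₁ ⊗[F] B),
      g.toLinearMap.rTensor B (f.toLinearMap.rTensor B z) =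
        (g.comp f).toLinearMap.rTensor B z := by
    intro S₁ S₂ S₃ _ _ _ _ _ _ f g z
    rw [← LinearMap.comp_apply, ← LinearMap.rTensor_comp, AlgHom.comp_toLinearMap]
  -- Over Laurent polynomials, homogeneity reads `Q(x + Ty) = T^d Q(T⁻¹x + y)`. Thus the coefficient
  -- of `T^d` on the left is the constant coefficient of `Q(Tx + y)`, its value at `T = 0`.
  have h1 : l (formEval Q (Polynomial A) (c.toLinearMap.rTensor B x +
      (Polynomial.X : Polynomial A) • c.toLinearMap.rTensor B y)) = LaurentPolynomial.T d *
      i (l (formEval Q (Polynomial A) ((Polynomial.X : Polynomial A) • c.toLinearMap.rTensor B x +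
        c.toLinearMap.rTensor B y))) := by
    have hT : (LaurentPolynomial.T d : LaurentPolynomial A) = LaurentPolynomial.T 1 ^ d := by
      rw [LaurentPolynomial.T_pow, mul_one]
    have hi : i (l Polynomial.X) = LaurentPolynomial.T (-1) := by simp [i, l]
    have hl : l Polynomial.X = LaurentPolynomial.T 1 := by simp [l]
    rw [hT, ← formEval_map, ← formEval_map, ← formEval_map, ← hQ.homogeneous]
    simp only [map_add, rTensor_smul_tensor, smul_add, smul_smul, hrT]
    rw [← AlgHom.comp_assoc, hil, hi, hl, ← LaurentPolynomial.T_add, add_neg_cancel,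
      LaurentPolynomial.T_zero, one_smul]
  have h2 := congrArg (fun z : LaurentPolynomial A => z.coeff (d : ℤ)) h1
  have h3 : ∀ f, e f = f.coeff 0 := fun f => by
    rw [Polynomial.coeff_zero_eq_aeval_zero]
    rfl
  have hec : e.comp c = AlgHom.id F A := by
    ext a
    simp [e, c]
  have h4 : formEval Q A y = (formEval Q (Polynomial A) ((Polynomial.X : Polynomial A) •
      c.toLinearMap.rTensor B x + c.toLinearMap.rTensor B y)).coeff 0 := by
    rw [← h3, ← formEval_map, map_add, rTensor_smul_tensor, h3, Polynomial.coeff_X_zero, zero_smul,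
      zero_add, hrT, hec, AlgHom.toLinearMap_id, LinearMap.rTensor_id, LinearMap.id_apply]
  rw [h4, ← coeff_toLaurent_natCast, ← coeff_toLaurent_natCast]
  refine h2.trans ((coeff_T_mul _ _).trans ?_)
  exact LaurentPolynomial.invert_apply _ _

namespace IsJordanNorm

variable {Q : B →ₚₗ[F] F} {d : ℕ} (hQ : IsJordanNorm Q d)

include hQ

theorem formEval_one (S : Type u) [CommRing S] [Algebra F S] : formEval Q S 1 = 1 := by
  rw [← rTensor_one_tensor (Algebra.ofId F S), formEval_map, Algebra.TensorProduct.one_def,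
    hQ.map_one, _root_.map_one]

/-- Any square-zero `η` is the image of `ε`, so this is the definition of the trace pushed along a
map from the dual numbers. -/
theorem formEval_one_add {S : Type u} [CommRing S] [Algebra F S] {η : S} (hη : η * η = 0) (x : B) :
    formEval Q S (1 + η ⊗ₜ[F] x) = 1 + η * algebraMap F S (formTrace Q x) := by
  let φ : DualNumber F →ₐ[F] S :=
    DualNumber.lift ⟨(Algebra.ofId F S, η), hη, fun a => Commute.all _ _⟩
  have hφ : φ DualNumber.eps = η := DualNumber.lift_apply_eps _
  have h1 : (formEval Q (DualNumber F) ((1 : DualNumber F) ⊗ₜ[F] (1 : B) +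
      (DualNumber.eps : DualNumber F) ⊗ₜ[F] x)).fst = 1 := by
    have h := formEval_map Q (TrivSqZeroExt.fstHom F F F) ((1 : DualNumber F) ⊗ₜ[F] (1 : B) +
      (DualNumber.eps : DualNumber F) ⊗ₜ[F] x)
    rw [TrivSqZeroExt.fstHom_apply] at h
    rw [← h, map_add, LinearMap.rTensor_tmul, LinearMap.rTensor_tmul, AlgHom.toLinearMap_apply,
      AlgHom.toLinearMap_apply, TrivSqZeroExt.fstHom_apply, TrivSqZeroExt.fstHom_apply,
      DualNumber.fst_eps, TensorProduct.zero_tmul, add_zero, TrivSqZeroExt.fst_one, hQ.map_one]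
  have h2 : formEval Q (DualNumber F) ((1 : DualNumber F) ⊗ₜ[F] (1 : B) +
      (DualNumber.eps : DualNumber F) ⊗ₜ[F] x) =
      1 + formTrace Q x • (DualNumber.eps : DualNumber F) := by
    refine TrivSqZeroExt.ext ?_ ?_
    · simp [h1]
    · simp [formTrace]
  have h3 := formEval_map Q φ ((1 : DualNumber F) ⊗ₜ[F] (1 : B) +
      (DualNumber.eps : DualNumber F) ⊗ₜ[F] x)
  rw [h2, map_add, map_add, map_smul, hφ, _root_.map_one, LinearMap.rTensor_tmul,
    LinearMap.rTensor_tmul, AlgHom.toLinearMap_apply, AlgHom.toLinearMap_apply, hφ,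
    _root_.map_one] at h3
  rw [Algebra.TensorProduct.one_def, h3, Algebra.smul_def, mul_comm]

/-- The logarithmic derivative of a Jordan norm at `z` in the direction `x z` is the trace
of `x`. -/
theorem formEval_add_smul_mul (h2 : (2 : F) ≠ 0) {S : Type u} [CommRing S] [Algebra F S] {η : S}
    (hη : η * η = 0) (x z : S ⊗[F] B) :
    formEval Q S (z + η • (x * z)) =
      (1 + η * traceExt S (formTrace Q) x) * formEval Q S z := by
  induction x generalizing z with
  | zero => simp
  | add x y hx hy =>
    -- The deformation along `x` is applied at the point already deformed along `y`; the cross terms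
    -- carry `η² = 0`.
    have h := hx (z + η • (y * z))
    rw [hy, mul_add, smul_add, mul_smul_comm, smul_smul, hη, zero_smul, add_zero, add_assoc,
      ← smul_add, ← add_mul, add_comm y x] at h
    rw [h, map_add]
    linear_combination traceExt S (formTrace Q) x * traceExt S (formTrace Q) y * formEval Q S z * hη
  | tmul k x =>
    obtain ⟨i, hi⟩ : ∃ i : S, i = algebraMap F S 2⁻¹ := ⟨_, rfl⟩
    have hi2 : 2 * i = 1 := by
      rw [hi, ← map_ofNat (algebraMap F S), ← map_mul, mul_inv_cancel₀ h2, _root_.map_one]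
    have hη' : i * η * k * (i * η * k) = 0 := by
      linear_combination i * i * k * k * hη
    -- With `i = ½`, the square-zero terms drop out of `U` and it sends `z` to `z + η(kx)z`;
    -- squaring the value of `Q` at the operator's argument doubles `½` back to `1`.
    have h := hQ.map_U S (1 + (i * η * k) ⊗ₜ[F] x) z
    have e : (i * η * k) ⊗ₜ[F] x * ((i * η * k) ⊗ₜ[F] x * z) = 0 := by
      have : (i * η * k) ⊗ₜ[F] x = (i * η * k) • ((1 : S) ⊗ₜ[F] x) := by
        rw [TensorProduct.smul_tmul', smul_eq_mul, mul_one]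
      rw [this, smul_mul_assoc, smul_mul_assoc, mul_smul_comm, smul_smul, hη', zero_smul]
    have e' : (i * η * k) ⊗ₜ[F] x * (i * η * k) ⊗ₜ[F] x = 0 := by
      rw [Algebra.TensorProduct.tmul_mul_tmul, hη', TensorProduct.zero_tmul]
    have e3 : η • (k ⊗ₜ[F] x * z) = (i * η * k) ⊗ₜ[F] x * z + (i * η * k) ⊗ₜ[F] x * z := by
      rw [← add_mul, ← TensorProduct.add_tmul, ← smul_mul_assoc, TensorProduct.smul_tmul',
        smul_eq_mul]
      congr 2
      linear_combination (-η * k) * hi2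
    rw [hQ.formEval_one_add hη'] at h
    simp only [add_mul, mul_add, one_mul, mul_one, e, e', add_zero] at h
    rw [e3, traceExt_tmul]
    refine Eq.trans (congrArg _ ?_) (h.trans ?_)
    · abel
    · linear_combination (formEval Q S z * η * k * algebraMap F S (formTrace Q x)) * hi2 +
        formEval Q S z * i * i * k * k * algebraMap F S (formTrace Q x) ^ 2 * hη

/-- The trace form of a Jordan norm is associative. -/
theorem trace_assoc (h2 : (2 : F) ≠ 0) (a b c : B) :
    formTrace Q (a * b * c) = formTrace Q (a * (b * c)) := by
  -- Associativity of the trace is the vanishing of `t` on all `[L_x, L_y]b`.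
  suffices h : ∀ x y b : B, formTrace Q (x * (y * b) - y * (x * b)) = 0 by
    have h' := h a c b
    rw [map_sub, sub_eq_zero] at h'
    rw [mul_comm b c, h', mul_comm]
  intro x y b
  obtain ⟨S, _, _, η₁, η₂, δ, e1, e2, e3, hS⟩ : ∃ (S : Type u) (_ : CommRing S) (_ : Algebra F S)
      (η₁ η₂ δ : S), η₁ * η₁ = 0 ∧ η₂ * η₂ = 0 ∧ δ * δ = 0 ∧
        ∀ r : F, η₁ * η₂ * δ * algebraMap F S r = 0 → r = 0 := by
    obtain ⟨S₁, _, _, f₁, δ, e3, h3⟩ := exists_square_zero F F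
    obtain ⟨S₂, _, _, f₂, η₂, e2, h2⟩ := exists_square_zero F S₁
    obtain ⟨S₃, _, _, f₃, η₁, e1, h1⟩ := exists_square_zero F S₂
    refine ⟨S₃, inferInstance, inferInstance, η₁, f₃ η₂, f₃ (f₂ δ), e1, ?_, ?_, fun r hr => ?_⟩
    · rw [← map_mul, e2, map_zero]
    · rw [← map_mul, ← map_mul, e3, map_zero, map_zero]
    · rw [mul_assoc, mul_assoc, ← f₃.commutes r, ← map_mul, ← map_mul] at hr
      have hr := h1 _ hr
      rw [← f₂.commutes r, ← map_mul] at hr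
      refine h3 r ?_
      rw [← h2 _ hr]
      congr 1
      exact f₁.commutes r
  obtain ⟨ω, hω⟩ : ∃ ω, ω = η₁ * η₂ * δ := ⟨_, rfl⟩
  have hω₁ : ω * η₁ = 0 := by linear_combination η₁ * hω + δ * η₂ * e1
  have hω₂ : ω * η₂ = 0 := by linear_combination η₂ * hω + δ * η₁ * e2
  have hω₃ : ω * δ = 0 := by linear_combination δ * hω + η₁ * η₂ * e3
  have hωω : ω * ω = 0 := by linear_combination ω * hω + η₂ * δ * hω₁
  rw [← hω] at hS
  obtain ⟨X, hX⟩ : ∃ X, X = (1 : S) ⊗ₜ[F] x := ⟨_, rfl⟩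
  obtain ⟨Y, hY⟩ : ∃ Y, Y = (1 : S) ⊗ₜ[F] y := ⟨_, rfl⟩
  obtain ⟨b', hb⟩ : ∃ b', b' = (1 : S) ⊗ₜ[F] b := ⟨_, rfl⟩
  obtain ⟨C, hC⟩ : ∃ C, C = X * (Y * b') - Y * (X * b') := ⟨_, rfl⟩
  have hC' : C = (1 : S) ⊗ₜ[F] (x * (y * b) - y * (x * b)) := by
    rw [hC, hX, hY, hb, TensorProduct.tmul_sub]
    simp only [Algebra.TensorProduct.tmul_mul_tmul, mul_one]
  obtain ⟨z, hz⟩ : ∃ z : S ⊗[F] B, z = 1 + δ • (b' * 1) := ⟨_, rfl⟩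
  obtain ⟨w, hw⟩ : ∃ w, w = z + η₁ • (X * z) + η₂ • (Y * (z + η₁ • (X * z))) := ⟨_, rfl⟩
  have hz1 := hQ.formEval_add_smul_mul h2 e3 b' 1
  have hw1 := hQ.formEval_add_smul_mul h2 e2 Y (z + η₁ • (X * z))
  have hu1 := hQ.formEval_add_smul_mul h2 e1 X (z + η₂ • (Y * z))
  rw [hQ.formEval_add_smul_mul h2 e1, ← hw, hz, hz1, hQ.formEval_one] at hw1
  rw [hQ.formEval_add_smul_mul h2 e2] at hu1
  rw [← hz, hQ.formEval_one] at hz1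
  have hwC : ω • (C * w) = ω • C := by
    have hw1 : ω • w = ω • (1 : S ⊗[F] B) := by
      rw [hw, hz]
      simp only [smul_add, smul_smul, mul_add, mul_smul_comm, ← mul_assoc, hω₁, hω₂, hω₃,
        zero_mul, zero_smul, add_zero]
    rw [← mul_smul_comm, hw1, mul_smul_comm, mul_one]
  -- The two orders of deformation differ by `η₁η₂[L_X, L_Y]z`. As `[L_X, L_Y]1 = 0`, only the part
  -- `δb` of `z` survives, giving `ωC`. Since `ω` kills all three parameters, `ωC = ω(Cw)`, a
  -- direction to which the logarithmic derivative formula applies.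
  have hu : z + η₂ • (Y * z) + η₁ • (X * (z + η₂ • (Y * z))) = w + ω • (C * w) := by
    rw [hwC, hω, hw, hC, hz]
    simp only [mul_add, mul_one, smul_add, mul_smul_comm, smul_sub, smul_smul, mul_comm Y X]
    module
  rw [hu, hQ.formEval_add_smul_mul h2 hωω, hw1, hz1, hC', traceExt_tmul] at hu1
  apply hS
  generalize traceExt S (formTrace Q) X = p at hu1
  generalize traceExt S (formTrace Q) Y = q at hu1
  generalize traceExt S (formTrace Q) b' = r at hu1
  generalize algebraMap F S _ = s at hu1 ⊢
  linear_combination hu1 - s * q * (1 + η₁ * p) * (1 + δ * r) * hω₂ -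
    s * p * (1 + δ * r) * hω₁ - s * r * hω₃

end IsJordanNorm

end JordanNormTrace

/-! ### Newton's identities and the Cayley–Hamilton equation -/

section JordanNormLine

attribute [local instance] tensorNonAssocCommRing

variable {F : Type u} [Field F] {B : Type v} [NonAssocCommRing B] [Module F B]
  [IsScalarTower F B B] [SMulCommClass F B B]

/-- The value of the form `Q` at `1 + s b + e y`. -/
noncomputable def lineForm (Q : B →ₚₗ[F] F) {S : Type u} [CommRing S] [Algebra F S] (s e : S)
    (b y : B) : S :=
  formEval Q S (1 + s ⊗ₜ[F] b + e ⊗ₜ[F] y)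

/-- The generating polynomial of the traces `(-1) ^ k t (L_b ^ k y)`, up to degree `4`. -/
def traceForm (t : B →ₗ[F] F) {S : Type u} [CommRing S] [Algebra F S] (s : S) (b y : B) : S :=
  algebraMap F S (t y) - s * algebraMap F S (t (b * y)) +
    s ^ 2 * algebraMap F S (t (b * (b * y))) -
    s ^ 3 * algebraMap F S (t (b * (b * (b * y)))) +
    s ^ 4 * algebraMap F S (t (b * (b * (b * (b * y)))))

section Generic

variable {Q : B →ₚₗ[F] F} {S S' : Type u} [CommRing S] [Algebra F S] [CommRing S'] [Algebra F S']

omit [IsScalarTower F B B] [SMulCommClass F B B] in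
theorem map_lineForm (φ : S →ₐ[F] S') (s e : S) (b y : B) :
    φ (lineForm Q s e b y) = lineForm Q (φ s) (φ e) b y := by
  rw [lineForm, ← formEval_map, map_add, map_add, rTensor_one_tensor, LinearMap.rTensor_tmul,
    LinearMap.rTensor_tmul, AlgHom.toLinearMap_apply, AlgHom.toLinearMap_apply, lineForm]

omit [IsScalarTower F B B] [SMulCommClass F B B] in
theorem map_traceForm (φ : S →ₐ[F] S') (t : B →ₗ[F] F) (s : S) (b y : B) :
    φ (traceForm t s b y) = traceForm t (φ s) b y := by
  simp only [traceForm, map_add, map_sub, map_mul, map_pow, AlgHom.commutes]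

omit [IsScalarTower F B B] [SMulCommClass F B B] in
theorem rTensor_line (φ : S →ₐ[F] S') (s : S') (e : S) (b y : B) :
    φ.toLinearMap.rTensor B (1 + e ⊗ₜ[F] y) + s • φ.toLinearMap.rTensor B ((1 : S) ⊗ₜ[F] b) =
      1 + s ⊗ₜ[F] b + φ e ⊗ₜ[F] y := by
  rw [map_add, rTensor_one_tensor, LinearMap.rTensor_tmul, LinearMap.rTensor_tmul,
    TensorProduct.smul_tmul', AlgHom.toLinearMap_apply, AlgHom.toLinearMap_apply, map_one,
    smul_eq_mul, mul_one, add_right_comm]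

omit [IsScalarTower F B B] [SMulCommClass F B B] in
theorem formEval_one_tmul (Q : B →ₚₗ[F] F) (S : Type u) [CommRing S] [Algebra F S] (b : B) :
    formEval Q S ((1 : S) ⊗ₜ[F] b) = algebraMap F S (formEval Q F ((1 : F) ⊗ₜ[F] b)) := by
  have h := formEval_map Q (Algebra.ofId F S) ((1 : F) ⊗ₜ[F] b)
  rwa [LinearMap.rTensor_tmul, AlgHom.toLinearMap_apply, map_one] at h

theorem IsJordanNorm.lineForm_zero_zero {d : ℕ} (hQ : IsJordanNorm Q d) (b y : B) :
    lineForm Q (0 : S) 0 b y = 1 := by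
  rw [lineForm, TensorProduct.zero_tmul, TensorProduct.zero_tmul, add_zero, add_zero,
    hQ.formEval_one]

/-- To deform `z = 1 + sb` in direction `y` one needs `x` with `xz = y`. The geometric series for
`(1 + sL_b)⁻¹y`, cut off after `s⁴`, solves this up to a multiple of `s⁵`, and `Q` respects
congruences. -/
theorem IsJordanNorm.dvd_lineForm {d : ℕ} (hQ : IsJordanNorm Q d) (h2 : (2 : F) ≠ 0) (s : S)
    {e : S} (he : e * e = 0) (b y : B) : s ^ 5 ∣
      (1 + e * traceForm (formTrace Q) s b y) * lineForm Q s 0 b y - lineForm Q s e b y := by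
  obtain ⟨z, hz⟩ : ∃ z : S ⊗[F] B, z = 1 + s ⊗ₜ[F] b := ⟨_, rfl⟩
  obtain ⟨x, hx⟩ : ∃ x : S ⊗[F] B, x = 1 ⊗ₜ[F] y - s ⊗ₜ[F] (b * y) +
    (s ^ 2) ⊗ₜ[F] (b * (b * y)) - (s ^ 3) ⊗ₜ[F] (b * (b * (b * y))) +
    (s ^ 4) ⊗ₜ[F] (b * (b * (b * (b * y)))) := ⟨_, rfl⟩
  have hxt : traceExt S (formTrace Q) x = traceForm (formTrace Q) s b y := by
    simp only [hx, map_add, map_sub, traceExt_tmul, traceForm, one_mul]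
  have hxz : z + e • (x * z) = 1 + s ⊗ₜ[F] b + e ⊗ₜ[F] y +
      (s ^ 5) • (e ⊗ₜ[F] (b * (b * (b * (b * (b * y)))))) := by
    rw [mul_comm x, hz, hx]
    simp only [add_mul, one_mul, mul_add, mul_sub, Algebra.TensorProduct.tmul_mul_tmul, mul_one,
      ← pow_succ', ← sq, smul_add, smul_sub, TensorProduct.smul_tmul', smul_eq_mul]
    rw [mul_comm (s ^ 5)]
    abel
  have hdvd := dvd_formEval_add_smul_sub Q (s ^ 5) (1 + s ⊗ₜ[F] b + e ⊗ₜ[F] y)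
    (e ⊗ₜ[F] (b * (b * (b * (b * (b * y))))))
  rw [← hxz, hQ.formEval_add_smul_mul h2 he, hxt, ← hz] at hdvd
  rwa [lineForm, lineForm, TensorProduct.zero_tmul, add_zero, ← hz]

end Generic

theorem aeval_add_of_sq_eq_zero' {F : Type u} {S : Type w} [CommRing F] [CommRing S] [Algebra F S]
    (p : Polynomial F) (x e : S) (he : e ^ 2 = 0) :
    Polynomial.aeval (x + e) p =
      Polynomial.aeval x p + e * Polynomial.aeval x (Polynomial.derivative p) := by
  rw [Polynomial.aeval_add_of_sq_eq_zero p x e he, mul_comm e]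

theorem snd_coeff_map_add {F : Type u} [Field F] (p q : Polynomial F) (j : ℕ) :
    ((Polynomial.mapAlgHom (Algebra.ofId F (DualNumber F)) p + Polynomial.C DualNumber.eps *
      Polynomial.mapAlgHom (Algebra.ofId F (DualNumber F)) q).coeff j).snd = q.coeff j := by
  simp [Polynomial.coe_mapAlgHom, TrivSqZeroExt.algebraMap_eq_inl]

/-- The polynomial `Q(1 + T b)`. -/
noncomputable def linePolynomial (Q : B →ₚₗ[F] F) (b : B) : Polynomial F :=
  lineForm Q Polynomial.X 0 b 0

/-- The form `Q` evaluated at `1 + T b + ε y`. -/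
noncomputable def lineDeformation (Q : B →ₚₗ[F] F) (b y : B) : Polynomial (DualNumber F) :=
  lineForm Q Polynomial.X (Polynomial.C DualNumber.eps) b y

omit [IsScalarTower F B B] [SMulCommClass F B B] in
theorem lineForm_zero (Q : B →ₚₗ[F] F) {S : Type u} [CommRing S] [Algebra F S] (s : S) (b y y' : B) :
    lineForm Q s 0 b y = lineForm Q s 0 b y' := by
  rw [lineForm, lineForm, TensorProduct.zero_tmul, TensorProduct.zero_tmul]

omit [IsScalarTower F B B] [SMulCommClass F B B] in
theorem lineForm_self (Q : B →ₚₗ[F] F) {S : Type u} [CommRing S] [Algebra F S] (s e : S) (b : B) :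
    lineForm Q s e b b = lineForm Q (s + e) 0 b 0 := by
  rw [lineForm, lineForm, TensorProduct.zero_tmul, add_zero, TensorProduct.add_tmul, add_assoc]

-- For `y = b` the deformation is the shift `T ↦ T + ε`, whose `ε`-part is the derivative in `T`.
omit [IsScalarTower F B B] [SMulCommClass F B B] in
theorem snd_coeff_lineDeformation_self (Q : B →ₚₗ[F] F) (b : B) (j : ℕ) :
    ((lineDeformation Q b b).coeff j).snd = (linePolynomial Q b).coeff (j + 1) * (j + 1) := by
  have h0 : (Polynomial.C DualNumber.eps : Polynomial (DualNumber F)) ^ 2 = 0 := by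
    rw [← Polynomial.C_pow, sq, DualNumber.eps_mul_eps, Polynomial.C_0]
  have h := map_lineForm (Q := Q) (Polynomial.aeval (R := F)
    (Polynomial.X + Polynomial.C DualNumber.eps : Polynomial (DualNumber F))) Polynomial.X 0 b 0
  rw [Polynomial.aeval_X, map_zero] at h
  have ha := fun q : Polynomial F => aeval_add_of_sq_eq_zero' q
    (Polynomial.X : Polynomial (DualNumber F)) _ h0
  have hm : ∀ q : Polynomial F, Polynomial.aeval (Polynomial.X : Polynomial (DualNumber F)) q =
      Polynomial.mapAlgHom (Algebra.ofId F (DualNumber F)) q := by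
    intro q
    congr 1
  rw [lineDeformation, lineForm_self, ← h, linePolynomial]
  generalize lineForm Q (Polynomial.X : Polynomial F) 0 b 0 = p
  rw [ha, hm, hm, ← Polynomial.coeff_derivative]
  exact snd_coeff_map_add p (Polynomial.derivative p) j

namespace IsJordanNorm

variable {Q : B →ₚₗ[F] F} {d : ℕ} (hQ : IsJordanNorm Q d)

include hQ

theorem snd_coeff_lineDeformation (h2 : (2 : F) ≠ 0) (b y : B) {j : ℕ} (hj : j < 5) :
    ((lineDeformation Q b y).coeff j).snd =
      (traceForm (formTrace Q) (Polynomial.X : Polynomial F) b y *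
        linePolynomial Q b).coeff j := by
  have hee : (Polynomial.C DualNumber.eps : Polynomial (DualNumber F)) *
      Polynomial.C DualNumber.eps = 0 := by
    rw [← Polynomial.C_mul, DualNumber.eps_mul_eps, Polynomial.C_0]
  have hX : Polynomial.mapAlgHom (Algebra.ofId F (DualNumber F)) (Polynomial.X : Polynomial F) =
      Polynomial.X := by
    simp [Polynomial.coe_mapAlgHom]
  have h1 := map_lineForm (Q := Q) (S := Polynomial F)
    (S' := Polynomial (DualNumber F)) (Polynomial.mapAlgHom (Algebra.ofId F (DualNumber F)))
    Polynomial.X 0 b 0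
  have h3 := map_traceForm (S := Polynomial F)
    (S' := Polynomial (DualNumber F)) (Polynomial.mapAlgHom (Algebra.ofId F (DualNumber F))) (formTrace Q)
    Polynomial.X b y
  rw [map_zero, hX] at h1
  rw [hX] at h3
  have h := (Polynomial.X_pow_dvd_iff (R := DualNumber F)).1
    (hQ.dvd_lineForm (S := Polynomial (DualNumber F)) h2 Polynomial.X hee b y) j hj
  rw [Polynomial.coeff_sub, sub_eq_zero, lineForm_zero Q _ b y 0, ← h1, ← h3, add_mul, one_mul,
    mul_assoc, ← map_mul] at h
  exact (congrArg TrivSqZeroExt.snd h.symm).trans (snd_coeff_map_add _ _ _)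

/-- The top coefficient along the line is the value of `Q` at its direction `b`, which carries no
`ε`. -/
theorem snd_coeff_lineDeformation_degree (b y : B) :
    ((lineDeformation Q b y).coeff d).snd = 0 := by
  have h := coeff_formEval_line hQ (1 + (DualNumber.eps : DualNumber F) ⊗ₜ[F] y)
    ((1 : DualNumber F) ⊗ₜ[F] b)
  have hl := congrArg (fun z => (formEval Q (Polynomial (DualNumber F)) z).coeff d)
    (rTensor_line (Polynomial.CAlgHom : DualNumber F →ₐ[F] Polynomial (DualNumber F)) Polynomial.X
      DualNumber.eps b y)
  refine (congrArg TrivSqZeroExt.snd (hl.symm.trans (h.trans (formEval_one_tmul _ _ b)))).trans ?_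
  simp [TrivSqZeroExt.algebraMap_eq_inl]

theorem coeff_zero_linePolynomial (b : B) : (linePolynomial Q b).coeff 0 = 1 := by
  have h := map_lineForm (Q := Q) (Polynomial.aeval (R := F) (0 : F)) Polynomial.X 0 b 0
  rw [Polynomial.aeval_X, map_zero, hQ.lineForm_zero_zero] at h
  rw [linePolynomial, Polynomial.coeff_zero_eq_aeval_zero, h]

omit hQ [IsScalarTower F B B] [SMulCommClass F B B] in
theorem _root_.coeff_traceForm_mul (p : Polynomial F) (t : B →ₗ[F] F) (b y : B) (j : ℕ) :
    (traceForm t (Polynomial.X : Polynomial F) b y * p).coeff j =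
      t y * p.coeff j - (if 1 ≤ j then t (b * y) * p.coeff (j - 1) else 0) +
        (if 2 ≤ j then t (b * (b * y)) * p.coeff (j - 2) else 0) -
        (if 3 ≤ j then t (b * (b * (b * y))) * p.coeff (j - 3) else 0) +
        (if 4 ≤ j then t (b * (b * (b * (b * y)))) * p.coeff (j - 4) else 0) := by
  have h := fun q : Polynomial F => Polynomial.coeff_X_pow_mul' q 1 j
  rw [pow_one] at h
  simp only [traceForm, Polynomial.algebraMap_eq, add_mul, sub_mul, mul_assoc, h,
      Polynomial.coeff_add, Polynomial.coeff_sub, Polynomial.coeff_X_pow_mul',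
      Polynomial.coeff_C_mul]

/-- The coefficients of `Q(1 + T b)` in terms of traces of powers. -/
theorem newton (h2 : (2 : F) ≠ 0) (b : B) {j : ℕ} (hj : j < 5) :
    (linePolynomial Q b).coeff (j + 1) * (j + 1) =
      (traceForm (formTrace Q) (Polynomial.X : Polynomial F) b b * linePolynomial Q b).coeff j := by
  rw [← hQ.snd_coeff_lineDeformation h2 b b hj, snd_coeff_lineDeformation_self]

end IsJordanNorm

/-- The `ε`-part of the coefficient of `T⁴` is computed twice: by the logarithmic derivative and by
homogeneity. Expanded, this is the Cayley–Hamilton equation of `b` paired with `y`. -/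
theorem IsJordanNorm.trace_cayley {Q : B →ₚₗ[F] F} (hQ : IsJordanNorm Q 4) (h2 : (2 : F) ≠ 0)
    (b y : B) :
    (traceForm (formTrace Q) (Polynomial.X : Polynomial F) b y * linePolynomial Q b).coeff 4 =
      0 := by
  rw [← hQ.snd_coeff_lineDeformation h2 b y (by norm_num), hQ.snd_coeff_lineDeformation_degree]

/-- The characteristic equation of an element of trace zero. -/
theorem IsJordanNorm.cayley_of_trace_zero {Q : B →ₚₗ[F] F} (hQ : IsJordanNorm Q 4)
    (h2 : (2 : F) ≠ 0) (h3 : (3 : F) ≠ 0) {b : B} (hb : formTrace Q b = 0) :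
    ∃ r : F, b * (b * (b * b)) =
      (2⁻¹ * formTrace Q (b * b)) • (b * b) + (3⁻¹ * formTrace Q (b * (b * b))) • b + r • 1 := by
  have hy := hQ.trace_cayley h2 b
  -- Let `c_j` be the coefficients of `Q(1 + Tb)`. For `t(b) = 0` Newton's identities give `c₁ = 0`,
  -- `2c₂ = -t(b²)` and `3c₃ = t(b³)`; the scalar `r` is `-c₄`.
  have n0 := hQ.newton h2 b (j := 0) (by norm_num)
  have n1 := hQ.newton h2 b (j := 1) (by norm_num)
  have n2 := hQ.newton h2 b (j := 2) (by norm_num)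
  have h0 := hQ.coeff_zero_linePolynomial b
  simp only [coeff_traceForm_mul] at hy n0 n1 n2
  norm_num [hb, h0] at hy n0 n1 n2
  rw [n0, mul_zero, neg_zero, zero_add] at n2
  refine ⟨-(linePolynomial Q b).coeff 4, ?_⟩
  rw [← sub_eq_zero]
  refine hQ.nondegenerate _ fun y => ?_
  have a3 : formTrace Q (b * (b * y)) = formTrace Q (b * b * y) := by
    rw [hQ.trace_assoc h2]
  have a4 : formTrace Q (b * (b * (b * (b * y)))) = formTrace Q (b * (b * (b * b)) * y) := by
    rw [← hQ.trace_assoc h2 b b, ← hQ.trace_assoc h2 (b * b), ← hQ.trace_assoc h2 (b * b * b),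
      mul_comm (b * b) b, mul_comm _ b]
  have h := hy y
  rw [a3, a4, n0] at h
  simp only [sub_mul, add_mul, smul_mul_assoc, one_mul, map_sub, map_add, map_smul, smul_eq_mul]
  have i2 := mul_inv_cancel₀ h2
  have i3 := mul_inv_cancel₀ h3
  linear_combination h - 2⁻¹ * formTrace Q (b * b * y) * n1 +
    formTrace Q (b * b * y) * (linePolynomial Q b).coeff 2 * i2 +
    3⁻¹ * formTrace Q (b * y) * n2 - formTrace Q (b * y) * (linePolynomial Q b).coeff 3 * i3

/-! ### The cubic norm structure on the trace-zero elements -/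

section TraceZero

variable {Q : B →ₚₗ[F] F} (hQ : IsJordanNorm Q 4) (h2 : (2 : F) ≠ 0)

theorem traceZeroData_trace_apply (a b : LinearMap.ker (formTrace Q)) :
    (traceZeroData hQ h2).trace a b = formTrace Q ((a : B) * b) := rfl

theorem coe_traceZeroData_adj (a : LinearMap.ker (formTrace Q)) :
    ((traceZeroData hQ h2).adj a : B) =
      (a : B) * a - ((4 : F)⁻¹ * formTrace Q ((a : B) * a)) • (1 : B) := rfl

theorem traceZeroData_norm_apply (a : LinearMap.ker (formTrace Q)) :
    (traceZeroData hQ h2).norm a = (3 : F)⁻¹ * formTrace Q ((a : B) * a * a) := rfl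

/-- Only `a♯♯ = N(a)a` needs the norm's degree 4 equation: modulo scalars `a♯♯` is `a⁴ - ½t(a²)a²`,
which Cayley–Hamilton turns into `⅓t(a³)a`. -/
theorem isCubicNorm_traceZeroData [IsCommJordan B] (h3 : (3 : F) ≠ 0) :
    (traceZeroData hQ h2).IsCubicNorm := by
  have h4 : (4 : F) ≠ 0 := by
    rw [show (4 : F) = 2 * 2 by norm_num]
    exact mul_ne_zero h2 h2
  have ht : ∀ a : LinearMap.ker (formTrace Q), formTrace Q (a : B) = 0 := fun a => a.2
  refine ⟨fun a b => ?_, fun r a => ?_, fun r a => ?_, fun a b => ?_, fun a => ?_⟩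
  · rw [traceZeroData_trace_apply, traceZeroData_trace_apply, mul_comm]
  · apply Subtype.ext
    rw [coe_traceZeroData_adj, Submodule.coe_smul, Submodule.coe_smul, coe_traceZeroData_adj]
    simp only [smul_mul_assoc, mul_smul_comm, map_smul, smul_eq_mul]
    module
  · simp only [traceZeroData_norm_apply, Submodule.coe_smul, smul_mul_assoc, mul_smul_comm,
      map_smul, smul_eq_mul]
    ring
  · have e1 : formTrace Q ((a : B) * b * a) = formTrace Q ((a : B) * a * b) := by
      rw [mul_comm ((a : B) * b), hQ.trace_assoc h2]
    have e2 : formTrace Q ((a : B) * b * b) = formTrace Q ((b : B) * b * a) := by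
      rw [mul_comm ((b : B) * b), hQ.trace_assoc h2]
    simp only [traceZeroData_norm_apply, traceZeroData_trace_apply, coe_traceZeroData_adj,
      Submodule.coe_add, add_mul, mul_add, mul_sub, map_add, map_sub, mul_smul_comm, mul_one,
      map_smul, ht, smul_zero, sub_zero, mul_comm (b : B) a, mul_comm (b : B) ((a : B) * a),
      mul_comm (a : B) ((b : B) * b), e1, e2]
    field_simp
    ring
  · obtain ⟨r, hr⟩ := hQ.cayley_of_trace_zero h2 h3 (ht a)
    have hJ : (a : B) * a * (a * a) = a * (a * (a * a)) := IsCommJordan.lmul_comm_rmul_rmul _ _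
    obtain ⟨s, hs⟩ : ∃ s : F, ((traceZeroData hQ h2).adj ((traceZeroData hQ h2).adj a) : B) =
        (traceZeroData hQ h2).norm a • (a : B) + s • 1 := by
      have h24 : (2 : F)⁻¹ = 4⁻¹ + 4⁻¹ := by
        field_simp
        norm_num
      rw [coe_traceZeroData_adj, coe_traceZeroData_adj, traceZeroData_norm_apply, mul_comm (_ * _)]
      generalize (4 : F)⁻¹ * formTrace Q (_ * ((a : B) * a - _)) = q
      refine ⟨r + (4⁻¹ * formTrace Q ((a : B) * a)) ^ 2 - q, ?_⟩
      simp only [sub_mul, mul_sub, smul_mul_assoc, mul_smul_comm, one_mul, mul_one]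
      rw [hJ, hr, h24]
      module
    -- Both `a♯♯` and `a` have trace zero, so the scalar error satisfies `4s = 0`.
    have hs0 := congrArg (formTrace Q) hs
    rw [map_add, map_smul, map_smul, ht, ht, hQ.trace_one, smul_zero, zero_add, smul_eq_mul] at hs0
    have : s = 0 := by
      refine (mul_eq_zero.1 hs0.symm).resolve_right ?_
      norm_num
      exact h4
    apply Subtype.ext
    rw [hs, this, zero_smul, add_zero, Submodule.coe_smul]

theorem coe_traceZeroData_dot (a b : LinearMap.ker (formTrace Q)) :
    ((traceZeroData hQ h2).dot a b : B) =
      (a : B) * b - ((4 : F)⁻¹ * formTrace Q ((a : B) * b)) • (1 : B) := by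
  refine smul_right_injective _ h2 ?_
  dsimp only
  rw [CubicNormData.dot, ← Submodule.coe_smul, smul_inv_smul₀ h2, CubicNormData.cross]
  simp only [Submodule.coe_sub, coe_traceZeroData_adj, Submodule.coe_add, add_mul, mul_add,
    map_add, mul_comm (b : B) a]
  module

include hQ h2 in
theorem formTrace_sub_smul_one (x : B) :
    formTrace Q (x - ((4 : F)⁻¹ * formTrace Q x) • 1) = 0 := by
  have h4 : (4 : F) ≠ 0 := by
    rw [show (4 : F) = 2 * 2 by norm_num]
    exact mul_ne_zero h2 h2
  rw [map_sub, map_smul, hQ.trace_one, smul_eq_mul, Nat.cast_ofNat, mul_right_comm,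
    inv_mul_cancel₀ h4, one_mul, sub_self]

/-- The projection onto the elements of trace zero. -/
noncomputable def traceZeroProj : B →ₗ[F] LinearMap.ker (formTrace Q) :=
  (LinearMap.id - ((4 : F)⁻¹ • formTrace Q).smulRight (1 : B)).codRestrict _
    (formTrace_sub_smul_one hQ h2)

theorem coe_traceZeroProj (x : B) :
    (traceZeroProj hQ h2 x : B) = x - ((4 : F)⁻¹ * formTrace Q x) • 1 := rfl

/-- Scalars are orthogonal to trace-zero elements, so nondegeneracy on `B` restricts to the
complement of the scalars. -/
theorem traceNondegenerate_traceZeroData : (traceZeroData hQ h2).TraceNondegenerate := by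
  have h4 : (4 : F) ≠ 0 := by
    rw [show (4 : F) = 2 * 2 by norm_num]
    exact mul_ne_zero h2 h2
  intro a ha
  refine Subtype.ext (hQ.nondegenerate _ fun c => ?_)
  have h := ha (traceZeroProj hQ h2 c)
  rw [traceZeroData_trace_apply, coe_traceZeroProj, mul_sub, mul_smul_comm, mul_one, map_sub,
    map_smul, show formTrace Q (a : B) = 0 from a.2, smul_zero, sub_zero] at h
  exact h

/-- The Jordan algebra of a Jordan norm of degree `4` is the sum of the scalars and the elements
of trace zero. -/
theorem isCubicDecomposition_traceZeroData : IsCubicDecomposition (traceZeroData hQ h2)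
    ((4 : F)⁻¹ • formTrace Q) (traceZeroProj hQ h2) := by
  have h4 : (4 : F) ≠ 0 := by
    rw [show (4 : F) = 2 * 2 by norm_num]
    exact mul_ne_zero h2 h2
  have h24 : (2 : F)⁻¹ = 4⁻¹ + 4⁻¹ := by
    field_simp
    norm_num
  have i4 : (4 : F) * 4⁻¹ = 1 := mul_inv_cancel₀ h4
  have ht1 : formTrace Q (1 : B) = 4 := by
    rw [hQ.trace_one]
    norm_num
  have hf : ∀ x y : B, (traceZeroData hQ h2).form (traceZeroProj hQ h2 x) (traceZeroProj hQ h2 y) =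
      4⁻¹ * formTrace Q (x * y) - 4⁻¹ * formTrace Q x * (4⁻¹ * formTrace Q y) := by
    intro x y
    rw [CubicNormData.form, LinearMap.smul_apply, LinearMap.smul_apply, traceZeroData_trace_apply,
      coe_traceZeroProj, coe_traceZeroProj]
    simp only [sub_mul, mul_sub, smul_mul_assoc, mul_smul_comm, one_mul, mul_one, map_sub,
      map_smul, smul_eq_mul, ht1]
    linear_combination 4⁻¹ * 4⁻¹ * formTrace Q x * formTrace Q y * i4
  refine ⟨fun x y => ?_, fun x y => ?_, ?_, ?_, fun x hx hx' => ?_, fun s a => ?_⟩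
  · simp only [LinearMap.smul_apply, smul_eq_mul]
    rw [hf]
    ring
  · apply Subtype.ext
    have hf' := hf x y
    rw [CubicNormData.form, LinearMap.smul_apply, LinearMap.smul_apply, smul_eq_mul,
      traceZeroData_trace_apply] at hf'
    rw [Submodule.coe_add, Submodule.coe_add, coe_traceZeroData_dot, hf']
    simp only [Submodule.coe_smul, coe_traceZeroProj, LinearMap.smul_apply, smul_eq_mul, sub_mul,
      mul_sub, smul_mul_assoc, mul_smul_comm, one_mul, mul_one]
    module
  · rw [LinearMap.smul_apply, ht1, smul_eq_mul, inv_mul_cancel₀ h4]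
  · apply Subtype.ext
    rw [coe_traceZeroProj, ht1, inv_mul_cancel₀ h4, one_smul, sub_self, Submodule.coe_zero]
  · have h := congrArg Subtype.val hx'
    rw [LinearMap.smul_apply, smul_eq_mul] at hx
    rwa [coe_traceZeroProj, hx, zero_smul, sub_zero] at h
  · have ha : formTrace Q (a : B) = 0 := a.2
    refine ⟨s • 1 + a, ?_, ?_⟩
    · rw [LinearMap.smul_apply, map_add, map_smul, ha, ht1, add_zero, smul_eq_mul, smul_eq_mul,
        mul_left_comm, inv_mul_cancel₀ h4, mul_one]
    · apply Subtype.ext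
      rw [coe_traceZeroProj, map_add, map_smul, ha, ht1, add_zero, smul_eq_mul, mul_left_comm,
        inv_mul_cancel₀ h4, mul_one, add_sub_cancel_left]

end TraceZero

end JordanNormLine

/-! ### Remaining coordinates and assembly of both directions -/

theorem quadraticRoot_root_notMem_range {F : Type u} [Field F] (μ : F) :
    (AdjoinRoot.root _ : QuadraticRoot μ) ∉ Set.range (algebraMap F (QuadraticRoot μ)) := by
  rintro ⟨r, hr⟩
  have h : AdjoinRoot.mk (Polynomial.X ^ 2 - Polynomial.C μ : Polynomial F)
      (Polynomial.X - Polynomial.C r) = 0 := by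
    rw [map_sub, AdjoinRoot.mk_X, AdjoinRoot.mk_C, sub_eq_zero]
    exact hr.symm
  rw [AdjoinRoot.mk_eq_zero] at h
  have hdeg := Polynomial.natDegree_le_of_dvd h (Polynomial.X_sub_C_ne_zero r)
  rw [Polynomial.natDegree_X_pow_sub_C, Polynomial.natDegree_X_sub_C] at hdeg
  omega

namespace CubicNormAlgebra

variable {F : Type u} [Field F] {J : Type v} [AddCommGroup J] [Module F J]

/-- The scalar coordinate. -/
def fstHom (D : CubicNormData F J) : CubicNormAlgebra D →ₗ[F] F where
  toFun x := x.1
  map_add' := fst_add (D := D)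
  map_smul' := fst_smul (D := D)

/-- The coordinate in the cubic norm structure. -/
def sndHom (D : CubicNormData F J) : CubicNormAlgebra D →ₗ[F] J where
  toFun x := x.2
  map_add' := snd_add (D := D)
  map_smul' := snd_smul (D := D)

theorem isCubicDecomposition {D : CubicNormData F J} [Fact D.IsCubicNorm]
    [Fact D.TraceNondegenerate] : IsCubicDecomposition D (fstHom D) (sndHom D) where
  fst_mul := CubicNormAlgebra.fst_mul (D := D)
  snd_mul := CubicNormAlgebra.snd_mul (D := D)
  fst_one := CubicNormAlgebra.fst_one (D := D)
  snd_one := CubicNormAlgebra.snd_one (D := D)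
  ext _ h h' := CubicNormAlgebra.ext h h'
  surj s a := ⟨((s, a) : F × J), rfl, rfl⟩

end CubicNormAlgebra

theorem mainTheorem6 {F : Type u} [Field F] (h2 : (2 : F) ≠ 0) (h3 : (3 : F) ≠ 0) :
    (∀ {B : Type v} [NonAssocCommRing B] [IsCommJordan B] [Module F B] [IsScalarTower F B B]
      [SMulCommClass F B B] (Q : B →ₚₗ[F] F) (hQ : IsJordanNorm Q 4) (μ : F), μ ≠ 0 →
      (traceZeroData hQ h2).IsCubicNorm ∧
      Algebra.Etale F (QuadraticRoot μ) ∧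
      ∀ σ : QuadraticRoot μ ≃ₐ[F] QuadraticRoot μ, σ ≠ AlgEquiv.refl →
      ∀ (lam : QuadraticRoot μ) (hlam : lam ∉ Set.range (algebraMap F (QuadraticRoot μ))),
        ((traceZeroData hQ h2).semilinearExt σ lam hlam).IsHermitianCubicNorm σ ∧
        ((∃ b, (traceZeroData hQ h2).norm b ≠ 0) →
          ∃ x, ((traceZeroData hQ h2).semilinearExt σ lam hlam).norm x ≠ 0) ∧
        AlgInvolutionIsomorphic F (CayleyDicksonAlgebra Q μ)
          (HermitianAlgebra σ ((traceZeroData hQ h2).semilinearExt σ lam hlam))) ∧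
    (∀ {J : Type v} [AddCommGroup J] [Module F J] (D : CubicNormData F J),
      D.IsCubicNorm → D.TraceNondegenerate →
      ∀ {K : Type w} [CommRing K] [Algebra F K] [Algebra.IsQuadraticExtension F K]
        [Algebra.Etale F K] (σ : K ≃ₐ[F] K), σ ≠ AlgEquiv.refl →
      ∀ (lam : K) (hlam : lam ∉ Set.range (algebraMap F K)),
        (D.semilinearExt σ lam hlam).IsHermitianCubicNorm σ ∧
        ((∃ b, D.norm b ≠ 0) → ∃ x, (D.semilinearExt σ lam hlam).norm x ≠ 0) ∧
        ∃ (B : Type (max u v)) (_ : NonAssocCommRing B) (_ : IsCommJordan B) (_ : Module F B)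
          (_ : IsScalarTower F B B) (_ : SMulCommClass F B B) (Q : B →ₚₗ[F] F) (μ : F),
          IsJordanNorm Q 4 ∧ μ ≠ 0 ∧
          AlgInvolutionIsomorphic F (HermitianAlgebra σ (D.semilinearExt σ lam hlam))
            (CayleyDicksonAlgebra Q μ)) := by
  have h4 : (4 : F) ≠ 0 := by
    rw [show (4 : F) = 2 * 2 by norm_num]
    exact mul_ne_zero h2 h2
  have h24 : (24 : F) ≠ 0 := by
    rw [show (24 : F) = 4 * 2 * 3 by norm_num]
    exact mul_ne_zero (mul_ne_zero h4 h2) h3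
  constructor
  · intro B _ _ _ _ _ Q hQ μ hμ
    have hD := isCubicNorm_traceZeroData hQ h2 h3
    have hnd := traceNondegenerate_traceZeroData hQ h2
    refine ⟨hD, etale_quadraticRoot h2 hμ, fun σ hσ lam hlam => ?_⟩
    have hι := quadraticRoot_root_notMem_range μ
    have hsq := quadraticRoot_root_mul_root μ
    have hσι := conj_sqrt hσ h2 hι hμ hsq
    refine ⟨hD.isHermitianCubicNorm_semilinearExt hnd h2 h3 (conj_conj hι hσι),
      hD.exists_semilinearExt_norm_ne_zero,
      (isCubicDecomposition_traceZeroData hQ h2).isomorphic h2 (fun x => ?_) hD hnd hι hsq hσι⟩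
    rw [LinearMap.smul_apply, smul_eq_mul, mul_inv_cancel_left₀ h4]
  · intro J _ _ D hD hnd K _ _ _ _ σ hσ lam hlam
    -- The parameter `μ` depends only on how `K` is generated by a square root; the Jordan algebra
    -- `F ⊕ J` does not depend on `K`.
    obtain ⟨ι, μ, hι, hμ, hsq⟩ := exists_sqrt_generator h2 hlam
    have hσι := conj_sqrt hσ h2 hι hμ hsq
    have : Fact D.IsCubicNorm := ⟨hD⟩
    have : Fact D.TraceNondegenerate := ⟨hnd⟩
    have ht := CubicNormAlgebra.isQuarticTrace (D := D) h2 h3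
    have hJ := CubicNormAlgebra.isCommJordan (D := D) h2 h3
    refine ⟨hD.isHermitianCubicNorm_semilinearExt hnd h2 h3 (conj_conj hι hσι),
      hD.exists_semilinearExt_norm_ne_zero, CubicNormAlgebra D, inferInstance, hJ, inferInstance,
      inferInstance, inferInstance, quarticLaw (CubicNormAlgebra.trace D), μ,
      isJordanNorm_quarticLaw h2 h3 ht (CubicNormAlgebra.trace_nondegenerate h2), hμ, ?_⟩
    refine (CubicNormAlgebra.isCubicDecomposition.isomorphic h2 (fun x => ?_) hD hnd hι hsq hσι).symm
    rw [formTrace_quarticLaw h24 ht.one]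
    rfl
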